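/- Let $m,n\in\{1,2,\dots\}$ and, for multi-indices $\alpha,\beta\in\mathbb{Z}_+^n$ with $|\alpha|=m=|\beta|$, let $a_{\alpha,\beta}\in L^\infty(\mathbb{R}^n;\mathbb{C})$. Put $$\mathfrak a_0(f,g):=\sum_{|\alpha|=m=|\beta|}\int_{\mathbb{R}^n}a_{\alpha,\beta}(x)\,\partial^\beta f(x)\,\overline{\partial^\alpha g(x)}\,dx,\qquad |\nabla^m f|^2:=\sum_{|\alpha|=m}|\partial^\alpha f|^2,$$ with weak derivatives, and let $\dot W^{m,2}(\mathbb{R}^n)$ be the space of locally integrable $f$ with $\partial^\alpha f\in L^2(\mathbb{R}^n)$ for all $|\alpha|=m$. Assume the ellipticity condition $(\mathcal E_0)$: there are constants $0<\lambda_0\le\Lambda_0<\infty$ such that, for all $f,g\in\dot W^{m,2}(\mathbb{R}^n)$, $$|\mathfrak a_0(f,g)|\le\Lambda_0\|\nabla^m f\|_{L^2(\mathbb{R}^n)}\|\nabla^m g\|_{L^2(\mathbb{R}^n)}\quad\text{and}\quad \mathrm{Re}\,\mathfrak a_0(f,f)\ge\lambda_0\|\nabla^m f\|_{L^2(\mathbb{R}^n)}^2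 .$$ Let $L$ (formally $\sum_{|\alpha|=m=|\beta|}(-1)^m\partial^\alpha(a_{\alpha,\beta}\partial^\beta)$) be the operator in $L^2(\mathbb{R}^n)$ associated with $\mathfrak a_0$ on the domain $W^{m,2}(\mathbb{R}^n)$: $u\in D(L)$ and $Lu=v$ if and only if $u\in W^{m,2}(\mathbb{R}^n)$, $v\in L^2(\mathbb{R}^n)$ and $\mathfrak a_0(u,\phi)=(v,\phi)_{L^2}$ for all $\phi\in W^{m,2}(\mathbb{R}^n)$. Then $-L$ generates a $C_0$-semigroup $\{e^{-tL}\}_{t\ge0}$ on $L^2(\mathbb{R}^n)$; for all $f\in L^2(\mathbb{R}^n)$ and $t>0$ the function $u(\cdot,t):=e^{-t^{2m}L}f$ belongs to $W^{m,2}(\mathbb{R}^n)$; and there is a positive constant $C$, depending on $n$, $m$ and the coefficients $a_{\alpha,\beta}$ but not on $f$, such that for all $f\in L^2(\mathbb{R}^n)$, $x_0\in\mathbb{R}^n$, $r\in(0,\infty)$ and $t_0\in(3r,\infty)$, $$\int_{t_0-r}^{t_0+r}\int_{B(x_0,r)}|\nabla^m u(x,t)|^2\,dx\,dt\le\frac{C}{r^{2m}}\int_{t_0-2r}^{t_0+2r}\int_{B(x_0,2r)}|u(x,t)|^2\,dx\,dt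 .$$ -/

import Mathlib

open MeasureTheory Filter Topology
open scoped ENNReal ContDiff ComplexConjugate

noncomputable section

/-- Multi-indices in `(ℤ₊)ⁿ` of length exactly `m`. -/
def multiIndices (n m : ℕ) : Finset (Fin n → ℕ) :=
  Finset.piAntidiag Finset.univ m

/-- The first order partial derivative in the `i`-th coordinate direction. -/
def partialDeriv {n : ℕ} (i : Fin n) (φ : EuclideanSpace ℝ (Fin n) → ℝ) :
    EuclideanSpace ℝ (Fin n) → ℝ :=
  fun x => fderiv ℝ φ x (EuclideanSpace.single i 1)

/-- The classical derivative `∂^α φ = ∂₁^{α₁} ⋯ ∂ₙ^{αₙ} φ`; it is used for smooth `φ` only. -/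
def iteratedPartial {n : ℕ} (α : Fin n → ℕ) (φ : EuclideanSpace ℝ (Fin n) → ℝ) :
    EuclideanSpace ℝ (Fin n) → ℝ :=
  (List.finRange n).foldr (fun i ψ => (partialDeriv i)^[α i] ψ) φ

/-- `g` is the weak derivative `∂^α f`: for all test functions `φ ∈ C_c^∞(ℝⁿ)`,
`∫ f ∂^α φ = (-1)^{|α|} ∫ g φ`. -/
def IsWeakDeriv {n : ℕ} (α : Fin n → ℕ) (f g : EuclideanSpace ℝ (Fin n) → ℂ) : Prop :=
  LocallyIntegrable f ∧ LocallyIntegrable g ∧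
    ∀ φ : EuclideanSpace ℝ (Fin n) → ℝ, ContDiff ℝ ∞ φ → HasCompactSupport φ →
      ∫ x, iteratedPartial α φ x • f x = (-1 : ℂ) ^ (∑ i, α i) * ∫ x, φ x • g x

open Classical in
/-- The weak derivative `∂^α f`, unique up to a null set when it exists (and `0` otherwise). -/
def weakDeriv {n : ℕ} (α : Fin n → ℕ) (f : EuclideanSpace ℝ (Fin n) → ℂ) :
    EuclideanSpace ℝ (Fin n) → ℂ :=
  if h : ∃ g, IsWeakDeriv α f g then h.choose else 0

/-- Membership in the homogeneous Sobolev space `Ẇ^{m,2}(ℝⁿ)`. -/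
def MemHomSobolev {n : ℕ} (m : ℕ) (f : EuclideanSpace ℝ (Fin n) → ℂ) : Prop :=
  LocallyIntegrable f ∧ ∀ α ∈ multiIndices n m, ∃ g, IsWeakDeriv α f g ∧ MemLp g 2 volume

/-- Membership in the inhomogeneous Sobolev space `W^{m,2}(ℝⁿ)`. -/
def MemSobolev {n : ℕ} (m : ℕ) (f : EuclideanSpace ℝ (Fin n) → ℂ) : Prop :=
  MemLp f 2 volume ∧
    ∀ k ≤ m, ∀ α ∈ multiIndices n k, ∃ g, IsWeakDeriv α f g ∧ MemLp g 2 volume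

/-- `‖∇^m f‖_{L²} = (∑_{|α|=m} ∫ |∂^α f|²)^{1/2}`. -/
def gradNorm {n : ℕ} (m : ℕ) (f : EuclideanSpace ℝ (Fin n) → ℂ) : ℝ :=
  Real.sqrt (∑ α ∈ multiIndices n m, ∫ x, ‖weakDeriv α f x‖ ^ 2)

/-- The sesquilinear form
`𝔞₀(f, g) = ∑_{|α|=m=|β|} ∫ a_{α,β}(x) ∂^β f(x) conj (∂^α g(x)) dx`. -/
def ellipticForm {n : ℕ} (m : ℕ)
    (a : (Fin n → ℕ) → (Fin n → ℕ) → EuclideanSpace ℝ (Fin n) → ℂ)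
    (f g : EuclideanSpace ℝ (Fin n) → ℂ) : ℂ :=
  ∑ α ∈ multiIndices n m, ∑ β ∈ multiIndices n m,
    ∫ x, a α β x * weakDeriv β f x * conj (weakDeriv α g x)

/-- The ellipticity condition `(𝓔₀)`. -/
def EllipticityCondition {n : ℕ} (m : ℕ)
    (a : (Fin n → ℕ) → (Fin n → ℕ) → EuclideanSpace ℝ (Fin n) → ℂ) : Prop :=
  ∃ lam Lam : ℝ, 0 < lam ∧ lam ≤ Lam ∧
    (∀ f g : EuclideanSpace ℝ (Fin n) → ℂ, MemHomSobolev m f → MemHomSobolev m g →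
      ‖ellipticForm m a f g‖ ≤ Lam * gradNorm m f * gradNorm m g) ∧
    (∀ f : EuclideanSpace ℝ (Fin n) → ℂ, MemHomSobolev m f →
      lam * gradNorm m f ^ 2 ≤ (ellipticForm m a f f).re)

/-- The Hilbert space `L²(ℝⁿ; ℂ)`. -/
abbrev L2Space (n : ℕ) : Type :=
  Lp ℂ 2 (volume : Measure (EuclideanSpace ℝ (Fin n)))

/-- The graph `{(u, Lu) : u ∈ D(L)}` of the operator `L` in `L²(ℝⁿ)` associated with the form
`𝔞₀` with domain `W^{m,2}(ℝⁿ)`: `u ∈ D(L)` and `Lu = v` if and only if `u ∈ W^{m,2}(ℝⁿ)` and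
`𝔞₀(u, φ) = (v, φ)_{L²}` for all `φ ∈ W^{m,2}(ℝⁿ)`. -/
def ellipticOperatorGraph {n : ℕ} (m : ℕ)
    (a : (Fin n → ℕ) → (Fin n → ℕ) → EuclideanSpace ℝ (Fin n) → ℂ) :
    Set (L2Space n × L2Space n) :=
  {p | MemSobolev m p.1 ∧ ∀ φ : EuclideanSpace ℝ (Fin n) → ℂ, MemSobolev m φ →
    ellipticForm m a p.1 φ = ∫ x, p.2 x * conj (φ x)}

/-- `S` is a strongly continuous (`C₀`-) semigroup of bounded operators, indexed by `t ≥ 0`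
(the values of `S` at negative times are irrelevant). -/
structure IsC0Semigroup {X : Type*} [NormedAddCommGroup X] [NormedSpace ℂ X]
    (S : ℝ → X →L[ℂ] X) : Prop where
  zero : S 0 = ContinuousLinearMap.id ℂ X
  add : ∀ s t : ℝ, 0 ≤ s → 0 ≤ t → S (s + t) = (S s).comp (S t)
  tendsto_zero : ∀ x : X, Tendsto (fun t => S t x) (𝓝[>] 0) (𝓝 x)

/-- The graph of the infinitesimal generator `x ↦ lim_{t → 0+} (S t x - x) / t`. -/
def generatorGraph {X : Type*} [NormedAddCommGroup X] [NormedSpace ℂ X]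
    (S : ℝ → X →L[ℂ] X) : Set (X × X) :=
  {p | Tendsto (fun t : ℝ => t⁻¹ • (S t p.1 - p.1)) (𝓝[>] 0) (𝓝 p.2)}

/-- `S` is a `C₀`-semigroup with generator `-T`, where the operator `T` is given by its graph
`G`. -/
def IsSemigroupOfNeg {X : Type*} [NormedAddCommGroup X] [NormedSpace ℂ X]
    (G : Set (X × X)) (S : ℝ → X →L[ℂ] X) : Prop :=
  IsC0Semigroup S ∧ generatorGraph S = {p | (p.1, -p.2) ∈ G}

open Classical in
/-- The semigroup `e^{-tT}`, `t ≥ 0`, generated by `-T`, where the operator `T` is given by its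
graph `G`. A `C₀`-semigroup is determined on `[0, ∞)` by its generator, so the choice is
immaterial there; the value is `0` if `-T` generates no `C₀`-semigroup. -/
def expNeg {X : Type*} [NormedAddCommGroup X] [NormedSpace ℂ X]
    (G : Set (X × X)) : ℝ → X →L[ℂ] X :=
  if h : ∃ S : ℝ → X →L[ℂ] X, IsSemigroupOfNeg G S then h.choose else 0

/-- `u(·, t) = e^{-t^{2m} L} f`. -/
def heatExtension {n : ℕ} (m : ℕ)
    (a : (Fin n → ℕ) → (Fin n → ℕ) → EuclideanSpace ℝ (Fin n) → ℂ)
    (f : L2Space n) (t : ℝ) : L2Space n :=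
  expNeg (ellipticOperatorGraph m a) (t ^ (2 * m)) f

end

/-!
The operator `L` is m-accretive: it is accretive by ellipticity, and `k + L` is onto for `k > 0` by
the Lax–Milgram lemma on `W^{m,2}` (`isMAccretive_ellipticGraph`). Hence `-L` generates a
contraction semigroup by the Hille–Yosida theorem, which is proved by Yosida approximation
(`IsMAccretive.exists_semigroup`). The form is bounded and coercive with respect to the same
seminorm `‖∇^m u‖`, so `L` is sectorial. An energy estimate bounds `t ‖L S(t) f‖` by a multiple of
`‖f‖`; consequently `S(t) f` lies in the domain of `L`, and `L S(t) f` is continuous in `t > 0`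
(`IsSemigroupOfNeg.exists_continuousOn_generator`). In particular `S(t) f ∈ W^{m,2}`.

For the Caccioppoli inequality, let `η` be a cutoff function between `B(x₀, r)` and `B(x₀, 2r)`.
On each time slice, `u` in the domain of `L` is tested against `η^{2(m+1)} u` and Gårding's
inequality is applied to `η^{m+1} u`. By the Leibniz rule (`exists_leibniz`) the two differ by terms
in which `u` is differentiated less than `m` times, weighted by powers of `η` and `1 / r`. These are
absorbed by the weighted interpolation inequality `exists_sum_wsum_le`, itself a consequence of
`‖η^{k+1} ∂_i w‖² ≲ ‖η^k w‖ (‖η^{k+2} ∂_i² w‖ + r⁻¹ ‖η^{k+1} ∂_i w‖)`. The result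
(`exists_spatial_caccioppoli`) is
`‖η^{m+1} ∇^m u‖² ≤ A₁ Re (η^{m+1} u, η^{m+1} L u) + A₂ r^{-2m} ‖η u‖²`.

For `u(t) = S(t^{2m}) f` the real part on the right is `-(4m)⁻¹ t^{1-2m}` times the time derivative
of `‖η^{m+1} u(t)‖²`. Multiplying by `4r² - (t - t₀)²`, which vanishes at `t₀ ± 2r` and is at least
`3r²` on `(t₀ - r, t₀ + r)`, and integrating by parts in time gives the claim
(`lintegral_le_of_slicewise`). The assumption `t₀ > 3r` enters through `t ≥ r` on the time interval,
which bounds `t^{1-2m}` by `r^{1-2m}`.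

Sobolev functions are handled as jets (`IsJet`), that is, families `(∂^γ u)_{|γ| ≤ m}` of elements
of `L²` linked by first order weak derivatives. Integration by parts between two Sobolev functions
(`HasPartial.inner_eq`) rests on the density of test functions in the graph of `∂_i`, which holds
because `∂_i g = ± g` has no solution `g ≠ 0` in `L²`.
-/


/-! ### Maximal accretive operators and their resolvents -/

section Accretive

variable {H : Type*} [NormedAddCommGroup H] [InnerProductSpace ℂ H]

/-- An operator `T` in a complex Hilbert space, given by its graph `G`, is *m-accretive*: it is
single-valued, `Re ⟪u, T u⟫ ≥ 0` on its domain, and `k + T` is onto for every `k > 0`. -/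
structure IsMAccretive (G : Submodule ℂ (H × H)) : Prop where
  single_valued : ∀ v, ((0 : H), v) ∈ G → v = 0
  accretive : ∀ u v, (u, v) ∈ G → 0 ≤ (inner ℂ u v).re
  surjective : ∀ k : ℝ, 0 < k → ∀ f, ∃ u v, (u, v) ∈ G ∧ k • u + v = f

namespace IsMAccretive

variable {G : Submodule ℂ (H × H)}

lemma real_smul_mem {u v : H} (h : (u, v) ∈ G) (k : ℝ) : (k • u, k • v) ∈ G := by
  simpa using G.smul_mem (k : ℂ) h

lemma norm_le (hG : IsMAccretive G) {k : ℝ} {u v : H} (h : (u, v) ∈ G) :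
    k * ‖u‖ ≤ ‖k • u + v‖ := by
  by_cases hu : u = 0
  · simp [hu]
  have hu' : 0 < ‖u‖ := norm_pos_iff.2 hu
  have h1 := hG.accretive u v h
  have h2 : (inner ℂ u (k • u + v)).re = k * ‖u‖ ^ 2 + (inner ℂ u v).re := by
    rw [inner_add_right, ← Complex.coe_smul, inner_smul_right, inner_self_eq_norm_sq_to_K]
    simp [← Complex.ofReal_pow]
  have h3 : (inner ℂ u (k • u + v)).re ≤ ‖u‖ * ‖k • u + v‖ :=
    (Complex.re_le_norm _).trans (norm_inner_le_norm _ _)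
  have : ‖u‖ * (k * ‖u‖) ≤ ‖u‖ * ‖k • u + v‖ := by nlinarith
  exact le_of_mul_le_mul_left this hu'

lemma mem_unique (hG : IsMAccretive G) {k : ℝ} (hk : 0 < k) {u v u' v' : H}
    (h : (u, v) ∈ G) (h' : (u', v') ∈ G) (e : k • u + v = k • u' + v') : u = u' := by
  have h1 := hG.norm_le (k := k) (G.sub_mem h h')
  have h2 : k • (u - u') + (v - v') = 0 := by
    rw [smul_sub]; rw [← sub_eq_zero] at e; rw [← e]; abel
  rw [h2, norm_zero] at h1
  have : ‖u - u'‖ = 0 := le_antisymm (by nlinarith [norm_nonneg (u - u')]) (norm_nonneg _)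
  exact sub_eq_zero.1 (norm_eq_zero.1 this)

lemma value_unique (hG : IsMAccretive G) {u v v' : H}
    (h : (u, v) ∈ G) (h' : (u, v') ∈ G) : v = v' := by
  have := G.sub_mem h h'
  simp only [Prod.mk_sub_mk, sub_self] at this
  exact sub_eq_zero.1 (hG.single_valued _ this)

/-- There is a bounded operator `R = (k + T)⁻¹` of norm at most `1 / k`. -/
lemma exists_resolvent (hG : IsMAccretive G) {k : ℝ} (hk : 0 < k) :
    ∃ R : H →L[ℂ] H, (∀ f, (R f, f - k • R f) ∈ G) ∧ ∀ f, k * ‖R f‖ ≤ ‖f‖ := by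
  choose R V hmem hsum using hG.surjective k hk
  have hV : ∀ f, V f = f - k • R f := fun f => by rw [eq_sub_iff_add_eq', hsum]
  have hbd : ∀ f, k * ‖R f‖ ≤ ‖f‖ := fun f => by
    simpa [hsum] using hG.norm_le (k := k) (hmem f)
  let R' : H →ₗ[ℂ] H :=
    { toFun := R
      map_add' := fun f g => hG.mem_unique hk (hmem _) (G.add_mem (hmem f) (hmem g)) (by
        rw [hsum, smul_add, add_add_add_comm, hsum, hsum])
      map_smul' := fun c f => hG.mem_unique hk (hmem _) (G.smul_mem c (hmem f)) (by
        rw [hsum]; simp only [RingHom.id_apply]; rw [smul_comm, ← smul_add, hsum]) }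
  refine ⟨R'.mkContinuous (1 / k) fun f => ?_, fun f => ?_, fun f => ?_⟩
  · rw [div_mul_eq_mul_div, one_mul, le_div_iff₀ hk, mul_comm]; exact hbd f
  · simpa [R', ← hV f] using hmem f
  · simpa [R'] using hbd f

open Classical in
/-- The resolvent `(k + T)⁻¹`, for `k > 0`. -/
noncomputable def resolvent (G : Submodule ℂ (H × H)) (k : ℝ) : H →L[ℂ] H :=
  if h : ∃ R : H →L[ℂ] H, (∀ f, (R f, f - k • R f) ∈ G) ∧ ∀ f, k * ‖R f‖ ≤ ‖f‖ then h.choose else 0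

lemma resolvent_mem (hG : IsMAccretive G) {k : ℝ} (hk : 0 < k) (f : H) :
    (resolvent G k f, f - k • resolvent G k f) ∈ G := by
  have h := hG.exists_resolvent hk
  rw [resolvent, dif_pos h]; exact h.choose_spec.1 f

lemma norm_resolvent_le (hG : IsMAccretive G) {k : ℝ} (hk : 0 < k) (f : H) :
    ‖k • resolvent G k f‖ ≤ ‖f‖ := by
  have h := hG.exists_resolvent hk
  rw [norm_smul, Real.norm_of_nonneg hk.le, resolvent, dif_pos h]; exact h.choose_spec.2 f

lemma resolvent_eq (hG : IsMAccretive G) {k : ℝ} (hk : 0 < k) {u v : H} (h : (u, v) ∈ G) :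
    resolvent G k (k • u + v) = u :=
  hG.mem_unique hk (hG.resolvent_mem hk _) h (by abel)

/-- `T` commutes with its resolvent. -/
lemma resolvent_mem_resolvent (hG : IsMAccretive G) {k : ℝ} (hk : 0 < k) {u v : H}
    (h : (u, v) ∈ G) : (resolvent G k u, resolvent G k v) ∈ G := by
  have h1 := hG.resolvent_mem hk u
  have h2 : resolvent G k v = u - k • resolvent G k u := by
    have := hG.resolvent_eq hk h
    rw [map_add, ContinuousLinearMap.map_smul_of_tower] at this
    exact eq_sub_of_add_eq' this
  rwa [h2]

lemma resolvent_comm (hG : IsMAccretive G) {j k : ℝ} (hj : 0 < j) (hk : 0 < k) (f : H) :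
    resolvent G j (resolvent G k f) = resolvent G k (resolvent G j f) := by
  have h1 := hG.resolvent_mem_resolvent hj (hG.resolvent_mem hk f)
  rw [← hG.resolvent_eq hk h1, map_sub, ContinuousLinearMap.map_smul_of_tower, add_sub_cancel]

/-- The domain of an m-accretive operator is dense. -/
lemma dense_domain [CompleteSpace H] (hG : IsMAccretive G) : Dense {u : H | ∃ v, (u, v) ∈ G} := by
  have : {u : H | ∃ v, (u, v) ∈ G} = (G.map (LinearMap.fst ℂ H H) : Set H) := by
    ext u; simp
  rw [this, Submodule.dense_iff_topologicalClosure_eq_top,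
    Submodule.topologicalClosure_eq_top_iff, Submodule.eq_bot_iff]
  intro g hg
  obtain ⟨u, v, huv, e⟩ := hG.surjective 1 one_pos g
  have h0 : inner ℂ u g = 0 := by
    rw [Submodule.mem_orthogonal] at hg
    exact hg u ⟨(u, v), huv, rfl⟩
  have h1 := hG.accretive u v huv
  have h2 : (inner ℂ u g).re = ‖u‖ ^ 2 + (inner ℂ u v).re := by
    rw [← e, one_smul, inner_add_right, inner_self_eq_norm_sq_to_K]
    simp [← Complex.ofReal_pow]
  rw [h0, Complex.zero_re] at h2
  have hu : u = 0 := by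
    have : ‖u‖ ^ 2 = 0 := le_antisymm (by linarith) (sq_nonneg _)
    simpa using this
  subst hu
  rw [← e, hG.single_valued v huv]; simp

/-- An m-accretive operator is closed. -/
lemma isClosed (hG : IsMAccretive G) : IsClosed (G : Set (H × H)) := by
  have : (G : Set (H × H)) = {p | resolvent G 1 (p.1 + p.2) = p.1} := by
    ext ⟨u, v⟩
    refine ⟨fun h => by simpa using hG.resolvent_eq one_pos h, fun h => ?_⟩
    have h1 := hG.resolvent_mem one_pos (u + v)
    rw [Set.mem_ofPred_eq] at h
    simp only at h
    rw [h] at h1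
    simpa using h1
  rw [this]
  exact isClosed_eq (by fun_prop) (by fun_prop)

/-- The Yosida approximation `k (k R - 1) = - T k R`, with `R = (k + T)⁻¹`, of `-T`. -/
noncomputable def yosida (G : Submodule ℂ (H × H)) (k : ℝ) : H →L[ℂ] H :=
  k • (k • resolvent G k - 1)

lemma yosida_apply (k : ℝ) (x : H) : yosida G k x = k • (k • resolvent G k x - x) := by
  simp [yosida]

lemma yosida_of_mem (hG : IsMAccretive G) {k : ℝ} (hk : 0 < k) {u v : H} (h : (u, v) ∈ G) :
    yosida G k u = - (k • resolvent G k v) := by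
  have := hG.resolvent_eq hk h
  rw [map_add, ContinuousLinearMap.map_smul_of_tower] at this
  rw [yosida_apply, ← smul_neg]
  congr 1
  rw [sub_eq_iff_eq_add]
  exact (eq_sub_of_add_eq this).trans (by abel)

lemma yosida_comm (hG : IsMAccretive G) {j k : ℝ} (hj : 0 < j) (hk : 0 < k) :
    Commute (yosida G j) (yosida G k) := by
  have h : Commute (resolvent G j) (resolvent G k) :=
    ContinuousLinearMap.ext fun f => hG.resolvent_comm hj hk f
  have h1 : Commute (j • resolvent G j - 1) (k • resolvent G k - 1) :=
    (((h.smul_left j).smul_right k).sub_left (Commute.one_left _)).sub_right (Commute.one_right _)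
  exact (h1.smul_left j).smul_right k

lemma yosida_dissipative (hG : IsMAccretive G) {k : ℝ} (hk : 0 < k) (x : H) :
    (inner ℂ x (yosida G k x)).re ≤ 0 := by
  rw [yosida_apply, ← Complex.coe_smul, inner_smul_right, inner_sub_right,
    inner_self_eq_norm_sq_to_K]
  have h1 : (inner ℂ x (k • resolvent G k x)).re ≤ ‖x‖ * ‖x‖ :=
    ((Complex.re_le_norm _).trans (norm_inner_le_norm _ _)).trans
      (mul_le_mul_of_nonneg_left (hG.norm_resolvent_le hk x) (norm_nonneg _))
  simp only [Complex.re_ofReal_mul, Complex.sub_re, Complex.coe_algebraMap]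
  rw [← Complex.ofReal_pow, Complex.ofReal_re]
  exact mul_nonpos_of_nonneg_of_nonpos hk.le (by nlinarith)

lemma norm_yosida_le (hG : IsMAccretive G) {k : ℝ} (hk : 0 < k) {x y : H} (h : (x, y) ∈ G) :
    ‖yosida G k x‖ ≤ ‖y‖ := by
  rw [hG.yosida_of_mem hk h, norm_neg]; exact hG.norm_resolvent_le hk y

lemma norm_yosida_yosida_le (hG : IsMAccretive G) {k : ℝ} (hk : 0 < k) {x y z : H}
    (h : (x, y) ∈ G) (h' : (y, z) ∈ G) : ‖yosida G k (yosida G k x)‖ ≤ ‖z‖ := by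
  have h1 := real_smul_mem (hG.resolvent_mem_resolvent hk h') k
  rw [hG.yosida_of_mem hk h, map_neg, norm_neg]
  exact (hG.norm_yosida_le hk h1).trans (hG.norm_resolvent_le hk z)

/-- If `-T` is known to be contained in the generator of a contraction semigroup, then it is the
generator, because the generator is dissipative and `1 + T` is onto. -/
lemma generator_eq (hG : IsMAccretive G) {S : ℝ → H →L[ℂ] H}
    (hc : ∀ t, 0 ≤ t → ∀ x, ‖S t x‖ ≤ ‖x‖)
    (hgen : ∀ x y, (x, y) ∈ G → Tendsto (fun t : ℝ => t⁻¹ • (S t x - x)) (𝓝[>] 0) (𝓝 (-y))) :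
    generatorGraph S = {p : H × H | (p.1, -p.2) ∈ (G : Set (H × H))} := by
  ext ⟨x, z⟩
  refine ⟨fun h => ?_, fun h => by
    have := hgen x (-z) h
    rwa [neg_neg] at this⟩
  simp only [generatorGraph, Set.mem_ofPred_eq] at h
  obtain ⟨u, v, huv, e⟩ := hG.surjective 1 one_pos (x - z)
  rw [one_smul] at e
  have hd : Tendsto (fun t : ℝ => t⁻¹ • (S t (x - u) - (x - u))) (𝓝[>] 0) (𝓝 (x - u)) := by
    have e2 : x - u = z - -v := by
      rw [sub_neg_eq_add, sub_eq_iff_eq_add, add_assoc, add_comm v u, e]; abel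
    nth_rewrite 3 [e2]
    refine (h.sub (hgen u v huv)).congr fun t => ?_
    rw [← smul_sub, map_sub]; congr 1; abel
  set d := x - u
  have h2 : Tendsto (fun t : ℝ => (inner ℂ d (t⁻¹ • (S t d - d))).re) (𝓝[>] 0)
      (𝓝 (inner ℂ d d).re) :=
    (Complex.continuous_re.tendsto _).comp ((tendsto_const_nhds (x := d)).inner hd)
  have h3 : (inner ℂ d d).re ≤ 0 := by
    refine le_of_tendsto h2 ?_
    filter_upwards [self_mem_nhdsWithin] with t (ht : 0 < t)
    rw [← Complex.coe_smul, inner_smul_right, Complex.re_ofReal_mul, inner_sub_right,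
      inner_self_eq_norm_sq_to_K]
    have h4 : (inner ℂ d (S t d)).re ≤ ‖d‖ * ‖d‖ :=
      ((Complex.re_le_norm _).trans (norm_inner_le_norm _ _)).trans
        (mul_le_mul_of_nonneg_left (hc t ht.le d) (norm_nonneg _))
    simp only [Complex.sub_re, Complex.coe_algebraMap]
    rw [← Complex.ofReal_pow, Complex.ofReal_re]
    exact mul_nonpos_of_nonneg_of_nonpos (by positivity) (by nlinarith)
  have hd0 : d = 0 := by
    have h5 : (inner ℂ d d).re = ‖d‖ ^ 2 := by
      rw [inner_self_eq_norm_sq_to_K]; simp [← Complex.ofReal_pow]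
    rw [h5] at h3
    have : ‖d‖ ^ 2 = 0 := le_antisymm h3 (sq_nonneg _)
    simpa using this
  have hxu : x = u := sub_eq_zero.1 hd0
  have hv : v = -z := by
    rw [hxu] at e
    have : u + v = u + -z := by rw [e]; abel
    exact add_left_cancel this
  simp only [Set.mem_ofPred_eq, SetLike.mem_coe]
  rw [hxu, ← hv]; exact huv

/-- `k (k + T)⁻¹ y → y` as `k → ∞`. -/
lemma tendsto_smul_resolvent [CompleteSpace H] (hG : IsMAccretive G) (y : H) :
    Tendsto (fun j : ℕ => ((j : ℝ) + 1) • resolvent G ((j : ℝ) + 1) y) atTop (𝓝 y) := by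
  have hpos : ∀ j : ℕ, (0 : ℝ) < (j : ℝ) + 1 := fun j => by positivity
  rw [Metric.tendsto_atTop]
  intro ε hε
  obtain ⟨z, hz, ⟨w, hzw⟩⟩ := Metric.dense_iff.1 hG.dense_domain y (ε / 3) (by positivity)
  rw [Metric.mem_ball, dist_eq_norm] at hz
  obtain ⟨N, hN⟩ := exists_nat_gt (‖w‖ / (ε / 3))
  refine ⟨N, fun j hj => ?_⟩
  have hk := hpos j
  set k : ℝ := (j : ℝ) + 1
  have e : k • resolvent G k y - y = k • resolvent G k (y - z) + (z - y) - resolvent G k w := by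
    have h1 := hG.resolvent_eq hk hzw
    rw [map_add, ContinuousLinearMap.map_smul_of_tower] at h1
    rw [map_sub, smul_sub, ← h1]
    simp only [h1]
    nth_rewrite 2 [← h1]
    abel
  have h2 : ‖resolvent G k w‖ < ε / 3 := by
    have h3 := hG.norm_resolvent_le hk w
    rw [norm_smul, Real.norm_of_nonneg hk.le] at h3
    have h4 : ‖w‖ < k * (ε / 3) := by
      rw [div_lt_iff₀ (by positivity)] at hN
      have : (N : ℝ) ≤ k := by
        have : (N : ℝ) ≤ j := by exact_mod_cast hj
        simp only [k]; linarith
      nlinarith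
    exact lt_of_mul_lt_mul_left (h3.trans_lt h4) hk.le
  rw [dist_eq_norm, e]
  calc _ ≤ ‖k • resolvent G k (y - z)‖ + ‖z - y‖ + ‖resolvent G k w‖ :=
        (norm_sub_le _ _).trans (add_le_add_left (norm_add_le _ _) _)
    _ ≤ ‖y - z‖ + ‖z - y‖ + ‖resolvent G k w‖ := by
        gcongr; exact hG.norm_resolvent_le hk _
    _ < ε / 3 + ε / 3 + ε / 3 := by
        rw [norm_sub_rev y z]; gcongr
    _ = ε := by ring

end IsMAccretive

/-! ### Exponentials of bounded dissipative operators -/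

variable [CompleteSpace H]

lemma hasDerivAt_exp_smul_apply (A : H →L[ℂ] H) (x : H) (t : ℝ) :
    HasDerivAt (fun s : ℝ => NormedSpace.exp (s • A) x) (NormedSpace.exp (t • A) (A x)) t :=
  (((ContinuousLinearMap.apply ℂ H x).restrictScalars ℝ).hasFDerivAt.comp_hasDerivAt t
    (hasDerivAt_exp_smul_const (𝕂 := ℝ) A t) :)

lemma exp_smul_apply_comm (A : H →L[ℂ] H) (x : H) (t : ℝ) :
    NormedSpace.exp (t • A) (A x) = A (NormedSpace.exp (t • A) x) := by
  have h : Commute (NormedSpace.exp (t • A)) A := ((Commute.refl A).smul_left t).exp_left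
  exact DFunLike.congr_fun h.eq x

/-- A bounded dissipative operator generates a contraction semigroup. -/
lemma norm_exp_smul_apply_le {A : H →L[ℂ] H} (hA : ∀ x, (inner ℂ x (A x)).re ≤ 0)
    {t : ℝ} (ht : 0 ≤ t) (x : H) : ‖NormedSpace.exp (t • A) x‖ ≤ ‖x‖ := by
  let : InnerProductSpace ℝ H := InnerProductSpace.rclikeToReal ℂ H
  have hd : ∀ s, HasDerivAt (fun s : ℝ => ‖NormedSpace.exp (s • A) x‖ ^ 2)
      (2 * inner ℝ (NormedSpace.exp (s • A) x) (NormedSpace.exp (s • A) (A x))) s :=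
    fun s => (hasDerivAt_exp_smul_apply A x s).norm_sq
  have hanti : Antitone (fun s : ℝ => ‖NormedSpace.exp (s • A) x‖ ^ 2) :=
    antitone_of_deriv_nonpos (fun s => (hd s).differentiableAt) fun s => by
      rw [(hd s).deriv, exp_smul_apply_comm, real_inner_eq_re_inner ℂ]
      have := hA (NormedSpace.exp (s • A) x)
      simp only [RCLike.re_to_complex]
      linarith
  have := hanti ht
  simp only [zero_smul, NormedSpace.exp_zero, one_apply_eq_self] at this
  exact le_of_sq_le_sq this (norm_nonneg _)

/-- The comparison of two commuting contraction semigroups with bounded generators. -/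
lemma norm_exp_smul_sub_exp_smul_le {A B : H →L[ℂ] H} (hA : ∀ x, (inner ℂ x (A x)).re ≤ 0)
    (hB : ∀ x, (inner ℂ x (B x)).re ≤ 0) (hAB : Commute A B) {t : ℝ} (ht : 0 ≤ t) (x : H) :
    ‖NormedSpace.exp (t • A) x - NormedSpace.exp (t • B) x‖ ≤ t * ‖A x - B x‖ := by
  let c : ℝ → (H →L[ℂ] H) := fun s => NormedSpace.exp (s • A) * NormedSpace.exp ((t - s) • B)
  have hc : ∀ s, HasDerivAt c
      (NormedSpace.exp (s • A) * NormedSpace.exp ((t - s) • B) * (A - B)) s := fun s => by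
    have h1 := hasDerivAt_exp_smul_const (𝕂 := ℝ) A s
    have h2 := (hasDerivAt_exp_smul_const (𝕂 := ℝ) B (t - s)).scomp s
      ((hasDerivAt_const s t).sub (hasDerivAt_id s))
    refine (h1.mul h2).congr_deriv ?_
    have h3 : A * NormedSpace.exp ((t - s) • B) = NormedSpace.exp ((t - s) • B) * A :=
      ((hAB.smul_right (t - s)).exp_right).eq
    simp only [Function.comp_apply]
    rw [mul_assoc, h3, zero_sub, neg_smul, one_smul, mul_neg, mul_sub, mul_assoc, mul_assoc,
      ← sub_eq_add_neg]
  have hd : ∀ s, HasDerivAt (fun s => c s x)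
      (NormedSpace.exp (s • A) (NormedSpace.exp ((t - s) • B) (A x - B x))) s := fun s =>
    (((ContinuousLinearMap.apply ℂ H x).restrictScalars ℝ).hasFDerivAt.comp_hasDerivAt s (hc s) :)
  have := norm_image_sub_le_of_norm_deriv_le_segment' (a := 0) (b := t)
    (fun s _ => (hd s).hasDerivWithinAt) (C := ‖A x - B x‖)
    (fun s hs => (norm_exp_smul_apply_le hA hs.1 _).trans
      (norm_exp_smul_apply_le hB (by linarith [hs.2]) _)) t ⟨ht, le_rfl⟩
  simpa [c, mul_comm] using this

lemma norm_exp_smul_sub_self_le {A : H →L[ℂ] H} (hA : ∀ x, (inner ℂ x (A x)).re ≤ 0)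
    {t : ℝ} (ht : 0 ≤ t) (x : H) : ‖NormedSpace.exp (t • A) x - x‖ ≤ t * ‖A x‖ := by
  simpa using norm_exp_smul_sub_exp_smul_le hA (B := 0) (by simp) (Commute.zero_right A) ht x

lemma norm_exp_smul_sub_self_sub_le {A : H →L[ℂ] H} (hA : ∀ x, (inner ℂ x (A x)).re ≤ 0)
    {t : ℝ} (ht : 0 ≤ t) (x : H) :
    ‖NormedSpace.exp (t • A) x - x - t • A x‖ ≤ t ^ 2 * ‖A (A x)‖ := by
  have hd : ∀ s : ℝ, HasDerivAt (fun s : ℝ => NormedSpace.exp (s • A) x - s • A x)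
      (NormedSpace.exp (s • A) (A x) - A x) s := fun s =>
    ((hasDerivAt_exp_smul_apply A x s).sub ((hasDerivAt_id s).smul_const (A x))).congr_deriv
      (by simp)
  have := norm_image_sub_le_of_norm_deriv_le_segment' (a := 0) (b := t)
    (fun s _ => (hd s).hasDerivWithinAt) (C := t * ‖A (A x)‖)
    (fun s hs => (norm_exp_smul_sub_self_le hA hs.1 _).trans
      (mul_le_mul_of_nonneg_right hs.2.le (norm_nonneg _))) t ⟨ht, le_rfl⟩
  calc _ = _ := by congr 1; simp; abel
    _ ≤ _ := this
    _ = _ := by ring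

/-! ### The Hille–Yosida theorem for m-accretive operators -/

namespace IsMAccretive

variable {G : Submodule ℂ (H × H)}

/-- The semigroup generated by the `j`-th Yosida approximation. -/
noncomputable def approx (G : Submodule ℂ (H × H)) (j : ℕ) (t : ℝ) : H →L[ℂ] H :=
  NormedSpace.exp (t • yosida G ((j : ℝ) + 1))

lemma norm_approx_le (hG : IsMAccretive G) (j : ℕ) {t : ℝ} (ht : 0 ≤ t) (x : H) :
    ‖approx G j t x‖ ≤ ‖x‖ :=
  norm_exp_smul_apply_le (hG.yosida_dissipative (by positivity)) ht x

lemma tendsto_yosida (hG : IsMAccretive G) {x y : H} (h : (x, y) ∈ G) :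
    Tendsto (fun j : ℕ => yosida G ((j : ℝ) + 1) x) atTop (𝓝 (-y)) := by
  refine (hG.tendsto_smul_resolvent y).neg.congr fun j => ?_
  rw [hG.yosida_of_mem (by positivity) h]

lemma exists_tendsto_approx (hG : IsMAccretive G) {t : ℝ} (ht : 0 ≤ t) (x : H) :
    ∃ y, Tendsto (fun j => approx G j t x) atTop (𝓝 y) := by
  apply cauchySeq_tendsto_of_complete
  rw [Metric.cauchySeq_iff]
  intro ε hε
  obtain ⟨z, hz, ⟨w, hzw⟩⟩ := Metric.dense_iff.1 hG.dense_domain x (ε / 4) (by positivity)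
  rw [Metric.mem_ball, dist_eq_norm] at hz
  obtain ⟨N, hN⟩ := Metric.cauchySeq_iff.1 (hG.tendsto_yosida hzw).cauchySeq
    (ε / (4 * (t + 1))) (by positivity)
  refine ⟨N, fun i hi j hj => ?_⟩
  have h1 := hN i hi j hj
  rw [dist_eq_norm] at h1 ⊢
  have h2 : ‖approx G i t z - approx G j t z‖ ≤ ε / 4 := by
    refine (norm_exp_smul_sub_exp_smul_le (hG.yosida_dissipative (by positivity))
      (hG.yosida_dissipative (by positivity)) (hG.yosida_comm (by positivity) (by positivity))
      ht z).trans ?_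
    calc _ ≤ (t + 1) * (ε / (4 * (t + 1))) := by gcongr; linarith
      _ = ε / 4 := by field_simp
  have e : approx G i t x - approx G j t x =
      approx G i t (x - z) + (approx G i t z - approx G j t z) + approx G j t (z - x) := by
    simp only [map_sub]; abel
  rw [e]
  calc _ ≤ ‖approx G i t (x - z)‖ + ‖approx G i t z - approx G j t z‖ + ‖approx G j t (z - x)‖ :=
        norm_add₃_le
    _ ≤ ‖z - x‖ + ε / 4 + ‖z - x‖ := by
        gcongr
        · rw [norm_sub_rev z x]; exact hG.norm_approx_le i ht _
        · exact hG.norm_approx_le j ht _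
    _ < ε := by linarith

lemma exists_limit (hG : IsMAccretive G) (t : ℝ) :
    ∃ S : H →L[ℂ] H, 0 ≤ t → ∀ x, Tendsto (fun j => approx G j t x) atTop (𝓝 (S x)) := by
  by_cases ht : 0 ≤ t
  · choose f hf using hG.exists_tendsto_approx ht
    exact ⟨continuousLinearMapOfTendsto (fun j => approx G j t) (tendsto_pi_nhds.2 hf),
      fun _ x => hf x⟩
  · exact ⟨0, fun h => absurd h ht⟩

/-- The Hille–Yosida theorem: the negative of an m-accretive operator generates a
`C₀`-semigroup. -/
theorem exists_semigroup (hG : IsMAccretive G) :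
    ∃ S : ℝ → H →L[ℂ] H, IsSemigroupOfNeg (G : Set (H × H)) S := by
  choose S hS using hG.exists_limit
  have hc : ∀ t, 0 ≤ t → ∀ x, ‖S t x‖ ≤ ‖x‖ := fun t ht x =>
    le_of_tendsto (hS t ht x).norm (Eventually.of_forall fun j => hG.norm_approx_le j ht x)
  have hlip : ∀ x y, (x, y) ∈ G → ∀ t, 0 ≤ t → ‖S t x - x‖ ≤ t * ‖y‖ := fun x y h t ht => by
    refine le_of_tendsto ((hS t ht x).sub_const x).norm (Eventually.of_forall fun j => ?_)
    refine (norm_exp_smul_sub_self_le (hG.yosida_dissipative (by positivity)) ht x).trans ?_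
    gcongr
    exact hG.norm_yosida_le (by positivity) h
  have hlip2 : ∀ x y z, (x, y) ∈ G → (y, z) ∈ G → ∀ t, 0 ≤ t →
      ‖S t x - x - t • (-y)‖ ≤ t ^ 2 * ‖z‖ := fun x y z h h' t ht => by
    refine le_of_tendsto (((hS t ht x).sub_const x).sub
      ((hG.tendsto_yosida h).const_smul t)).norm (Eventually.of_forall fun j => ?_)
    refine (norm_exp_smul_sub_self_sub_le (hG.yosida_dissipative (by positivity)) ht x).trans ?_
    gcongr
    exact hG.norm_yosida_yosida_le (by positivity) h h'
  refine ⟨S, ⟨?_, ?_, ?_⟩, hG.generator_eq hc fun x y hxy => ?_⟩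
  · ext x
    refine tendsto_nhds_unique (hS 0 le_rfl x) ?_
    simp [approx]
  · intro s t hs ht
    ext x
    refine tendsto_nhds_unique (hS (s + t) (add_nonneg hs ht) x) ?_
    let : NormedAlgebra ℚ (H →L[ℂ] H) := NormedAlgebra.restrictScalars ℚ ℝ _
    have e : ∀ j, approx G j (s + t) x = approx G j s (approx G j t x) := fun j => by
      rw [approx, add_smul, NormedSpace.exp_add_of_commute
        (((Commute.refl _).smul_left s).smul_right t)]; rfl
    have h1 : Tendsto (fun j => approx G j s (approx G j t x - S t x)) atTop (𝓝 0) := by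
      refine squeeze_zero_norm (fun j => hG.norm_approx_le j hs _) ?_
      simpa using ((hS t ht x).sub_const (S t x)).norm
    simpa [e] using h1.add (hS s hs (S t x))
  · intro x
    rw [Metric.tendsto_nhdsWithin_nhds]
    intro ε hε
    obtain ⟨z, hz, ⟨w, hzw⟩⟩ := Metric.dense_iff.1 hG.dense_domain x (ε / 3) (by positivity)
    rw [Metric.mem_ball, dist_eq_norm] at hz
    refine ⟨ε / (3 * (‖w‖ + 1)), by positivity, fun {t} (ht : 0 < t) htd => ?_⟩
    rw [dist_eq_norm, sub_zero, Real.norm_of_nonneg ht.le, lt_div_iff₀ (by positivity)] at htd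
    have e : S t x - x = S t (x - z) + (S t z - z) + (z - x) := by
      simp only [map_sub]; abel
    rw [dist_eq_norm, e]
    calc _ ≤ ‖S t (x - z)‖ + ‖S t z - z‖ + ‖z - x‖ := norm_add₃_le
      _ ≤ ‖z - x‖ + t * ‖w‖ + ‖z - x‖ := by
          gcongr
          · rw [norm_sub_rev z x]; exact hc t ht.le _
          · exact hlip z w hzw t ht.le
      _ < ε := by nlinarith
  · rw [Metric.tendsto_nhdsWithin_nhds]
    intro ε hε
    -- approximation of `x` in the graph norm by an element `x'` of the domain of `T²`
    obtain ⟨j, hj⟩ := ((Metric.tendsto_atTop.1 (hG.tendsto_smul_resolvent y)) (ε / 3)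
      (by positivity))
    have hjj := hj j le_rfl
    have hk : (0 : ℝ) < (j : ℝ) + 1 := by positivity
    set k : ℝ := (j : ℝ) + 1
    set x' := k • resolvent G k x
    set y' := k • resolvent G k y
    have h1 : (x', y') ∈ G := real_smul_mem (hG.resolvent_mem_resolvent hk hxy) k
    obtain ⟨z, h2⟩ : ∃ z, (y', z) ∈ G := ⟨_, real_smul_mem (hG.resolvent_mem hk y) k⟩
    rw [dist_eq_norm, norm_sub_rev] at hjj
    refine ⟨ε / (3 * (‖z‖ + 1)), by positivity, fun {t} (ht : 0 < t) htd => ?_⟩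
    rw [dist_eq_norm, sub_zero, Real.norm_of_nonneg ht.le, lt_div_iff₀ (by positivity)] at htd
    have e : t⁻¹ • (S t x - x) - -y = t⁻¹ • (S t (x - x') - (x - x')) +
        t⁻¹ • (S t x' - x' - t • (-y')) + (y - y') := by
      rw [smul_sub _ (S t x' - x'), inv_smul_smul₀ ht.ne', map_sub]
      simp only [smul_sub]; abel
    rw [dist_eq_norm, e]
    have b1 : ‖t⁻¹ • (S t (x - x') - (x - x'))‖ ≤ ‖y - y'‖ := by
      rw [norm_smul, norm_inv, Real.norm_of_nonneg ht.le, inv_mul_le_iff₀ ht]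
      exact hlip _ _ (G.sub_mem hxy h1) t ht.le
    have b2 : ‖t⁻¹ • (S t x' - x' - t • (-y'))‖ ≤ t * ‖z‖ := by
      rw [norm_smul, norm_inv, Real.norm_of_nonneg ht.le, inv_mul_le_iff₀ ht]
      refine (hlip2 _ _ _ h1 h2 t ht.le).trans (le_of_eq (by ring))
    calc _ ≤ ‖t⁻¹ • (S t (x - x') - (x - x'))‖ + ‖t⁻¹ • (S t x' - x' - t • (-y'))‖ + ‖y - y'‖ :=
          norm_add₃_le
      _ ≤ ‖y - y'‖ + t * ‖z‖ + ‖y - y'‖ := by gcongr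
      _ < ε := by nlinarith

end IsMAccretive

end Accretive

/-! ### Orbits of the semigroup generated by an m-accretive operator -/

section Orbits

variable {H : Type*} [NormedAddCommGroup H] [InnerProductSpace ℂ H]
  {G : Submodule ℂ (H × H)} {S : ℝ → H →L[ℂ] H}

lemma IsC0Semigroup.continuousOn (hS : IsC0Semigroup S) {δ M : ℝ}
    (hM : ∀ t, 0 ≤ t → t ≤ δ → ‖S t‖ ≤ M) (x : H) :
    ContinuousOn (fun t => S t x) (Set.Icc 0 δ) := by
  by_cases hδ : 0 ≤ δ
  swap
  · rw [Set.Icc_eq_empty hδ]; exact continuousOn_empty _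
  have hM0 : 0 ≤ M := (norm_nonneg _).trans (hM 0 le_rfl hδ)
  have key : ∀ a b, 0 ≤ a → a ≤ b → b ≤ δ → ‖S b x - S a x‖ ≤ M * ‖S (b - a) x - x‖ := by
    intro a b ha hab hb
    have h1 : S b x = S a (S (b - a) x) := by
      have := hS.add a (b - a) ha (sub_nonneg.2 hab)
      rw [add_sub_cancel] at this
      rw [this]; rfl
    rw [h1, ← map_sub]
    exact (S a).le_of_opNorm_le (hM a ha (hab.trans hb)) _
  rw [Metric.continuousOn_iff]
  intro b hb ε hε
  obtain ⟨η, hη, h⟩ := (Metric.tendsto_nhdsWithin_nhds.1 (hS.tendsto_zero x)) (ε / (M + 1))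
    (by positivity)
  refine ⟨η, hη, fun a ha hab => ?_⟩
  have h' : ∀ s, 0 < s → s < η → M * ‖S s x - x‖ < ε := fun s hs hsη => by
    have := h (x := s) hs (by rwa [dist_zero_right, Real.norm_of_nonneg hs.le])
    rw [dist_eq_norm, lt_div_iff₀ (by positivity)] at this
    nlinarith [norm_nonneg (S s x - x)]
  rw [Real.dist_eq] at hab
  rcases lt_trichotomy a b with hlt | rfl | hlt
  · rw [dist_comm, dist_eq_norm]
    exact (key a b ha.1 hlt.le hb.2).trans_lt (h' _ (sub_pos.2 hlt)
      ((le_abs_self _).trans_lt (by rwa [abs_sub_comm])))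
  · simpa using hε
  · rw [dist_eq_norm]
    exact (key b a hb.1 hlt.le ha.2).trans_lt (h' _ (sub_pos.2 hlt) ((le_abs_self _).trans_lt hab))

/-- A function with nonpositive right derivative is nonincreasing. -/
lemma le_of_hasDerivWithinAt_nonpos {f f' : ℝ → ℝ} {a b : ℝ} (hab : a ≤ b)
    (hf : ContinuousOn f (Set.Icc a b))
    (hf' : ∀ t ∈ Set.Ico a b, HasDerivWithinAt f (f' t) (Set.Ici t) t)
    (hneg : ∀ t ∈ Set.Ico a b, f' t ≤ 0) : f b ≤ f a :=
  image_le_of_deriv_right_le_deriv_boundary hf hf' (B := fun _ => f a) (B' := fun _ => 0) le_rfl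
    continuousOn_const (fun _ _ => hasDerivWithinAt_const _ _ _) hneg ⟨hab, le_rfl⟩

lemma hasDerivWithinAt_norm_sq {y : ℝ → H} {y' : H} {s : Set ℝ} {t : ℝ}
    (h : HasDerivWithinAt y y' s t) :
    HasDerivWithinAt (fun t => ‖y t‖ ^ 2) (2 * (inner ℂ (y t) y').re) s t := by
  let : InnerProductSpace ℝ H := InnerProductSpace.rclikeToReal ℂ H
  have := h.norm_sq
  rwa [real_inner_eq_re_inner ℂ] at this

namespace IsSemigroupOfNeg

variable (hS : IsSemigroupOfNeg (G : Set (H × H)) S)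
include hS

lemma tendsto_of_mem {x y : H} (h : (x, y) ∈ G) :
    Tendsto (fun t : ℝ => t⁻¹ • (S t x - x)) (𝓝[>] 0) (𝓝 (-y)) := by
  have : (x, -y) ∈ generatorGraph S := by
    rw [hS.2]; simpa [Set.mem_ofPred_eq] using h
  exact this

/-- The domain of the generator is invariant under the semigroup, which commutes with the
generator. -/
lemma apply_mem {x y : H} (h : (x, y) ∈ G) {t : ℝ} (ht : 0 ≤ t) : (S t x, S t y) ∈ G := by
  have : (S t x, -S t y) ∈ generatorGraph S := by
    have h1 := ((S t).continuous.tendsto _).comp (hS.tendsto_of_mem h)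
    rw [map_neg] at h1
    refine h1.congr' ?_
    filter_upwards [self_mem_nhdsWithin] with s (hs : 0 < s)
    have e1 : S s (S t x) = S t (S s x) := by
      have a1 := hS.1.add s t hs.le ht
      have a2 := hS.1.add t s ht hs.le
      rw [add_comm, a2] at a1
      exact (DFunLike.congr_fun a1 x).symm
    simp [e1, ← Complex.coe_smul]
  rw [hS.2] at this
  simpa [Set.mem_ofPred_eq] using this

lemma hasDerivWithinAt_of_mem_apply {f v : H} {t : ℝ} (ht : 0 ≤ t) (h : (S t f, v) ∈ G) :
    HasDerivWithinAt (fun s => S s f) (-v) (Set.Ici t) t := by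
  rw [← hasDerivWithinAt_Ioi_iff_Ici, hasDerivWithinAt_iff_tendsto_slope' Set.self_notMem_Ioi]
  have h2 : Tendsto (fun s => s - t) (𝓝[>] t) (𝓝[>] 0) := by
    refine tendsto_nhdsWithin_iff.2 ⟨?_, ?_⟩
    · refine Tendsto.mono_left ?_ nhdsWithin_le_nhds
      simpa using (continuous_sub_right t).tendsto t
    · filter_upwards [self_mem_nhdsWithin] with s (hs : t < s)
      exact sub_pos.2 hs
  refine ((hS.tendsto_of_mem h).comp h2).congr' ?_
  filter_upwards [self_mem_nhdsWithin] with s (hs : t < s)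
  have a1 := hS.1.add (s - t) t (sub_nonneg.2 hs.le) ht
  rw [sub_add_cancel] at a1
  simp [slope, a1]

lemma hasDerivWithinAt {x y : H} (h : (x, y) ∈ G) {t : ℝ} (ht : 0 ≤ t) :
    HasDerivWithinAt (fun s => S s x) (-S t y) (Set.Ici t) t :=
  hS.hasDerivWithinAt_of_mem_apply ht (hS.apply_mem h ht)

end IsSemigroupOfNeg

variable [CompleteSpace H]

/-- A `C₀`-semigroup is bounded near `t = 0`, by the uniform boundedness principle. -/
lemma IsC0Semigroup.exists_norm_le (hS : IsC0Semigroup S) :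
    ∃ δ > 0, ∃ M, ∀ t, 0 ≤ t → t ≤ δ → ‖S t‖ ≤ M := by
  by_contra! hcon
  have hpos : ∀ j : ℕ, (0 : ℝ) < 1 / ((j : ℝ) + 1) := fun j => by positivity
  choose t ht0 htle htM using fun j : ℕ => hcon _ (hpos j) (max (j : ℝ) ‖S 0‖)
  have htpos : ∀ j, 0 < t j := fun j => by
    refine (ht0 j).lt_of_ne fun h => ?_
    have := htM j
    rw [← h] at this
    exact absurd (le_max_right _ _) (not_le.2 this)
  have hlim : Tendsto t atTop (𝓝[>] 0) := by
    refine tendsto_nhdsWithin_iff.2 ⟨?_, Eventually.of_forall htpos⟩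
    exact squeeze_zero ht0 htle tendsto_one_div_add_atTop_nhds_zero_nat
  obtain ⟨C, hC⟩ := banach_steinhaus (g := fun j => S (t j)) fun x => by
    have := ((hS.tendsto_zero x).comp hlim).norm.bddAbove_range
    obtain ⟨C, hC⟩ := this
    exact ⟨C, fun j => hC ⟨j, rfl⟩⟩
  obtain ⟨j, hj⟩ := exists_nat_gt C
  exact absurd (hC j) (not_le.2 (hj.trans ((le_max_left _ _).trans_lt (htM j))))

/-- The domain of `T²` is dense. -/
lemma IsMAccretive.dense_domain_sq (hG : IsMAccretive G) :
    Dense {x : H | ∃ y z, (x, y) ∈ G ∧ (y, z) ∈ G} := by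
  have h1 : DenseRange (IsMAccretive.resolvent G 1) := by
    refine hG.dense_domain.mono ?_
    rintro u ⟨v, huv⟩
    exact ⟨_, hG.resolvent_eq one_pos huv⟩
  refine (h1.dense_image (IsMAccretive.resolvent G 1).continuous hG.dense_domain).mono ?_
  rintro _ ⟨u, ⟨v, huv⟩, rfl⟩
  exact ⟨_, _, hG.resolvent_mem_resolvent one_pos huv,
    by simpa using hG.resolvent_mem one_pos v⟩

namespace IsSemigroupOfNeg

variable (hS : IsSemigroupOfNeg (G : Set (H × H)) S)
include hS

lemma norm_apply_le (hG : IsMAccretive G) {t : ℝ} (ht : 0 ≤ t) (f : H) : ‖S t f‖ ≤ ‖f‖ := by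
  obtain ⟨δ, hδ, M, hM⟩ := hS.1.exists_norm_le
  have hδ1 : ∀ t, 0 ≤ t → t ≤ δ → ∀ f, ‖S t f‖ ≤ ‖f‖ := by
    intro t ht htδ f
    have hclosed : IsClosed {f : H | ‖S t f‖ ≤ ‖f‖} := isClosed_le (by fun_prop) (by fun_prop)
    have hsub : {u : H | ∃ v, (u, v) ∈ G} ⊆ {f : H | ‖S t f‖ ≤ ‖f‖} := by
      rintro x ⟨y, hxy⟩
      have hcont : ContinuousOn (fun s => ‖S s x‖ ^ 2) (Set.Icc 0 t) :=
        ((hS.1.continuousOn hM x).mono (Set.Icc_subset_Icc_right htδ)).norm.pow 2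
      have := le_of_hasDerivWithinAt_nonpos ht hcont
        (fun s hs => hasDerivWithinAt_norm_sq (hS.hasDerivWithinAt hxy hs.1)) (fun s hs => by
          have := hG.accretive _ _ (hS.apply_mem hxy hs.1)
          rw [inner_neg_right, Complex.neg_re]; linarith)
      simp only [hS.1.zero, ContinuousLinearMap.id_apply] at this
      exact le_of_sq_le_sq this (norm_nonneg _)
    have := hclosed.closure_subset_iff.2 hsub
    rw [hG.dense_domain.closure_eq] at this
    exact this (Set.mem_univ f)
  have hind : ∀ j : ℕ, ∀ t, 0 ≤ t → t ≤ j * δ → ∀ f, ‖S t f‖ ≤ ‖f‖ := by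
    intro j
    induction j with
    | zero => intro t ht htj f; exact hδ1 t ht (by simp at htj; linarith) f
    | succ j ih =>
      intro t ht htj f
      push_cast at htj
      rcases le_total t δ with h | h
      · exact hδ1 t ht h f
      · have a1 := hS.1.add δ (t - δ) hδ.le (sub_nonneg.2 h)
        rw [add_sub_cancel] at a1
        rw [a1]
        exact (hδ1 δ hδ.le le_rfl _).trans (ih _ (sub_nonneg.2 h) (by linarith) f)
  obtain ⟨j, hj⟩ := exists_nat_gt (t / δ)
  rw [div_lt_iff₀ hδ] at hj
  exact hind j t ht hj.le f

lemma norm_le_one (hG : IsMAccretive G) {t : ℝ} (ht : 0 ≤ t) : ‖S t‖ ≤ 1 :=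
  (S t).opNorm_le_bound zero_le_one fun f => by rw [one_mul]; exact hS.norm_apply_le hG ht f

lemma continuousOn_Icc (hG : IsMAccretive G) (x : H) (δ : ℝ) :
    ContinuousOn (fun t => S t x) (Set.Icc 0 δ) :=
  hS.1.continuousOn (fun _ ht _ => hS.norm_le_one hG ht) x

/-- For a form-sectorial operator `T`, `t ‖T S(t) f‖ ≤ C ‖f‖`: with `u = S(t) f` and `v = T u`, the
quantity `t² ‖v‖² + K ‖u‖²` decreases along the flow, since
`‖v‖² = Re ⟪v, T u⟫ ≤ Λ p(u) p(v)` while `Re ⟪u, T u⟫ ≥ λ p(u)²` and `Re ⟪v, T v⟫ ≥ λ p(v)²`. -/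
lemma sq_mul_norm_sq_le (hG : IsMAccretive G) {p : H → ℝ} {lam Lam : ℝ} (hlam : 0 < lam)
    (hlower : ∀ u v, (u, v) ∈ G → lam * p u ^ 2 ≤ (inner ℂ u v).re)
    (hupper : ∀ u v u' v', (u, v) ∈ G → (u', v') ∈ G → ‖inner ℂ u' v‖ ≤ Lam * p u * p u')
    {x y z : H} (hxy : (x, y) ∈ G) (hyz : (y, z) ∈ G) {t : ℝ} (ht : 0 ≤ t) :
    t ^ 2 * ‖S t y‖ ^ 2 ≤ Lam ^ 2 / (4 * lam ^ 2) * ‖x‖ ^ 2 := by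
  set K := Lam ^ 2 / (4 * lam ^ 2) with hK
  have hK4 : 4 * lam ^ 2 * K = Lam ^ 2 := by rw [hK]; field_simp
  have hcont : ContinuousOn (fun s => s ^ 2 * ‖S s y‖ ^ 2 + K * ‖S s x‖ ^ 2) (Set.Icc 0 t) :=
    ((continuousOn_id.pow 2).mul ((hS.continuousOn_Icc hG y t).norm.pow 2)).add
      (continuousOn_const.mul ((hS.continuousOn_Icc hG x t).norm.pow 2))
  have := le_of_hasDerivWithinAt_nonpos ht hcont
    (fun s hs => (((hasDerivWithinAt_id s _).pow 2).mul
      (hasDerivWithinAt_norm_sq (hS.hasDerivWithinAt hyz hs.1))).add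
      ((hasDerivWithinAt_norm_sq (hS.hasDerivWithinAt hxy hs.1)).const_mul K)) (fun s hs => by
      have g1 := hS.apply_mem hxy hs.1
      have g2 := hS.apply_mem hyz hs.1
      have h1 := hlower _ _ g1
      have h2 := hlower _ _ g2
      have h3 := hupper _ _ _ _ g1 g2
      rw [inner_self_eq_norm_sq_to_K, norm_pow] at h3
      simp only [Complex.coe_algebraMap, Complex.norm_real, norm_norm] at h3
      simp only [inner_neg_right, Complex.neg_re, id_eq, Pi.pow_apply, Nat.cast_ofNat,
        Nat.add_one_sub_one, pow_one, mul_one]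
      have hs0 := hs.1
      set A := p (S s x)
      set B := p (S s y)
      -- the quadratic form in `p(u)` and `s p(v)` is nonnegative by the choice of `K`
      have h4 : s * ‖S s y‖ ^ 2 ≤ s * (Lam * A * B) := mul_le_mul_of_nonneg_left h3 hs0
      have h5 : s ^ 2 * (lam * B ^ 2) ≤ s ^ 2 * (inner ℂ (S s y) (S s z)).re :=
        mul_le_mul_of_nonneg_left h2 (sq_nonneg s)
      have hK0 : 0 ≤ K := by positivity
      have h6 : K * (lam * A ^ 2) ≤ K * (inner ℂ (S s x) (S s y)).re :=
        mul_le_mul_of_nonneg_left h1 hK0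
      have h7 : s * (Lam * A * B) ≤ s ^ 2 * (lam * B ^ 2) + K * (lam * A ^ 2) := by
        have h8 : 0 ≤ (2 * lam * (s * B) - Lam * A) ^ 2 := sq_nonneg _
        have h9 : 0 ≤ 4 * lam * (s ^ 2 * (lam * B ^ 2) + K * (lam * A ^ 2) - s * (Lam * A * B)) := by
          calc (0 : ℝ) ≤ _ := h8
            _ = _ := by linear_combination (-A ^ 2) * hK4
        have := nonneg_of_mul_nonneg_right h9 (by positivity)
        linarith
      nlinarith)
  simp only [hS.1.zero, ContinuousLinearMap.id_apply, ne_eq, OfNat.ofNat_ne_zero,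
    not_false_eq_true, zero_pow, zero_mul, zero_add] at this
  have : 0 ≤ K * ‖S t x‖ ^ 2 := by positivity
  linarith

/-- The semigroup generated by the negative of a form-sectorial operator maps into its domain. -/
lemma exists_apply_mem (hG : IsMAccretive G) {p : H → ℝ} {lam Lam : ℝ} (hlam : 0 < lam)
    (hlower : ∀ u v, (u, v) ∈ G → lam * p u ^ 2 ≤ (inner ℂ u v).re)
    (hupper : ∀ u v u' v', (u, v) ∈ G → (u', v') ∈ G → ‖inner ℂ u' v‖ ≤ Lam * p u * p u')
    (f : H) {t : ℝ} (ht : 0 < t) : ∃ v, (S t f, v) ∈ G := by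
  obtain ⟨x, hx, hlim⟩ := mem_closure_iff_seq_limit.1 (hG.dense_domain_sq f)
  choose y z hxy hyz using hx
  set C := Lam ^ 2 / (4 * lam ^ 2)
  have hbd : ∀ i j, ‖S t (y i) - S t (y j)‖ ≤ t⁻¹ * (Real.sqrt C * ‖x i - x j‖) := by
    intro i j
    have := hS.sq_mul_norm_sq_le hG hlam hlower hupper (G.sub_mem (hxy i) (hxy j))
      (G.sub_mem (hyz i) (hyz j)) ht.le
    rw [← map_sub, le_inv_mul_iff₀ ht]
    refine le_of_sq_le_sq ?_ (by positivity)
    rw [mul_pow, mul_pow, Real.sq_sqrt (by positivity)]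
    exact this
  have hcau : CauchySeq fun j => S t (y j) := by
    rw [Metric.cauchySeq_iff]
    intro ε hε
    obtain ⟨N, hN⟩ := Metric.cauchySeq_iff.1 hlim.cauchySeq (ε * t / (Real.sqrt C + 1))
      (by positivity)
    refine ⟨N, fun i hi j hj => ?_⟩
    have h1 := hN i hi j hj
    rw [dist_eq_norm, lt_div_iff₀ (by positivity)] at h1
    rw [dist_eq_norm]
    refine (hbd i j).trans_lt ?_
    rw [inv_mul_lt_iff₀ ht]
    nlinarith [norm_nonneg (x i - x j)]
  obtain ⟨v, hv⟩ := cauchySeq_tendsto_of_complete hcau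
  refine ⟨v, hG.isClosed.mem_of_tendsto
    ((((S t).continuous.tendsto _).comp hlim).prodMk_nhds hv) ?_⟩
  exact Eventually.of_forall fun j => hS.apply_mem (hxy j) ht.le

/-- Along each orbit, `T S(t) f` is defined and continuous on `(0, ∞)`, and it is minus the right
derivative of the orbit. -/
lemma exists_continuousOn_generator (hG : IsMAccretive G) {p : H → ℝ} {lam Lam : ℝ} (hlam : 0 < lam)
    (hlower : ∀ u v, (u, v) ∈ G → lam * p u ^ 2 ≤ (inner ℂ u v).re)
    (hupper : ∀ u v u' v', (u, v) ∈ G → (u', v') ∈ G → ‖inner ℂ u' v‖ ≤ Lam * p u * p u')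
    (f : H) : ∃ v : ℝ → H, ContinuousOn v (Set.Ioi 0) ∧ ∀ t, 0 < t → (S t f, v t) ∈ G ∧
      HasDerivWithinAt (fun s => S s f) (-v t) (Set.Ici t) t := by
  choose! v hv using fun t (ht : 0 < t) => hS.exists_apply_mem hG hlam hlower hupper f ht
  refine ⟨v, fun t ht => ?_, fun t ht =>
    ⟨hv t ht, hS.hasDerivWithinAt_of_mem_apply ht.le (hv t ht)⟩⟩
  have ht' : (0 : ℝ) < t := ht
  have h0 : 0 < t / 2 := by positivity
  have hEq : ∀ s ∈ Set.Icc (t / 2) (2 * t), v s = S (s - t / 2) (v (t / 2)) := fun s hs => by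
    have h1 := hS.apply_mem (hv _ h0) (sub_nonneg.2 hs.1)
    have a1 := hS.1.add (s - t / 2) (t / 2) (sub_nonneg.2 hs.1) h0.le
    rw [sub_add_cancel] at a1
    refine hG.value_unique (hv s (h0.trans_le hs.1)) ?_
    rw [a1]; exact h1
  have hcont : ContinuousOn v (Set.Icc (t / 2) (2 * t)) := by
    refine ContinuousOn.congr ?_ hEq
    exact (hS.continuousOn_Icc hG (v (t / 2)) (2 * t)).comp (by fun_prop)
      fun s hs => ⟨sub_nonneg.2 hs.1, by linarith [hs.2]⟩
  exact (hcont.continuousAt (Icc_mem_nhds (by linarith) (by linarith))).continuousWithinAt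

end IsSemigroupOfNeg

end Orbits

/-! ### Iterated partial derivatives of smooth functions -/

section Partial

variable {n : ℕ} {φ ψ : EuclideanSpace ℝ (Fin n) → ℝ}

lemma ContDiff.partialDeriv (hφ : ContDiff ℝ ∞ φ) (i : Fin n) : ContDiff ℝ ∞ (partialDeriv i φ) :=
  (hφ.fderiv_right (m := ∞) (by simp)).clm_apply contDiff_const

lemma HasCompactSupport.partialDeriv (hφ : HasCompactSupport φ) (i : Fin n) :
    HasCompactSupport (partialDeriv i φ) :=
  hφ.fderiv_apply ℝ _

lemma partialDeriv_comm (hφ : ContDiff ℝ ∞ φ) (i j : Fin n) :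
    partialDeriv i (partialDeriv j φ) = partialDeriv j (partialDeriv i φ) := by
  ext x
  have hd : DifferentiableAt ℝ (fderiv ℝ φ) x :=
    ((hφ.fderiv_right (m := 1) (by norm_cast)).differentiable (by norm_num)) x
  have hsymm : IsSymmSndFDerivAt ℝ φ x :=
    (hφ.contDiffAt).isSymmSndFDerivAt (by simp; norm_cast)
  have key : ∀ k l : Fin n, partialDeriv k (partialDeriv l φ) x =
      fderiv ℝ (fderiv ℝ φ) x (EuclideanSpace.single k 1) (EuclideanSpace.single l 1) := by
    intro k l
    unfold partialDeriv
    rw [fderiv_clm_apply hd (by fun_prop)]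
    simp
  rw [key, key]
  exact hsymm _ _

lemma partialDeriv_mul (hφ : ContDiff ℝ ∞ φ) (hψ : ContDiff ℝ ∞ ψ) (i : Fin n)
    (x : EuclideanSpace ℝ (Fin n)) :
    partialDeriv i (fun y => φ y * ψ y) x = φ x * partialDeriv i ψ x + ψ x * partialDeriv i φ x := by
  unfold partialDeriv
  rw [fderiv_fun_mul (hφ.differentiable (by simp) x) (hψ.differentiable (by simp) x)]
  simp

lemma partialDeriv_pow (hφ : ContDiff ℝ ∞ φ) (k : ℕ) (i : Fin n)
    (x : EuclideanSpace ℝ (Fin n)) :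
    partialDeriv i (fun y => φ y ^ k) x = k * φ x ^ (k - 1) * partialDeriv i φ x := by
  unfold partialDeriv
  rw [fderiv_fun_pow k (hφ.differentiable (by simp) x)]
  simp

lemma ContDiff.iterate_partialDeriv (hφ : ContDiff ℝ ∞ φ) (i : Fin n) (k : ℕ) :
    ContDiff ℝ ∞ ((_root_.partialDeriv i)^[k] φ) := by
  induction k generalizing φ with
  | zero => exact hφ
  | succ k ih => exact ih (hφ.partialDeriv i)

lemma HasCompactSupport.iterate_partialDeriv (hφ : HasCompactSupport φ) (i : Fin n) (k : ℕ) :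
    HasCompactSupport ((_root_.partialDeriv i)^[k] φ) := by
  induction k generalizing φ with
  | zero => exact hφ
  | succ k ih => exact ih (hφ.partialDeriv i)

lemma partialDeriv_iterate_comm (hφ : ContDiff ℝ ∞ φ) (i j : Fin n) (k : ℕ) :
    partialDeriv i ((partialDeriv j)^[k] φ) = (partialDeriv j)^[k] (partialDeriv i φ) := by
  induction k generalizing φ with
  | zero => rfl
  | succ k ih =>
    rw [Function.iterate_succ_apply, Function.iterate_succ_apply, ih (hφ.partialDeriv j),
      partialDeriv_comm hφ]

variable (α : Fin n → ℕ)

lemma contDiff_foldr (l : List (Fin n)) (hφ : ContDiff ℝ ∞ φ) :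
    ContDiff ℝ ∞ (l.foldr (fun i ψ => (partialDeriv i)^[α i] ψ) φ) := by
  induction l with
  | nil => exact hφ
  | cons j l ih => exact ih.iterate_partialDeriv j _

lemma ContDiff.iteratedPartial (hφ : ContDiff ℝ ∞ φ) : ContDiff ℝ ∞ (iteratedPartial α φ) :=
  contDiff_foldr α _ hφ

lemma HasCompactSupport.iteratedPartial (hφ : HasCompactSupport φ) :
    HasCompactSupport (iteratedPartial α φ) := by
  unfold _root_.iteratedPartial
  induction List.finRange n with
  | nil => exact hφ
  | cons j l ih => exact ih.iterate_partialDeriv j _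

lemma partialDeriv_foldr (l : List (Fin n)) (hφ : ContDiff ℝ ∞ φ) (i : Fin n) :
    partialDeriv i (l.foldr (fun i ψ => (partialDeriv i)^[α i] ψ) φ) =
      l.foldr (fun i ψ => (partialDeriv i)^[α i] ψ) (partialDeriv i φ) := by
  induction l with
  | nil => rfl
  | cons j l ih =>
    simp only [List.foldr_cons]
    rw [partialDeriv_iterate_comm (contDiff_foldr α l hφ), ih]

lemma iteratedPartial_add_single (hφ : ContDiff ℝ ∞ φ) (i : Fin n) :
    iteratedPartial (α + Pi.single i 1) φ = iteratedPartial α (partialDeriv i φ) := by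
  have key : ∀ l : List (Fin n), l.Nodup →
      l.foldr (fun j ψ => (partialDeriv j)^[(α + Pi.single i 1 : Fin n → ℕ) j] ψ) φ =
        l.foldr (fun j ψ => (partialDeriv j)^[α j] ψ) (if i ∈ l then partialDeriv i φ else φ) := by
    intro l hl
    induction l with
    | nil => simp
    | cons j l ih =>
      rw [List.nodup_cons] at hl
      simp only [List.foldr_cons]
      rw [ih hl.2]
      by_cases hij : j = i
      · subst hij
        simp only [hl.1, if_false, List.mem_cons, true_or, if_true, Pi.add_apply,
          Pi.single_eq_same]
        rw [Function.iterate_succ_apply, partialDeriv_foldr α l hφ]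
      · have : ¬ i = j := fun h => hij h.symm
        simp [hij, this]
  have := key (List.finRange n) (List.nodup_finRange n)
  simpa [iteratedPartial] using this

lemma iteratedPartial_zero : iteratedPartial (0 : Fin n → ℕ) φ = φ := by
  simp [iteratedPartial]

end Partial

/-! ### Multiplication operators on `L²` -/

section Mul

variable {n : ℕ}

open Classical in
/-- The operator of multiplication by `b` on `L²(ℝⁿ)`; it is `0` unless `b ∈ L^∞`. -/
noncomputable def mulOp (b : EuclideanSpace ℝ (Fin n) → ℂ) : L2Space n →L[ℂ] L2Space n :=
  if hb : MemLp b ∞ volume then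
    (ContinuousLinearMap.mul ℂ ℂ).holderL volume ∞ 2 2 (hb.toLp b) else 0

/-- The operator of multiplication by a real function on `L²(ℝⁿ)`; it is `0` unless the function
is in `L^∞`. -/
noncomputable abbrev mulReal (b : EuclideanSpace ℝ (Fin n) → ℝ) : L2Space n →L[ℂ] L2Space n :=
  mulOp fun x => (b x : ℂ)

variable {b c : EuclideanSpace ℝ (Fin n) → ℂ}

lemma coeFn_mulOp (hb : MemLp b ∞ volume) (u : L2Space n) :
    mulOp b u =ᵐ[volume] fun x => b x * u x := by
  rw [mulOp, dif_pos hb]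
  have h1 := (ContinuousLinearMap.mul ℂ ℂ).coeFn_holder (r := 2) (hb.toLp b) u
  filter_upwards [h1, hb.coeFn_toLp] with x hx hx'
  rw [← hx']
  exact hx

lemma mulOp_mulOp (hb : MemLp b ∞ volume) (hc : MemLp c ∞ volume)
    (hbc : MemLp (fun x => b x * c x) ∞ volume)
    (u : L2Space n) : mulOp b (mulOp c u) = mulOp (fun x => b x * c x) u := by
  apply Lp.ext
  filter_upwards [coeFn_mulOp hb (mulOp c u), coeFn_mulOp hc u, coeFn_mulOp hbc u] with x h1 h2 h3
  rw [h1, h2, h3, mul_assoc]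

lemma mulOp_smul (k : ℂ) (hb : MemLp b ∞ volume) (u : L2Space n) :
    mulOp (fun x => k * b x) u = k • mulOp b u := by
  apply Lp.ext
  filter_upwards [coeFn_mulOp hb u, coeFn_mulOp (hb.const_mul k) u,
    Lp.coeFn_smul k (mulOp b u)] with x h1 h2 h3
  rw [h3, Pi.smul_apply, h1, h2, smul_eq_mul, mul_assoc]

lemma inner_mulOp (hb : MemLp b ∞ volume) (u v : L2Space n) :
    inner ℂ u (mulOp b v) = ∫ x, b x * v x * conj (u x) := by
  rw [L2.inner_def]
  refine integral_congr_ae ?_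
  filter_upwards [coeFn_mulOp hb v] with x h1
  rw [h1]; rfl

lemma norm_mulOp_le (hb : MemLp b ∞ volume) (hc : MemLp c ∞ volume) {C : ℝ}
    (h : ∀ᵐ x, ‖b x‖ ≤ C * ‖c x‖) (u : L2Space n) : ‖mulOp b u‖ ≤ C * ‖mulOp c u‖ := by
  refine Lp.norm_le_mul_norm_of_ae_le_mul ?_
  filter_upwards [coeFn_mulOp hb u, coeFn_mulOp hc u, h] with x h1 h2 h3
  rw [h1, h2, norm_mul, norm_mul, ← mul_assoc]
  exact mul_le_mul_of_nonneg_right h3 (norm_nonneg _)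

lemma mulReal_one (u : L2Space n) : mulReal (fun _ => 1) u = u := by
  apply Lp.ext
  have hb : MemLp (fun _ : EuclideanSpace ℝ (Fin n) => ((1 : ℝ) : ℂ)) ∞ volume :=
    memLp_top_of_bound (by fun_prop) 1 (by simp)
  filter_upwards [coeFn_mulOp hb u] with x h1
  rw [mulReal, h1]; simp

lemma inner_mulReal_left {b : EuclideanSpace ℝ (Fin n) → ℝ}
    (hb : MemLp (fun x => (b x : ℂ)) ∞ volume) (u v : L2Space n) :
    inner ℂ (mulReal b u) v = inner ℂ u (mulReal b v) := by
  rw [L2.inner_def, L2.inner_def]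
  refine integral_congr_ae ?_
  filter_upwards [coeFn_mulOp hb u, coeFn_mulOp hb v] with x h1 h2
  rw [h1, h2]
  simp only [RCLike.inner_apply, map_mul, Complex.conj_ofReal]; ring

/-- A *multiplier* is a smooth real function that is bounded together with its first order partial
derivatives; multiplication by it preserves first order Sobolev spaces. -/
structure IsMultiplier (ψ : EuclideanSpace ℝ (Fin n) → ℝ) : Prop where
  contDiff : ContDiff ℝ ∞ ψ
  bdd : ∃ C, ∀ x, |ψ x| ≤ C
  bdd_deriv : ∀ i, ∃ C, ∀ x, |partialDeriv i ψ x| ≤ C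

lemma memLp_top_of_abs_le {ψ : EuclideanSpace ℝ (Fin n) → ℝ} (h : Continuous ψ)
    (hb : ∃ C, ∀ x, |ψ x| ≤ C) : MemLp (fun x => (ψ x : ℂ)) ∞ volume := by
  obtain ⟨C, hC⟩ := hb
  refine memLp_top_of_bound (by fun_prop) C (Eventually.of_forall fun x => ?_)
  simpa using hC x

namespace IsMultiplier

variable {φ ψ : EuclideanSpace ℝ (Fin n) → ℝ}

lemma memLp (h : IsMultiplier ψ) : MemLp (fun x => (ψ x : ℂ)) ∞ volume :=
  memLp_top_of_abs_le h.contDiff.continuous h.bdd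

lemma memLp_deriv (h : IsMultiplier ψ) (i : Fin n) :
    MemLp (fun x => (partialDeriv i ψ x : ℂ)) ∞ volume :=
  memLp_top_of_abs_le (h.contDiff.partialDeriv i).continuous (h.bdd_deriv i)

lemma of_hasCompactSupport (h : ContDiff ℝ ∞ ψ) (h' : HasCompactSupport ψ) : IsMultiplier ψ where
  contDiff := h
  bdd := by simpa using h'.exists_bound_of_continuous h.continuous
  bdd_deriv i := by
    simpa using (h'.partialDeriv i).exists_bound_of_continuous (h.partialDeriv i).continuous

lemma const (c : ℝ) : IsMultiplier (fun _ : EuclideanSpace ℝ (Fin n) => c) where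
  contDiff := contDiff_const
  bdd := ⟨|c|, fun _ => le_rfl⟩
  bdd_deriv i := ⟨0, fun x => by simp [partialDeriv]⟩

lemma mul (hφ : IsMultiplier φ) (hψ : IsMultiplier ψ) : IsMultiplier (fun x => φ x * ψ x) where
  contDiff := hφ.contDiff.mul hψ.contDiff
  bdd := by
    obtain ⟨C, hC⟩ := hφ.bdd
    obtain ⟨D, hD⟩ := hψ.bdd
    refine ⟨C * D, fun x => ?_⟩
    rw [abs_mul]
    exact mul_le_mul (hC x) (hD x) (abs_nonneg _) ((abs_nonneg _).trans (hC x))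
  bdd_deriv i := by
    obtain ⟨C, hC⟩ := hφ.bdd
    obtain ⟨D, hD⟩ := hψ.bdd
    obtain ⟨C', hC'⟩ := hφ.bdd_deriv i
    obtain ⟨D', hD'⟩ := hψ.bdd_deriv i
    refine ⟨C * D' + D * C', fun x => ?_⟩
    rw [partialDeriv_mul hφ.contDiff hψ.contDiff]
    refine (abs_add_le _ _).trans (add_le_add ?_ ?_)
    · rw [abs_mul]
      exact mul_le_mul (hC x) (hD' x) (abs_nonneg _) ((abs_nonneg _).trans (hC x))
    · rw [abs_mul]
      exact mul_le_mul (hD x) (hC' x) (abs_nonneg _) ((abs_nonneg _).trans (hD x))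

lemma pow (hψ : IsMultiplier ψ) (k : ℕ) : IsMultiplier (fun x => ψ x ^ k) := by
  induction k with
  | zero => simpa using const 1
  | succ k ih => simpa only [pow_succ] using ih.mul hψ

lemma mulReal_mulReal (hφ : IsMultiplier φ) (hψ : IsMultiplier ψ) (u : L2Space n) :
    mulReal φ (mulReal ψ u) = mulReal (fun x => φ x * ψ x) u := by
  have h := (hφ.mul hψ).memLp
  simp only [Complex.ofReal_mul] at h
  rw [mulReal, mulReal, mulReal, mulOp_mulOp hφ.memLp hψ.memLp h]
  simp only [Complex.ofReal_mul]

end IsMultiplier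

end Mul

/-! ### Weak derivatives in `L²` -/

section Weak

variable {n : ℕ}

open Classical in
/-- A test function, as an element of `L²(ℝⁿ)`. -/
noncomputable def testL2 (φ : EuclideanSpace ℝ (Fin n) → ℝ) : L2Space n :=
  if h : MemLp (fun x => (φ x : ℂ)) 2 volume then h.toLp _ else 0

section Test

variable {φ ψ : EuclideanSpace ℝ (Fin n) → ℝ}

lemma memLp_test (hφ : Continuous φ) (hφ' : HasCompactSupport φ) (p : ℝ≥0∞) :
    MemLp (fun x => (φ x : ℂ)) p volume :=
  Continuous.memLp_of_hasCompactSupport (by fun_prop) (hφ'.comp_left Complex.ofReal_zero)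

lemma coeFn_testL2 (hφ : Continuous φ) (hφ' : HasCompactSupport φ) :
    testL2 φ =ᵐ[volume] fun x => (φ x : ℂ) := by
  rw [testL2, dif_pos (memLp_test hφ hφ' 2)]
  exact MemLp.coeFn_toLp _

lemma inner_testL2 (hφ : Continuous φ) (hφ' : HasCompactSupport φ) (u : L2Space n) :
    inner ℂ (testL2 φ) u = ∫ x, φ x • u x := by
  rw [L2.inner_def]
  refine integral_congr_ae ?_
  filter_upwards [coeFn_testL2 hφ hφ'] with x hx
  rw [hx]
  simp [mul_comm]

lemma testL2_add (hφ : Continuous φ) (hφ' : HasCompactSupport φ) (hψ : Continuous ψ)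
    (hψ' : HasCompactSupport ψ) : testL2 (fun x => φ x + ψ x) = testL2 φ + testL2 ψ := by
  apply Lp.ext
  filter_upwards [coeFn_testL2 hφ hφ', coeFn_testL2 hψ hψ', coeFn_testL2 (hφ.add hψ) (hφ'.add hψ'),
    Lp.coeFn_add (testL2 φ) (testL2 ψ)] with x h1 h2 h3 h4
  rw [h4, Pi.add_apply, h1, h2, ← Complex.ofReal_add]
  exact h3

lemma mulReal_testL2 (hψ : IsMultiplier ψ) (hφ : Continuous φ) (hφ' : HasCompactSupport φ) :
    mulReal ψ (testL2 φ) = testL2 (fun x => ψ x * φ x) := by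
  apply Lp.ext
  filter_upwards [coeFn_mulOp hψ.memLp (testL2 φ), coeFn_testL2 hφ hφ',
    coeFn_testL2 (φ := fun x => ψ x * φ x) (hψ.contDiff.continuous.mul hφ)
      (HasCompactSupport.mul_left (f := ψ) hφ')] with x h1 h2 h3
  rw [mulReal, h1, h2]
  simp [h3]

end Test

/-- `g` is the weak derivative `∂_i u`, for `u, g ∈ L²(ℝⁿ)`. -/
def HasPartial (i : Fin n) (u g : L2Space n) : Prop :=
  ∀ φ : EuclideanSpace ℝ (Fin n) → ℝ, ContDiff ℝ ∞ φ → HasCompactSupport φ →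
    inner ℂ (testL2 (partialDeriv i φ)) u = - inner ℂ (testL2 φ) g

lemma locallyIntegrable_L2 (u : L2Space n) : LocallyIntegrable u volume :=
  (Lp.memLp u).locallyIntegrable (by norm_num)

lemma isWeakDeriv_iff {α : Fin n → ℕ} {u g : L2Space n} :
    IsWeakDeriv α u g ↔ ∀ φ : EuclideanSpace ℝ (Fin n) → ℝ, ContDiff ℝ ∞ φ → HasCompactSupport φ →
      inner ℂ (testL2 (iteratedPartial α φ)) u = (-1 : ℂ) ^ (∑ i, α i) * inner ℂ (testL2 φ) g := by
  refine ⟨fun h φ hφ hφ' => ?_,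
    fun h => ⟨locallyIntegrable_L2 u, locallyIntegrable_L2 g, fun φ hφ hφ' => ?_⟩⟩
  · rw [inner_testL2 (hφ.iteratedPartial α).continuous (hφ'.iteratedPartial α),
      inner_testL2 hφ.continuous hφ']
    exact h.2.2 φ hφ hφ'
  · rw [← inner_testL2 (hφ.iteratedPartial α).continuous (hφ'.iteratedPartial α),
      ← inner_testL2 hφ.continuous hφ']
    exact h φ hφ hφ'

lemma isWeakDeriv_zero (u : L2Space n) : IsWeakDeriv 0 u u := by
  rw [isWeakDeriv_iff]
  intro φ _ _
  simp [iteratedPartial_zero]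

/-- `∂^{α + e_i} u = ∂_i ∂^α u`. -/
lemma IsWeakDeriv.add_single_iff {α : Fin n → ℕ} {i : Fin n} {u g h : L2Space n}
    (hg : IsWeakDeriv α u g) : IsWeakDeriv (α + Pi.single i 1) u h ↔ HasPartial i g h := by
  rw [isWeakDeriv_iff] at hg ⊢
  have hs : ∑ j, (α + Pi.single i 1 : Fin n → ℕ) j = (∑ j, α j) + 1 := by
    simp [Finset.sum_add_distrib]
  have h1 : ((-1 : ℂ) ^ (∑ j, α j)) ≠ 0 := pow_ne_zero _ (by norm_num)
  refine forall₃_congr fun φ hφ hφ' => ?_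
  rw [iteratedPartial_add_single α hφ, hg _ (hφ.partialDeriv i) (hφ'.partialDeriv i), hs, pow_succ,
    mul_assoc, mul_right_inj' h1, neg_one_mul]

/-- Weak derivatives are unique almost everywhere. -/
lemma IsWeakDeriv.ae_eq {α : Fin n → ℕ} {f g h : EuclideanSpace ℝ (Fin n) → ℂ}
    (hg : IsWeakDeriv α f g) (hh : IsWeakDeriv α f h) : g =ᵐ[volume] h := by
  refine ae_eq_of_integral_contDiff_smul_eq hg.2.1 hh.2.1 fun φ hφ hφ' => ?_
  have h1 : ((-1 : ℂ) ^ (∑ j, α j)) ≠ 0 := pow_ne_zero _ (by norm_num)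
  exact mul_left_cancel₀ h1 ((hg.2.2 φ hφ hφ').symm.trans (hh.2.2 φ hφ hφ'))

lemma IsWeakDeriv.congr {α : Fin n → ℕ} {f f' g g' : EuclideanSpace ℝ (Fin n) → ℂ}
    (h : IsWeakDeriv α f g) (hf : f =ᵐ[volume] f') (hg : g =ᵐ[volume] g') :
    IsWeakDeriv α f' g' := by
  refine ⟨h.1.congr hf, h.2.1.congr hg, fun φ hφ hφ' => ?_⟩
  have e1 : ∫ x, iteratedPartial α φ x • f' x = ∫ x, iteratedPartial α φ x • f x :=
    integral_congr_ae (by filter_upwards [hf] with x hx; rw [hx])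
  have e2 : ∫ x, φ x • g' x = ∫ x, φ x • g x :=
    integral_congr_ae (by filter_upwards [hg] with x hx; rw [hx])
  rw [e1, e2]
  exact h.2.2 φ hφ hφ'

/-- Elements of `L²` with equal inner products against test functions are equal. -/
lemma eq_of_inner_testL2 {u v : L2Space n}
    (h : ∀ φ : EuclideanSpace ℝ (Fin n) → ℝ, ContDiff ℝ ∞ φ → HasCompactSupport φ →
      inner ℂ (testL2 φ) u = inner ℂ (testL2 φ) v) : u = v := by
  apply Lp.ext
  refine ae_eq_of_integral_contDiff_smul_eq (locallyIntegrable_L2 u) (locallyIntegrable_L2 v)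
    fun φ hφ hφ' => ?_
  rw [← inner_testL2 hφ.continuous hφ', ← inner_testL2 hφ.continuous hφ']
  exact h φ hφ hφ'

lemma HasPartial.add {i : Fin n} {u v g h : L2Space n} (hu : HasPartial i u g)
    (hv : HasPartial i v h) : HasPartial i (u + v) (g + h) := fun φ hφ hφ' => by
  rw [inner_add_right, inner_add_right, hu φ hφ hφ', hv φ hφ hφ']; ring

lemma HasPartial.smul {i : Fin n} {u g : L2Space n} (c : ℂ) (hu : HasPartial i u g) :
    HasPartial i (c • u) (c • g) := fun φ hφ hφ' => by
  rw [inner_smul_right, inner_smul_right, hu φ hφ hφ']; ring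

lemma HasPartial.zero (i : Fin n) : HasPartial i (0 : L2Space n) 0 := fun φ _ _ => by simp

/-- The product rule for weak derivatives. -/
lemma HasPartial.mulReal {i : Fin n} {u g : L2Space n} {ψ : EuclideanSpace ℝ (Fin n) → ℝ}
    (hψ : IsMultiplier ψ) (hu : HasPartial i u g) :
    HasPartial i (mulReal ψ u) (mulReal (partialDeriv i ψ) u + mulReal ψ g) := by
  intro φ hφ hφ'
  have hd := hφ.partialDeriv i
  have hd' := hφ'.partialDeriv i
  have hψφ : ContDiff ℝ ∞ (fun x => ψ x * φ x) := hψ.contDiff.mul hφ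
  have hψφ' : HasCompactSupport (fun x => ψ x * φ x) := hφ'.mul_left
  have hDψ := (hψ.contDiff.partialDeriv i).continuous
  have e1 : testL2 (partialDeriv i fun x => ψ x * φ x) =
      testL2 (fun x => ψ x * partialDeriv i φ x) + testL2 (fun x => partialDeriv i ψ x * φ x) := by
    rw [← testL2_add (φ := fun x => ψ x * partialDeriv i φ x)
      (ψ := fun x => partialDeriv i ψ x * φ x) (hψ.contDiff.continuous.mul hd.continuous) hd'.mul_left
      (hDψ.mul hφ.continuous) hφ'.mul_left]
    congr 1
    ext x
    rw [partialDeriv_mul hψ.contDiff hφ]; ring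
  have e2 : _root_.mulReal (partialDeriv i ψ) (testL2 φ) =
      testL2 (fun x => partialDeriv i ψ x * φ x) := by
    apply Lp.ext
    filter_upwards [coeFn_mulOp (hψ.memLp_deriv i) (testL2 φ), coeFn_testL2 hφ.continuous hφ',
      coeFn_testL2 (φ := fun x => partialDeriv i ψ x * φ x) (hDψ.mul hφ.continuous)
        (HasCompactSupport.mul_left (f := partialDeriv i ψ) hφ')] with x h1 h2 h3
    rw [_root_.mulReal, h1, h2]
    simp [h3]
  have h0 := hu _ hψφ hψφ'
  rw [e1, inner_add_left] at h0
  rw [← inner_mulReal_left hψ.memLp, mulReal_testL2 hψ hd.continuous hd', inner_add_right,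
    ← inner_mulReal_left (hψ.memLp_deriv i), e2, ← inner_mulReal_left hψ.memLp,
    mulReal_testL2 hψ hφ.continuous hφ', neg_add, ← h0]
  ring

end Weak

/-! ### Integration by parts for weak derivatives in `L²` -/

section IBP

variable {n : ℕ} {φ : EuclideanSpace ℝ (Fin n) → ℝ}

lemma hasPartial_testL2 (hφ : ContDiff ℝ ∞ φ) (hφ' : HasCompactSupport φ) (i : Fin n) :
    HasPartial i (testL2 φ) (testL2 (partialDeriv i φ)) := by
  intro ψ hψ hψ'
  have hdφ := (hφ.partialDeriv i).continuous
  have hdψ := (hψ.partialDeriv i).continuous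
  have key : ∀ {a b : EuclideanSpace ℝ (Fin n) → ℝ}, Continuous a → HasCompactSupport a →
      Continuous b → HasCompactSupport b →
      inner ℂ (testL2 a) (testL2 b) = ((∫ x, a x * b x : ℝ) : ℂ) := by
    intro a b ha ha' hb hb'
    rw [inner_testL2 ha ha', ← integral_complex_ofReal]
    refine integral_congr_ae ?_
    filter_upwards [coeFn_testL2 hb hb'] with x hx
    rw [hx]; simp
  rw [key hdψ (hψ'.partialDeriv i) hφ.continuous hφ', key hψ.continuous hψ' hdφ (hφ'.partialDeriv i),
    ← Complex.ofReal_neg]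
  congr 1
  have := integral_mul_fderiv_eq_neg_fderiv_mul_of_integrable (μ := volume) (f := ψ) (g := φ)
    (v := EuclideanSpace.single i (1 : ℝ))
    ((hdψ.mul hφ.continuous).integrable_of_hasCompactSupport hφ'.mul_left)
    ((hψ.continuous.mul hdφ).integrable_of_hasCompactSupport (hφ'.partialDeriv i).mul_left)
    ((hψ.continuous.mul hφ.continuous).integrable_of_hasCompactSupport hφ'.mul_left)
    (fun x _ => hψ.differentiable (by simp) x) (fun x _ => hφ.differentiable (by simp) x)
  exact (neg_eq_iff_eq_neg.2 this).symm

/-- The pairing of a translated test function with `g` is differentiable in the translation. -/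
lemma hasDerivAt_integral_translate (hφ : ContDiff ℝ ∞ φ) (hφ' : HasCompactSupport φ) (i : Fin n)
    (g : L2Space n) (h₀ : ℝ) :
    HasDerivAt (fun h : ℝ => ∫ x, φ (x - h • EuclideanSpace.single i 1) • g x)
      (∫ x, -partialDeriv i φ (x - h₀ • EuclideanSpace.single i 1) • g x) h₀ := by
  set e : EuclideanSpace ℝ (Fin n) := EuclideanSpace.single i 1
  have he : ‖e‖ = 1 := by simp [e]
  have hd := (hφ.partialDeriv i).continuous
  obtain ⟨C, hC⟩ := (hφ'.partialDeriv i).exists_bound_of_continuous hd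
  obtain ⟨R, hR⟩ := (hφ'.partialDeriv i).isCompact.isBounded.subset_closedBall 0
  have hg := Lp.aestronglyMeasurable g
  have hsupp : ∀ h : ℝ, HasCompactSupport fun x => φ (x - h • e) := fun h =>
    hφ'.comp_homeomorph (Homeomorph.subRight (h • e))
  set B := Metric.closedBall (0 : EuclideanSpace ℝ (Fin n)) (R + |h₀| + 1)
  refine (hasDerivAt_integral_of_dominated_loc_of_deriv_le (s := Metric.ball h₀ 1)
    (F' := fun h x => -partialDeriv i φ (x - h • e) • g x)
    (bound := fun x => B.indicator (fun x => C * ‖g x‖) x)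
    (Metric.ball_mem_nhds h₀ one_pos) (Eventually.of_forall fun h => ?_) ?_ ?_ ?_ ?_ ?_).2
  · exact (hφ.continuous.comp (by fun_prop)).aestronglyMeasurable.smul hg
  · exact (locallyIntegrable_L2 g).integrable_smul_left_of_hasCompactSupport
      (hφ.continuous.comp (by fun_prop)) (hsupp h₀)
  · exact (hd.comp (by fun_prop)).neg.aestronglyMeasurable.smul hg
  · refine Eventually.of_forall fun x h hh => ?_
    rw [Metric.mem_ball, Real.dist_eq] at hh
    by_cases hx : x ∈ B
    · rw [Set.indicator_of_mem hx, norm_smul, norm_neg]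
      exact mul_le_mul_of_nonneg_right (hC _) (norm_nonneg _)
    · rw [Set.indicator_of_notMem hx]
      have : partialDeriv i φ (x - h • e) = 0 := by
        refine image_eq_zero_of_notMem_tsupport fun hmem => hx ?_
        have h1 := hR hmem
        rw [mem_closedBall_zero_iff] at h1 ⊢
        have h2 : ‖x‖ ≤ ‖x - h • e‖ + ‖h • e‖ := by
          simpa using norm_add_le (x - h • e) (h • e)
        rw [norm_smul, he, mul_one, Real.norm_eq_abs] at h2
        have h3 : |h| ≤ |h - h₀| + |h₀| := by simpa using abs_add_le (h - h₀) h₀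
        linarith
      simp [this]
  · exact (integrable_indicator_iff measurableSet_closedBall).2
      (((locallyIntegrable_L2 g).integrableOn_isCompact (isCompact_closedBall _ _)).norm.const_mul C)
  · refine Eventually.of_forall fun x h _ => ?_
    have h1 : HasFDerivAt φ (fderiv ℝ φ (x - h • e)) (x - h • e) :=
      (hφ.differentiable (by simp) _).hasFDerivAt
    have h2 : HasDerivAt (fun h : ℝ => x - h • e) (-e) h := by
      simpa using ((hasDerivAt_id h).smul_const e).const_sub x
    have h3 := (h1.comp_hasDerivAt h h2).smul_const (g x)
    simpa [partialDeriv, e] using h3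

lemma norm_testL2_translate (hφ : Continuous φ) (hφ' : HasCompactSupport φ)
    (y : EuclideanSpace ℝ (Fin n)) : ‖testL2 fun x => φ (x - y)‖ = ‖testL2 φ‖ := by
  have h1 : HasCompactSupport fun x => φ (x - y) := hφ'.comp_homeomorph (Homeomorph.subRight y)
  have h2 : Continuous fun x => φ (x - y) := hφ.comp (by fun_prop)
  rw [testL2, testL2, dif_pos (memLp_test h2 h1 2), dif_pos (memLp_test hφ hφ' 2), Lp.norm_toLp,
    Lp.norm_toLp]
  congr 1
  exact eLpNorm_comp_measurePreserving (g := fun x => (φ x : ℂ)) (f := fun x => x - y)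
    (memLp_test hφ hφ' 2).aestronglyMeasurable (measurePreserving_sub_right volume y)

/-- There are no exponential solutions of `∂_i g = ± g` in `L²`. -/
lemma HasPartial.eq_zero_of_eigen {i : Fin n} {g : L2Space n} {c : ℝ} (hc : c ^ 2 = 1)
    (hg : HasPartial i g ((c : ℂ) • g)) : g = 0 := by
  refine eq_of_inner_testL2 fun φ hφ hφ' => ?_
  rw [inner_zero_right]
  set e : EuclideanSpace ℝ (Fin n) := EuclideanSpace.single i 1
  have hsm : ∀ h : ℝ, ContDiff ℝ ∞ fun x => φ (x - h • e) := fun h => hφ.comp (by fun_prop)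
  have hsupp : ∀ h : ℝ, HasCompactSupport fun x => φ (x - h • e) := fun h =>
    hφ'.comp_homeomorph (Homeomorph.subRight (h • e))
  set F : ℝ → ℂ := fun h => ∫ x, φ (x - h • e) • g x
  have hF : ∀ h, HasDerivAt F (c • F h) h := by
    intro h
    refine (hasDerivAt_integral_translate hφ hφ' i g h).congr_deriv ?_
    have h1 := hg _ (hsm h) (hsupp h)
    have hp : (partialDeriv i fun x => φ (x - h • e)) = fun x => partialDeriv i φ (x - h • e) := by
      ext x
      unfold partialDeriv
      rw [fderiv_comp_sub]
    rw [inner_testL2 ((hsm h).partialDeriv i).continuous ((hsupp h).partialDeriv i), hp,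
      inner_smul_right, inner_testL2 (hsm h).continuous (hsupp h)] at h1
    simp only [neg_smul, integral_neg]
    rw [h1, neg_neg, ← Complex.coe_smul, smul_eq_mul]
  have hbd : ∀ h, ‖F h‖ ≤ ‖testL2 φ‖ * ‖g‖ := by
    intro h
    have h1 := norm_testL2_translate hφ.continuous hφ' (h • e)
    rw [← h1, show F h = inner ℂ (testL2 fun x => φ (x - h • e)) g from
      (inner_testL2 (hsm h).continuous (hsupp h) g).symm]
    exact norm_inner_le_norm _ _
  have hconst : ∀ h, Real.exp (-(c * h)) • F h = F 0 := by
    have hd : ∀ h, HasDerivAt (fun h : ℝ => Real.exp (-(c * h)) • F h) 0 h := fun h => by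
      have h1 : HasDerivAt (fun h : ℝ => Real.exp (-(c * h))) (Real.exp (-(c * h)) * -(c * 1)) h :=
        (((hasDerivAt_id h).const_mul c).neg).exp
      refine (h1.smul (hF h)).congr_deriv ?_
      rw [smul_smul, ← add_smul]
      simp
    intro h
    have := is_const_of_deriv_eq_zero (fun h => (hd h).differentiableAt) (fun h => (hd h).deriv) h 0
    simpa using this
  have hlim : Tendsto (fun s : ℝ => Real.exp (-s) * (‖testL2 φ‖ * ‖g‖)) atTop (𝓝 0) := by
    simpa using Real.tendsto_exp_neg_atTop_nhds_zero.mul_const (‖testL2 φ‖ * ‖g‖)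
  have h0 : ‖F 0‖ ≤ 0 := by
    refine ge_of_tendsto hlim (Eventually.of_forall fun s => ?_)
    rw [← hconst (c * s), norm_smul, ← mul_assoc, ← pow_two, hc, one_mul,
      Real.norm_of_nonneg (Real.exp_pos _).le]
    exact mul_le_mul_of_nonneg_left (hbd _) (Real.exp_pos _).le
  have : F 0 = 0 := norm_le_zero_iff.1 h0
  rw [inner_testL2 hφ.continuous hφ']
  simpa [F] using this

/-- The graph of the weak derivative `∂_i` in `L²`. -/
noncomputable def partialGraph (n : ℕ) (i : Fin n) :
    Submodule ℂ (WithLp 2 (L2Space n × L2Space n)) where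
  carrier := {p | HasPartial i p.fst p.snd}
  add_mem' h h' := h.add h'
  zero_mem' := HasPartial.zero i
  smul_mem' c _ h := h.smul c

lemma isClosed_partialGraph (i : Fin n) :
    IsClosed (partialGraph n i : Set (WithLp 2 (L2Space n × L2Space n))) := by
  have : (partialGraph n i : Set (WithLp 2 (L2Space n × L2Space n))) =
      ⋂ φ : {φ : EuclideanSpace ℝ (Fin n) → ℝ // ContDiff ℝ ∞ φ ∧ HasCompactSupport φ},
        {p | inner ℂ (testL2 (partialDeriv i φ)) p.fst = - inner ℂ (testL2 φ.1) p.snd} := by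
    ext p
    simp only [Set.mem_iInter, Subtype.forall]
    exact ⟨fun h φ hφ => h φ hφ.1 hφ.2, fun h φ hφ hφ' => h φ ⟨hφ, hφ'⟩⟩
  rw [this]
  refine isClosed_iInter fun φ => isClosed_eq ?_ ?_
  · exact continuous_const.inner (WithLp.prod_continuous_ofLp 2 _ _).fst
  · exact (continuous_const.inner (WithLp.prod_continuous_ofLp 2 _ _).snd).neg

/-- The graph of `∂_i` on test functions. -/
noncomputable def testGraph (n : ℕ) (i : Fin n) : Submodule ℂ (WithLp 2 (L2Space n × L2Space n)) :=
  Submodule.span ℂ {p | ∃ φ : EuclideanSpace ℝ (Fin n) → ℝ, ContDiff ℝ ∞ φ ∧ HasCompactSupport φ ∧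
    p = WithLp.toLp 2 (testL2 φ, testL2 (partialDeriv i φ))}

/-- Test functions are dense in the graph of `∂_i`: an element `(B, ∂_i B)` of the graph orthogonal
to them satisfies `∂_i ∂_i B = B`, so `B ± ∂_i B` are eigenfunctions of `∂_i`. -/
lemma partialGraph_le_closure (i : Fin n) :
    partialGraph n i ≤ (testGraph n i).topologicalClosure := by
  have hle : (testGraph n i).topologicalClosure ≤ partialGraph n i := by
    refine Submodule.topologicalClosure_minimal _ ?_ (isClosed_partialGraph i)
    refine Submodule.span_le.2 ?_
    rintro _ ⟨φ, hφ, hφ', rfl⟩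
    exact hasPartial_testL2 hφ hφ' i
  intro p hp
  set N := (testGraph n i).topologicalClosure
  have hNc : IsClosed (N : Set (WithLp 2 (L2Space n × L2Space n))) :=
    Submodule.isClosed_topologicalClosure _
  have : CompleteSpace N := hNc.completeSpace_coe
  obtain ⟨y, hy, z, hz, rfl⟩ := N.exists_add_mem_mem_orthogonal p
  have hzg : HasPartial i z.fst z.snd := by
    have := (partialGraph n i).sub_mem hp (hle hy)
    rwa [add_sub_cancel_left] at this
  have hz2 : HasPartial i z.snd z.fst := by
    intro φ hφ hφ'
    have hmem : WithLp.toLp 2 (testL2 φ, testL2 (partialDeriv i φ)) ∈ N :=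
      Submodule.le_topologicalClosure _ (Submodule.subset_span ⟨φ, hφ, hφ', rfl⟩)
    have h1 := (Submodule.mem_orthogonal _ _).1 hz _ hmem
    rw [WithLp.prod_inner_apply] at h1
    exact eq_neg_of_add_eq_zero_right h1
  have h1 : z.fst + z.snd = 0 := by
    refine HasPartial.eq_zero_of_eigen (i := i) (c := 1) (by norm_num) ?_
    have := hzg.add hz2
    rw [add_comm z.snd] at this
    rwa [Complex.ofReal_one, one_smul]
  have h2 : z.fst - z.snd = 0 := by
    refine HasPartial.eq_zero_of_eigen (i := i) (c := -1) (by norm_num) ?_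
    have := hzg.add (hz2.smul (-1))
    rw [neg_one_smul, neg_one_smul] at this
    rw [Complex.ofReal_neg, Complex.ofReal_one, neg_one_smul, neg_sub]
    simpa [sub_eq_add_neg] using this
  have h3 : z.fst = z.snd := sub_eq_zero.1 h2
  have h4 : z.snd = 0 := by
    rw [h3, ← two_smul ℂ] at h1
    exact (smul_eq_zero.1 h1).resolve_left two_ne_zero
  have hz0 : z = 0 := by
    rw [← WithLp.toLp_ofLp 2 z, show z.ofLp = 0 from Prod.ext (h3.trans h4) h4]; rfl
  rw [hz0, add_zero]
  exact hy

/-- Integration by parts in `L²`. -/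
theorem HasPartial.inner_eq {i : Fin n} {u u' v v' : L2Space n} (hu : HasPartial i u u')
    (hv : HasPartial i v v') : inner ℂ u' v = - inner ℂ u v' := by
  have hcl : IsClosed {p : WithLp 2 (L2Space n × L2Space n) |
      inner ℂ p.snd v = - inner ℂ p.fst v'} :=
    isClosed_eq ((WithLp.prod_continuous_ofLp 2 _ _).snd.inner continuous_const)
      ((WithLp.prod_continuous_ofLp 2 _ _).fst.inner continuous_const).neg
  have hsub : (testGraph n i : Set (WithLp 2 (L2Space n × L2Space n))) ⊆
      {p | inner ℂ p.snd v = - inner ℂ p.fst v'} := by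
    intro p hp
    refine Submodule.span_induction ?_ ?_ ?_ ?_ hp
    · rintro _ ⟨φ, hφ, hφ', rfl⟩
      exact hv φ hφ hφ'
    · simp
    · intro x y _ _ hx hy
      simp only [Set.mem_ofPred_eq, WithLp.add_snd, WithLp.add_fst, inner_add_left] at hx hy ⊢
      rw [hx, hy]; ring
    · intro c x _ hx
      simp only [Set.mem_ofPred_eq, WithLp.smul_snd, WithLp.smul_fst, inner_smul_left] at hx ⊢
      rw [hx]; ring
  exact hcl.closure_subset_iff.2 hsub (partialGraph_le_closure i (x := WithLp.toLp 2 (u, u')) hu)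

end IBP

/-! ### Weighted interpolation of intermediate derivatives -/

section RealInterpolation

/-- If `X_{j+1}² ≤ C_j X_j (X_{j+2} + X_{j+1})` for `j < k`, then `X_k` is controlled by a small
multiple of `X_{k+1}` and a large multiple of `X_0`. -/
lemma exists_le_succ_of_sq_le (C : ℕ → ℝ) (hC : ∀ k, 0 ≤ C k) (k : ℕ) :
    ∀ ε : ℝ, 0 < ε → ∃ B, 0 ≤ B ∧ ∀ X : ℕ → ℝ, (∀ j, 0 ≤ X j) →
      (∀ j < k, X (j + 1) ^ 2 ≤ C j * (X j * (X (j + 2) + X (j + 1)))) →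
      X k ≤ ε * X (k + 1) + B * X 0 := by
  induction k with
  | zero =>
    intro ε hε
    refine ⟨1, zero_le_one, fun X hX _ => ?_⟩
    have := mul_nonneg hε.le (hX 1)
    linarith
  | succ k ih =>
    intro ε hε
    set C' := C k * (1 + 2 / ε) with hC'
    have hC'0 : 0 ≤ C' := mul_nonneg (hC k) (by positivity)
    obtain ⟨B, hB, h⟩ := ih (1 / (2 * (C' + 1))) (by positivity)
    refine ⟨2 * (C' * B), by positivity, fun X hX hrec => ?_⟩
    have h1 := h X hX fun j hj => hrec j (hj.trans (Nat.lt_succ_self k))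
    have h2 := hrec k (Nat.lt_succ_self k)
    have h0 := hX 0
    have hk := hX k
    have hk1 := hX (k + 1)
    have hk2 := hX (k + 2)
    have h3 : X (k + 1) ≤ ε / 2 * X (k + 2) + C' * X k := by
      by_cases hle : X (k + 1) ≤ ε / 2 * X (k + 2)
      · have := mul_nonneg hC'0 hk
        linarith
      · push Not at hle
        have hpos : 0 < X (k + 1) := lt_of_le_of_lt (by positivity) hle
        have h4 : X (k + 2) ≤ 2 / ε * X (k + 1) := by
          rw [div_mul_eq_mul_div, le_div_iff₀ hε]; linarith
        have h5 : X (k + 1) * X (k + 1) ≤ X (k + 1) * (C' * X k) := by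
          calc X (k + 1) * X (k + 1) = X (k + 1) ^ 2 := (sq _).symm
            _ ≤ C k * (X k * (X (k + 2) + X (k + 1))) := h2
            _ ≤ C k * (X k * (2 / ε * X (k + 1) + X (k + 1))) := by
                have := hC k
                gcongr
            _ = _ := by rw [hC']; ring
        have h6 := le_of_mul_le_mul_left h5 hpos
        have : 0 ≤ ε / 2 * X (k + 2) := by positivity
        linarith
    have h7 : C' * X k ≤ 1 / 2 * X (k + 1) + C' * B * X 0 := by
      calc C' * X k ≤ C' * (1 / (2 * (C' + 1)) * X (k + 1) + B * X 0) := by gcongr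
        _ = C' / (C' + 1) * (1 / 2 * X (k + 1)) + C' * B * X 0 := by field_simp
        _ ≤ 1 * (1 / 2 * X (k + 1)) + C' * B * X 0 := by
            gcongr
            rw [div_le_one (by positivity)]; linarith
        _ = _ := by ring
    linarith

/-- If `X_{k+1}² ≤ C_k X_k (X_{k+2} + X_{k+1})` for `k + 1 < m`, then `X_0, …, X_{m-1}` are
controlled by a small multiple of `X_m` and a large multiple of `X_0`. -/
lemma exists_sum_le_of_sq_le (C : ℕ → ℝ) (hC : ∀ k, 0 ≤ C k) (m : ℕ) {ε : ℝ} (hε : 0 < ε) :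
    ∃ B, 0 ≤ B ∧ ∀ X : ℕ → ℝ, (∀ j, 0 ≤ X j) →
      (∀ j, j + 1 < m → X (j + 1) ^ 2 ≤ C j * (X j * (X (j + 2) + X (j + 1)))) →
      ∑ k ∈ Finset.range m, X k ≤ ε * X m + B * X 0 := by
  have step : ∀ l k : ℕ, ∀ ε : ℝ, 0 < ε → ∃ B, 0 ≤ B ∧ ∀ X : ℕ → ℝ, (∀ j, 0 ≤ X j) →
      (∀ j, j + 1 < k + (l + 1) → X (j + 1) ^ 2 ≤ C j * (X j * (X (j + 2) + X (j + 1)))) →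
      X k ≤ ε * X (k + (l + 1)) + B * X 0 := by
    intro l
    induction l with
    | zero =>
      intro k ε hε
      obtain ⟨B, hB, h⟩ := exists_le_succ_of_sq_le C hC k ε hε
      exact ⟨B, hB, fun X hX hrec => h X hX fun j hj => hrec j (by omega)⟩
    | succ l ih =>
      intro k ε hε
      obtain ⟨B, hB, h⟩ := exists_le_succ_of_sq_le C hC k 1 one_pos
      obtain ⟨B', hB', h'⟩ := ih (k + 1) ε hε
      refine ⟨B + B', by positivity, fun X hX hrec => ?_⟩
      have e : k + 1 + (l + 1) = k + (l + 1 + 1) := by ring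
      have h1 := h X hX fun j hj => hrec j (by omega)
      have h2 := h' X hX fun j hj => hrec j (by omega)
      rw [e] at h2
      linarith
  have hε' : 0 < ε / (m + 1) := by positivity
  have step' : ∀ k < m, ∃ B, 0 ≤ B ∧ ∀ X : ℕ → ℝ, (∀ j, 0 ≤ X j) →
      (∀ j, j + 1 < m → X (j + 1) ^ 2 ≤ C j * (X j * (X (j + 2) + X (j + 1)))) →
      X k ≤ ε / (m + 1) * X m + B * X 0 := by
    intro k hk
    obtain ⟨l, rfl⟩ : ∃ l, m = k + (l + 1) := ⟨m - k - 1, by omega⟩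
    exact step l k _ hε'
  choose! B hB h using step'
  refine ⟨∑ k ∈ Finset.range m, B k, Finset.sum_nonneg fun k hk => hB k (Finset.mem_range.1 hk),
    fun X hX hrec => ?_⟩
  calc ∑ k ∈ Finset.range m, X k ≤ ∑ k ∈ Finset.range m, (ε / (m + 1) * X m + B k * X 0) :=
        Finset.sum_le_sum fun k hk => h k (Finset.mem_range.1 hk) X hX hrec
    _ = m / (m + 1) * (ε * X m) + (∑ k ∈ Finset.range m, B k) * X 0 := by
        rw [Finset.sum_add_distrib, Finset.sum_const, Finset.card_range, ← Finset.sum_mul,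
          nsmul_eq_mul]
        field_simp
    _ ≤ 1 * (ε * X m) + (∑ k ∈ Finset.range m, B k) * X 0 := by
        have := mul_nonneg hε.le (hX m)
        gcongr
        rw [div_le_one (by positivity)]; linarith
    _ = _ := by ring

end RealInterpolation

section Interpolation

variable {n : ℕ}

lemma mem_multiIndices {k : ℕ} {γ : Fin n → ℕ} : γ ∈ multiIndices n k ↔ ∑ i, γ i = k := by
  simp [multiIndices]

lemma sum_add_single (γ : Fin n → ℕ) (i : Fin n) :
    ∑ j, (γ + Pi.single i 1 : Fin n → ℕ) j = (∑ j, γ j) + 1 := by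
  simp [Finset.sum_add_distrib]

lemma exists_eq_add_single {γ : Fin n → ℕ} {k : ℕ} (h : ∑ j, γ j = k + 1) :
    ∃ (γ' : Fin n → ℕ) (i : Fin n), γ = γ' + Pi.single i 1 ∧ ∑ j, γ' j = k := by
  obtain ⟨i, -, hi⟩ : ∃ i ∈ Finset.univ, γ i ≠ 0 :=
    Finset.exists_ne_zero_of_sum_ne_zero (by rw [h]; omega)
  have e : γ = (γ - Pi.single i 1) + Pi.single i 1 := by
    ext j
    by_cases hj : j = i
    · subst hj; simp; omega
    · simp [hj]
  refine ⟨γ - Pi.single i 1, i, e, ?_⟩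
  have := sum_add_single (γ - Pi.single i 1) i
  rw [← e, h] at this
  omega

/-- A family `D γ` in `L²` is an `m`-jet if `D (γ + e_i) = ∂_i D γ` for `|γ| < m`; then
`D γ = ∂^γ (D 0)` for `|γ| ≤ m`. -/
def IsJet (m : ℕ) (D : (Fin n → ℕ) → L2Space n) : Prop :=
  ∀ γ i, ∑ j, γ j < m → HasPartial i (D γ) (D (γ + Pi.single i 1))

lemma IsJet.isWeakDeriv {m : ℕ} {D : (Fin n → ℕ) → L2Space n} (hD : IsJet m D) :
    ∀ (k : ℕ) (γ : Fin n → ℕ), ∑ j, γ j = k → k ≤ m → IsWeakDeriv γ (D 0) (D γ) := by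
  intro k
  induction k with
  | zero =>
    intro γ hγ _
    have : γ = 0 := by ext j; simpa using (Finset.sum_eq_zero_iff.1 hγ) j (Finset.mem_univ j)
    rw [this]
    exact isWeakDeriv_zero _
  | succ k ih =>
    intro γ hγ hk
    obtain ⟨γ', i, rfl, hγ'⟩ := exists_eq_add_single hγ
    rw [(ih γ' hγ' (by omega)).add_single_iff]
    exact hD γ' i (by omega)

/-- The weighted sum `∑_{|γ| = k} ‖η^{k+1} D γ‖`. With these exponents, a derivative falling on the
cutoff costs one power of `η`, as does passing from order `k + 1` to order `k`. -/
noncomputable def wsum (η : EuclideanSpace ℝ (Fin n) → ℝ) (D : (Fin n → ℕ) → L2Space n)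
    (k : ℕ) : ℝ :=
  ∑ γ ∈ multiIndices n k, ‖mulReal (fun x => η x ^ (k + 1)) (D γ)‖

lemma wsum_nonneg (η : EuclideanSpace ℝ (Fin n) → ℝ) (D : (Fin n → ℕ) → L2Space n) (k : ℕ) :
    0 ≤ wsum η D k := Finset.sum_nonneg fun _ _ => norm_nonneg _

lemma wsum_zero (η : EuclideanSpace ℝ (Fin n) → ℝ) (D : (Fin n → ℕ) → L2Space n) :
    wsum η D 0 = ‖mulReal η (D 0)‖ := by
  rw [wsum, show multiIndices n 0 = {0} from ?_, Finset.sum_singleton]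
  · simp only [zero_add, pow_one]
  · ext γ
    simp [mem_multiIndices, funext_iff]

lemma norm_le_wsum (η : EuclideanSpace ℝ (Fin n) → ℝ) (D : (Fin n → ℕ) → L2Space n) {k : ℕ}
    {γ : Fin n → ℕ} (hγ : ∑ i, γ i = k) :
    ‖mulReal (fun x => η x ^ (k + 1)) (D γ)‖ ≤ wsum η D k :=
  Finset.single_le_sum (f := fun γ => ‖mulReal (fun x => η x ^ (k + 1)) (D γ)‖)
    (fun _ _ => norm_nonneg _) (mem_multiIndices.2 hγ)

lemma norm_mulReal_sq {ψ : EuclideanSpace ℝ (Fin n) → ℝ} (hψ : IsMultiplier ψ) (u : L2Space n) :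
    ‖mulReal ψ u‖ ^ 2 = ‖inner ℂ u (mulReal (fun x => ψ x * ψ x) u)‖ := by
  rw [← hψ.mulReal_mulReal hψ, ← inner_mulReal_left hψ.memLp, inner_self_eq_norm_sq_to_K]
  simp

/-- Integrating by parts once, `‖η^{k+2} ∂_i w‖²` is estimated by `‖η^{k+1} w‖`, `‖η^{k+3} ∂_i² w‖`
and the gradient of `η`. -/
lemma norm_sq_le_of_hasPartial {η : EuclideanSpace ℝ (Fin n) → ℝ} (hη : IsMultiplier η) {K : ℝ}
    {i : Fin n} (hK : ∀ x, |partialDeriv i η x| ≤ K) {w g h : L2Space n} (hw : HasPartial i w g)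
    (hg : HasPartial i g h) (k : ℕ) :
    ‖mulReal (fun x => η x ^ (k + 2)) g‖ ^ 2 ≤ ‖mulReal (fun x => η x ^ (k + 1)) w‖ *
      (‖mulReal (fun x => η x ^ (k + 3)) h‖ +
        (2 * k + 4) * K * ‖mulReal (fun x => η x ^ (k + 2)) g‖) := by
  have h1 : IsMultiplier fun x => η x ^ (k + 2) * η x ^ (k + 2) := (hη.pow _).mul (hη.pow _)
  have hd : mulReal (partialDeriv i fun x => η x ^ (k + 2) * η x ^ (k + 2)) g =
      mulReal (fun x => η x ^ (k + 1)) (((2 * k + 4 : ℝ) : ℂ) •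
        mulOp (fun x => (partialDeriv i η x : ℂ) * ((η x ^ (k + 2) : ℝ) : ℂ)) g) := by
    have hm : MemLp (fun x => (partialDeriv i η x : ℂ) * ((η x ^ (k + 2) : ℝ) : ℂ)) ∞ volume :=
      (hη.pow (k + 2)).memLp.mul (r := ∞) (hη.memLp_deriv i)
    apply Lp.ext
    rw [map_smul]
    filter_upwards [coeFn_mulOp (h1.memLp_deriv i) g,
      coeFn_mulOp (hη.pow (k + 1)).memLp
        (mulOp (fun x => (partialDeriv i η x : ℂ) * ((η x ^ (k + 2) : ℝ) : ℂ)) g),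
      coeFn_mulOp hm g, Lp.coeFn_smul ((2 * k + 4 : ℝ) : ℂ) (mulReal (fun x => η x ^ (k + 1))
        (mulOp (fun x => (partialDeriv i η x : ℂ) * ((η x ^ (k + 2) : ℝ) : ℂ)) g))]
      with x e1 e2 e3 e4
    rw [e4, Pi.smul_apply, mulReal, e1, e2, e3, partialDeriv_mul (hη.pow _).contDiff
      (hη.pow _).contDiff, partialDeriv_pow hη.contDiff, smul_eq_mul]
    push_cast
    ring
  have he : mulReal (fun x => η x ^ (k + 2) * η x ^ (k + 2)) h =
      mulReal (fun x => η x ^ (k + 1)) (mulReal (fun x => η x ^ (k + 3)) h) := by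
    rw [(hη.pow _).mulReal_mulReal (hη.pow _)]
    congr 2
    ext x
    ring
  have hn : ‖mulOp (fun x => (partialDeriv i η x : ℂ) * ((η x ^ (k + 2) : ℝ) : ℂ)) g‖ ≤
      K * ‖mulReal (fun x => η x ^ (k + 2)) g‖ := by
    refine norm_mulOp_le ?_ (hη.pow (k + 2)).memLp (Eventually.of_forall fun x => ?_) g
    · exact (hη.pow (k + 2)).memLp.mul (r := ∞) (hη.memLp_deriv i)
    · rw [norm_mul]
      refine mul_le_mul_of_nonneg_right ?_ (norm_nonneg _)
      simpa using hK x
  have hibp := hw.inner_eq (hg.mulReal h1)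
  rw [norm_mulReal_sq (hη.pow (k + 2)), hibp, norm_neg, hd, he, ← map_add,
    ← inner_mulReal_left (hη.pow (k + 1)).memLp]
  refine (norm_inner_le_norm _ _).trans (mul_le_mul_of_nonneg_left ?_ (norm_nonneg _))
  refine (norm_add_le _ _).trans ?_
  rw [add_comm, norm_smul, Complex.norm_real, Real.norm_of_nonneg (by positivity), mul_assoc]
  gcongr

lemma wsum_sq_le {η : EuclideanSpace ℝ (Fin n) → ℝ} (hη : IsMultiplier η) {K : ℝ} (hK0 : 0 ≤ K)
    (hK : ∀ i x, |partialDeriv i η x| ≤ K) {m : ℕ} {D : (Fin n → ℕ) → L2Space n} (hD : IsJet m D)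
    {k : ℕ} (hk : k + 1 < m) :
    wsum η D (k + 1) ^ 2 ≤ ((multiIndices n (k + 1)).card : ℝ) ^ 2 *
      (wsum η D k * (wsum η D (k + 2) + (2 * k + 4) * K * wsum η D (k + 1))) := by
  have hterm : ∀ γ ∈ multiIndices n (k + 1), ‖mulReal (fun x => η x ^ (k + 2)) (D γ)‖ ^ 2 ≤
      wsum η D k * (wsum η D (k + 2) + (2 * k + 4) * K * wsum η D (k + 1)) := by
    intro γ hγ
    rw [mem_multiIndices] at hγ
    obtain ⟨γ', i, rfl, hγ'⟩ := exists_eq_add_single hγ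
    refine (norm_sq_le_of_hasPartial hη (hK i) (hD γ' i (by omega))
      (hD _ i (by omega)) k).trans ?_
    have e1 := norm_le_wsum η D hγ'
    have e2 := norm_le_wsum η D hγ
    have e3 := norm_le_wsum η D (γ := γ' + Pi.single i 1 + Pi.single i 1) (k := k + 2)
      (by rw [sum_add_single, sum_add_single, hγ'])
    have := wsum_nonneg η D k
    gcongr
  calc wsum η D (k + 1) ^ 2 ≤ (multiIndices n (k + 1)).card *
        ∑ γ ∈ multiIndices n (k + 1), ‖mulReal (fun x => η x ^ (k + 2)) (D γ)‖ ^ 2 :=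
        sq_sum_le_card_mul_sum_sq
    _ ≤ (multiIndices n (k + 1)).card * ((multiIndices n (k + 1)).card •
        (wsum η D k * (wsum η D (k + 2) + (2 * k + 4) * K * wsum η D (k + 1)))) := by
        gcongr
        exact Finset.sum_le_card_nsmul _ _ _ hterm
    _ = _ := by rw [nsmul_eq_mul]; ring

/-- The weighted interpolation inequality: intermediate derivatives, weighted by powers of a cutoff
`η` with `|∇ η| ≤ M / r`, are controlled by a small multiple of the highest ones and a large
multiple of the function itself. -/
theorem exists_sum_wsum_le (n m : ℕ) {M : ℝ} (hM : 0 ≤ M) {ε : ℝ} (hε : 0 < ε) :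
    ∃ B, 0 ≤ B ∧ ∀ (η : EuclideanSpace ℝ (Fin n) → ℝ) (r : ℝ) (D : (Fin n → ℕ) → L2Space n),
      IsMultiplier η → 0 < r → (∀ i x, |partialDeriv i η x| ≤ M / r) → IsJet m D →
      ∑ k ∈ Finset.range m, r ^ k * wsum η D k ≤ ε * (r ^ m * wsum η D m) + B * wsum η D 0 := by
  obtain ⟨B, hB, h⟩ := exists_sum_le_of_sq_le
    (fun k => ((multiIndices n (k + 1)).card : ℝ) ^ 2 * (1 + (2 * k + 4) * M))
    (fun k => by positivity) m hε
  refine ⟨B, hB, fun η r D hη hr hK hD => ?_⟩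
  have := h (fun k => r ^ k * wsum η D k)
    (fun k => mul_nonneg (by positivity) (wsum_nonneg η D k)) fun k hk => ?_
  · simpa using this
  have h1 := wsum_sq_le hη (by positivity) hK hD hk
  have a0 := wsum_nonneg η D k
  have a1 := wsum_nonneg η D (k + 1)
  have a2 := wsum_nonneg η D (k + 2)
  calc (r ^ (k + 1) * wsum η D (k + 1)) ^ 2 = r ^ (2 * k + 2) * wsum η D (k + 1) ^ 2 := by ring
    _ ≤ r ^ (2 * k + 2) * (((multiIndices n (k + 1)).card : ℝ) ^ 2 *
        (wsum η D k * (wsum η D (k + 2) + (2 * k + 4) * (M / r) * wsum η D (k + 1)))) := by gcongr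
    _ = ((multiIndices n (k + 1)).card : ℝ) ^ 2 * ((r ^ k * wsum η D k) *
        (r ^ (k + 2) * wsum η D (k + 2) + (2 * k + 4) * M * (r ^ (k + 1) * wsum η D (k + 1)))) := by
        field_simp
        ring
    _ ≤ ((multiIndices n (k + 1)).card : ℝ) ^ 2 * ((r ^ k * wsum η D k) *
        ((1 + (2 * k + 4) * M) * (r ^ (k + 2) * wsum η D (k + 2) + r ^ (k + 1) * wsum η D (k + 1)))) := by
        gcongr
        have : 0 ≤ (2 * k + 4) * M * (r ^ (k + 2) * wsum η D (k + 2)) := by positivity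
        have : 0 ≤ r ^ (k + 1) * wsum η D (k + 1) := by positivity
        nlinarith
    _ = _ := by ring

end Interpolation

/-! ### The Leibniz rule for cut-off Sobolev functions -/

section Leibniz

variable {n : ℕ}

/-- The function `x ↦ f ((x - x₀) / r)`. -/
noncomputable def rescale (r : ℝ) (x₀ : EuclideanSpace ℝ (Fin n))
    (f : EuclideanSpace ℝ (Fin n) → ℝ) :
    EuclideanSpace ℝ (Fin n) → ℝ := fun x => f (r⁻¹ • (x - x₀))

variable {r : ℝ} {x₀ : EuclideanSpace ℝ (Fin n)} {f : EuclideanSpace ℝ (Fin n) → ℝ}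

lemma partialDeriv_rescale (hf : ContDiff ℝ ∞ f) (i : Fin n) (x : EuclideanSpace ℝ (Fin n)) :
    partialDeriv i (rescale r x₀ f) x = r⁻¹ * rescale r x₀ (partialDeriv i f) x := by
  have h1 : HasFDerivAt (fun x : EuclideanSpace ℝ (Fin n) => r⁻¹ • (x - x₀))
      (r⁻¹ • ContinuousLinearMap.id ℝ (EuclideanSpace ℝ (Fin n))) x :=
    ((hasFDerivAt_id x).sub_const x₀).const_smul r⁻¹
  have h2 := ((hf.differentiable (by simp) (r⁻¹ • (x - x₀))).hasFDerivAt).comp x h1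
  have h3 : fderiv ℝ (rescale r x₀ f) x = _ := h2.fderiv
  unfold partialDeriv
  rw [h3]
  simp [rescale]

lemma ContDiff.rescale (hf : ContDiff ℝ ∞ f) : ContDiff ℝ ∞ (rescale r x₀ f) :=
  hf.comp (by fun_prop)

lemma IsMultiplier.rescale (hf : IsMultiplier f) : IsMultiplier (rescale r x₀ f) where
  contDiff := hf.contDiff.rescale
  bdd := by
    obtain ⟨C, hC⟩ := hf.bdd
    exact ⟨C, fun x => hC _⟩
  bdd_deriv i := by
    obtain ⟨C, hC⟩ := hf.bdd_deriv i
    refine ⟨|r⁻¹| * C, fun x => ?_⟩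
    rw [partialDeriv_rescale hf.contDiff, abs_mul]
    exact mul_le_mul_of_nonneg_left (hC _) (abs_nonneg _)

lemma mulReal_const_mul (c : ℝ) {ψ : EuclideanSpace ℝ (Fin n) → ℝ}
    (hψ : MemLp (fun x => (ψ x : ℂ)) ∞ volume) (u : L2Space n) :
    mulReal (fun x => c * ψ x) u = (c : ℂ) • mulReal ψ u := by
  rw [mulReal, mulReal, ← mulOp_smul (c : ℂ) hψ]
  simp only [Complex.ofReal_mul]

/-- The finite sums of lower order terms `r^{-(k-|γ|)} b((x - x₀)/r) η^{q+(m-k)+|γ|+1} D γ` with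
`|γ| < k` and `b` smooth, which appear in the derivatives of order `k` of `η^{q+m+1} D 0`; here
`η` is the rescaled cutoff `η₀((x - x₀)/r)`. The terms are functions of `r`, `x₀` and `D`. -/
inductive IsLower (η₀ : EuclideanSpace ℝ (Fin n) → ℝ) (q m k : ℕ) :
    (ℝ → EuclideanSpace ℝ (Fin n) → ((Fin n → ℕ) → L2Space n) → L2Space n) → Prop
  | zero : IsLower η₀ q m k fun _ _ _ => 0
  | add {F F' : ℝ → EuclideanSpace ℝ (Fin n) → ((Fin n → ℕ) → L2Space n) → L2Space n} :
      IsLower η₀ q m k F → IsLower η₀ q m k F' →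
        IsLower η₀ q m k fun r x₀ D => F r x₀ D + F' r x₀ D
  | term {l s p : ℕ} {γ : Fin n → ℕ} {b : EuclideanSpace ℝ (Fin n) → ℝ} (hb : ContDiff ℝ ∞ b)
      (hkl : k + l = m) (hs : (∑ i, γ i) + (s + 1) = k) (hp : p = q + l + ∑ i, γ i) :
      IsLower η₀ q m k fun r x₀ D =>
        ((r⁻¹ ^ (s + 1) : ℝ) : ℂ) • mulReal (rescale r x₀ fun y => b y * η₀ y ^ (p + 1)) (D γ)

variable {η₀ : EuclideanSpace ℝ (Fin n) → ℝ} {q m : ℕ}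

lemma isMultiplier_mul_pow {b : EuclideanSpace ℝ (Fin n) → ℝ} (hη : ContDiff ℝ ∞ η₀)
    (hη' : HasCompactSupport η₀) (hb : ContDiff ℝ ∞ b) (p : ℕ) :
    IsMultiplier fun y => b y * η₀ y ^ (p + 1) := by
  refine .of_hasCompactSupport (hb.mul (hη.pow _)) ?_
  have : HasCompactSupport fun y => η₀ y ^ (p + 1) :=
    hη'.comp_left (g := fun t : ℝ => t ^ (p + 1)) (by simp)
  exact this.mul_left

/-- Differentiating a lower order term of order `k` gives one of order `k + 1`. -/
lemma IsLower.exists_hasPartial (hη : ContDiff ℝ ∞ η₀) (hη' : HasCompactSupport η₀) (i : Fin n)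
    {k : ℕ} {F : ℝ → EuclideanSpace ℝ (Fin n) → ((Fin n → ℕ) → L2Space n) → L2Space n}
    (hF : IsLower η₀ q m k F) (hk : k < m) :
    ∃ F', IsLower η₀ q m (k + 1) F' ∧ ∀ r x₀ D, IsJet m D →
      HasPartial i (F r x₀ D) (F' r x₀ D) := by
  induction hF with
  | zero => exact ⟨_, .zero, fun r x₀ D _ => .zero i⟩
  | add _ _ ih1 ih2 =>
    obtain ⟨F₁, h1, h1'⟩ := ih1
    obtain ⟨F₂, h2, h2'⟩ := ih2
    exact ⟨_, h1.add h2, fun r x₀ D hD => (h1' r x₀ D hD).add (h2' r x₀ D hD)⟩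
  | @term l s p γ b hb hkl hs hp =>
    obtain ⟨l, rfl⟩ : ∃ l', l = l' + 1 := ⟨l - 1, by omega⟩
    obtain ⟨p, rfl⟩ : ∃ p', p = p' + 1 := ⟨p - 1, by omega⟩
    have hM := isMultiplier_mul_pow hη hη' hb (p + 1)
    have hb' : ContDiff ℝ ∞ fun y =>
        η₀ y * partialDeriv i b y + ((p + 1 : ℕ) + 1 : ℝ) * b y * partialDeriv i η₀ y :=
      (hη.mul (hb.partialDeriv i)).add ((contDiff_const.mul hb).mul (hη.partialDeriv i))
    refine ⟨_, (IsLower.term (l := l) (s := s + 1) (p := p) (γ := γ) hb' (by omega) (by omega)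
      (by omega)).add (IsLower.term (l := l) (s := s) (p := p + 1) (γ := γ + Pi.single i 1) hb
      (by omega) (by rw [sum_add_single]; omega) (by rw [sum_add_single]; omega)),
      fun r x₀ D hD => ?_⟩
    have h := ((hD γ i (by omega)).mulReal (hM.rescale (r := r) (x₀ := x₀))).smul
      ((r⁻¹ ^ (s + 1) : ℝ) : ℂ)
    rw [smul_add] at h
    convert h using 2
    have e : partialDeriv i (rescale r x₀ fun y => b y * η₀ y ^ (p + 1 + 1)) =
        fun x => r⁻¹ * rescale r x₀ (fun y => (η₀ y * partialDeriv i b y +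
          ((p + 1 : ℕ) + 1 : ℝ) * b y * partialDeriv i η₀ y) * η₀ y ^ (p + 1)) x := by
      ext x
      rw [partialDeriv_rescale hM.contDiff]
      congr 1
      unfold rescale
      rw [partialDeriv_mul hb (hη.pow _), partialDeriv_pow hη]
      simp only [Nat.add_sub_cancel]
      push_cast
      ring
    rw [e, mulReal_const_mul _ (isMultiplier_mul_pow hη hη' hb' p).rescale.memLp, smul_smul]
    congr 1
    push_cast
    ring

/-- The Leibniz rule: `∂^α (η^{q+m+1} u) = η^{q+m+1} ∂^α u + lower order terms`. -/
lemma exists_leibniz (hη : ContDiff ℝ ∞ η₀) (hη' : HasCompactSupport η₀) (q m : ℕ) :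
    ∀ (k : ℕ) (α : Fin n → ℕ), ∑ i, α i = k → k ≤ m →
    ∃ F, IsLower η₀ q m k F ∧ ∀ r x₀ D, IsJet m D →
      IsWeakDeriv α (mulReal (rescale r x₀ fun y => η₀ y ^ (q + m + 1)) (D 0))
        ((mulReal (rescale r x₀ fun y => η₀ y ^ (q + m + 1)) (D α) + F r x₀ D : L2Space n)) := by
  have hM : IsMultiplier fun y => η₀ y ^ (q + m + 1) :=
    (IsMultiplier.of_hasCompactSupport hη hη').pow _
  intro k
  induction k with
  | zero =>
    intro α hα _
    have : α = 0 := by ext j; simpa using (Finset.sum_eq_zero_iff.1 hα) j (Finset.mem_univ j)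
    subst this
    refine ⟨_, .zero, fun r x₀ D _ => ?_⟩
    rw [add_zero]
    exact isWeakDeriv_zero _
  | succ k ih =>
    intro α hα hk
    obtain ⟨α', i, rfl, hα'⟩ := exists_eq_add_single hα
    obtain ⟨F, hF, hF'⟩ := ih α' hα' (by omega)
    obtain ⟨F₁, hF₁, hF₁'⟩ := hF.exists_hasPartial hη hη' i (by omega)
    have hb : ContDiff ℝ ∞ fun y => ((q + m : ℕ) + 1 : ℝ) * partialDeriv i η₀ y :=
      contDiff_const.mul (hη.partialDeriv i)
    obtain ⟨l, rfl⟩ : ∃ l, m = k + 1 + l := ⟨m - (k + 1), by omega⟩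
    obtain ⟨p, hp⟩ : ∃ p, q + (k + 1 + l) = p + 1 := ⟨q + k + l, by omega⟩
    refine ⟨_, (IsLower.term (l := l) (s := 0) (p := p) (γ := α') hb (by omega) (by omega)
      (by omega)).add hF₁, fun r x₀ D hD => ?_⟩
    rw [(hF' r x₀ D hD).add_single_iff]
    have h := ((hD α' i (by omega)).mulReal (hM.rescale (r := r) (x₀ := x₀))).add (hF₁' r x₀ D hD)
    convert h using 1
    rw [← add_assoc, add_comm (mulReal (partialDeriv i _) _)]
    congr 2
    have e : partialDeriv i (rescale r x₀ fun y => η₀ y ^ (q + (k + 1 + l) + 1)) =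
        fun x => r⁻¹ * rescale r x₀ (fun y => (((q + (k + 1 + l) : ℕ) + 1 : ℝ) *
          partialDeriv i η₀ y) * η₀ y ^ (p + 1)) x := by
      ext x
      rw [partialDeriv_rescale hM.contDiff]
      congr 1
      unfold rescale
      rw [partialDeriv_pow hη, hp]
      simp only [Nat.add_sub_cancel]
      push_cast
      ring
    rw [e, mulReal_const_mul _ (isMultiplier_mul_pow hη hη' hb p).rescale.memLp]
    simp

/-- A lower order term of top order `m` is `η^q` times a remainder that is bounded by the weighted
sums of the derivatives of order less than `m`. -/
lemma IsLower.exists_bound (hη : ContDiff ℝ ∞ η₀) (hη' : HasCompactSupport η₀) {k : ℕ}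
    {F : ℝ → EuclideanSpace ℝ (Fin n) → ((Fin n → ℕ) → L2Space n) → L2Space n}
    (hF : IsLower η₀ q m k F) (hk : k = m) :
    ∃ (C : ℝ) (F' : ℝ → EuclideanSpace ℝ (Fin n) → ((Fin n → ℕ) → L2Space n) → L2Space n),
      0 ≤ C ∧ ∀ r x₀ D, 0 < r → F r x₀ D = mulReal (rescale r x₀ fun y => η₀ y ^ q) (F' r x₀ D) ∧
        ‖F' r x₀ D‖ ≤ C * (r⁻¹ ^ m * ∑ j ∈ Finset.range m, r ^ j * wsum (rescale r x₀ η₀) D j) := by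
  induction hF with
  | zero =>
    refine ⟨0, fun _ _ _ => 0, le_rfl, fun r x₀ D hr => ⟨by simp, by simp⟩⟩
  | add _ _ ih1 ih2 =>
    obtain ⟨C₁, F₁, hC₁, h1⟩ := ih1
    obtain ⟨C₂, F₂, hC₂, h2⟩ := ih2
    refine ⟨C₁ + C₂, fun r x₀ D => F₁ r x₀ D + F₂ r x₀ D, by positivity, fun r x₀ D hr => ⟨?_, ?_⟩⟩
    · simp only
      rw [(h1 r x₀ D hr).1, (h2 r x₀ D hr).1, map_add]
    · rw [add_mul]
      exact (norm_add_le _ _).trans (add_le_add (h1 r x₀ D hr).2 (h2 r x₀ D hr).2)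
  | @term l s p γ b hb hkl hs hp =>
    obtain rfl : l = 0 := by omega
    have hη₀ := IsMultiplier.of_hasCompactSupport hη hη'
    set j := ∑ i, γ i with hj
    have hM := isMultiplier_mul_pow hη hη' hb j
    obtain ⟨C, hC⟩ := hη'.isCompact.exists_bound_of_continuousOn hb.continuous.continuousOn
    refine ⟨max C 0, fun r x₀ D => ((r⁻¹ ^ (s + 1) : ℝ) : ℂ) •
      mulReal (rescale r x₀ fun y => b y * η₀ y ^ (j + 1)) (D γ), le_max_right _ _,
      fun r x₀ D hr => ⟨?_, ?_⟩⟩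
    · have e := ((hη₀.pow q).rescale (r := r) (x₀ := x₀)).mulReal_mulReal
        (hM.rescale (r := r) (x₀ := x₀)) (D γ)
      have e' : (rescale r x₀ fun y => b y * η₀ y ^ (p + 1)) = fun x =>
          rescale r x₀ (fun y => η₀ y ^ q) x * rescale r x₀ (fun y => b y * η₀ y ^ (j + 1)) x := by
        ext x
        simp only [rescale]
        rw [hp]; ring
      rw [map_smul, e, ← e']
    · have hbd : ‖mulReal (rescale r x₀ fun y => b y * η₀ y ^ (j + 1)) (D γ)‖ ≤
          max C 0 * ‖mulReal (fun x => rescale r x₀ η₀ x ^ (j + 1)) (D γ)‖ := by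
        refine norm_mulOp_le hM.rescale.memLp (hη₀.rescale.pow _).memLp
          (Eventually.of_forall fun x => ?_) _
        simp only [rescale, Complex.norm_real, norm_mul]
        by_cases hx : r⁻¹ • (x - x₀) ∈ tsupport η₀
        · exact mul_le_mul_of_nonneg_right ((hC _ hx).trans (le_max_left _ _)) (norm_nonneg _)
        · simp [image_eq_zero_of_notMem_tsupport hx]
      have h1 : ‖mulReal (fun x => rescale r x₀ η₀ x ^ (j + 1)) (D γ)‖ ≤
          wsum (rescale r x₀ η₀) D j := norm_le_wsum _ D hj.symm
      have h2 : r ^ j * wsum (rescale r x₀ η₀) D j ≤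
          ∑ j ∈ Finset.range m, r ^ j * wsum (rescale r x₀ η₀) D j :=
        Finset.single_le_sum (f := fun j => r ^ j * wsum (rescale r x₀ η₀) D j)
          (fun _ _ => mul_nonneg (by positivity) (wsum_nonneg _ _ _))
          (Finset.mem_range.2 (by omega))
      have h3 : r⁻¹ ^ m = r⁻¹ ^ (s + 1) * r⁻¹ ^ j := by
        rw [← pow_add]; congr 1; omega
      rw [norm_smul, Complex.norm_real, Real.norm_of_nonneg (by positivity)]
      calc _ ≤ r⁻¹ ^ (s + 1) * (max C 0 * wsum (rescale r x₀ η₀) D j) := by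
            gcongr
            exact hbd.trans (mul_le_mul_of_nonneg_left h1 (le_max_right _ _))
        _ = max C 0 * (r⁻¹ ^ m * (r ^ j * wsum (rescale r x₀ η₀) D j)) := by
            have h4 : r⁻¹ ^ j * r ^ j = 1 := by rw [← mul_pow, inv_mul_cancel₀ hr.ne', one_pow]
            rw [h3]
            linear_combination (-r⁻¹ ^ (s + 1) * max C 0 * wsum (rescale r x₀ η₀) D j) * h4
        _ ≤ _ := by gcongr

end Leibniz

/-! ### Sobolev functions as jets, and the elliptic form -/

section Form

variable {n m : ℕ}

lemma isWeakDeriv_weakDeriv {γ : Fin n → ℕ} {f g : EuclideanSpace ℝ (Fin n) → ℂ}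
    (h : IsWeakDeriv γ f g) : IsWeakDeriv γ f (weakDeriv γ f) := by
  have h' : ∃ g, IsWeakDeriv γ f g := ⟨g, h⟩
  rw [weakDeriv, dif_pos h']
  exact h'.choose_spec

/-- The jet `D` consists of the weak derivatives up to order `m` of `f`. -/
structure IsJetOf (m : ℕ) (f : EuclideanSpace ℝ (Fin n) → ℂ) (D : (Fin n → ℕ) → L2Space n) :
    Prop where
  isJet : IsJet m D
  ae_eq : f =ᵐ[volume] D 0

namespace IsJetOf

variable {f : EuclideanSpace ℝ (Fin n) → ℂ} {D : (Fin n → ℕ) → L2Space n}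

lemma isWeakDeriv (h : IsJetOf m f D) {γ : Fin n → ℕ} (hγ : ∑ i, γ i ≤ m) :
    IsWeakDeriv γ f (D γ) :=
  (h.isJet.isWeakDeriv _ γ rfl hγ).congr h.ae_eq.symm .rfl

lemma weakDeriv_ae_eq (h : IsJetOf m f D) {γ : Fin n → ℕ} (hγ : ∑ i, γ i ≤ m) :
    weakDeriv γ f =ᵐ[volume] D γ :=
  (isWeakDeriv_weakDeriv (h.isWeakDeriv hγ)).ae_eq (h.isWeakDeriv hγ)

lemma memSobolev (h : IsJetOf m f D) : MemSobolev m f := by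
  refine ⟨(memLp_congr_ae h.ae_eq).2 (Lp.memLp _), fun k hk α hα => ?_⟩
  rw [mem_multiIndices] at hα
  exact ⟨D α, h.isWeakDeriv (by omega), Lp.memLp _⟩

end IsJetOf

lemma IsJet.isJetOf {D : (Fin n → ℕ) → L2Space n} (h : IsJet m D) : IsJetOf m (D 0) D :=
  ⟨h, .rfl⟩

lemma MemSobolev.memHomSobolev {f : EuclideanSpace ℝ (Fin n) → ℂ} (h : MemSobolev m f) :
    MemHomSobolev m f :=
  ⟨h.1.locallyIntegrable (by norm_num), h.2 m le_rfl⟩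

lemma MemSobolev.exists_jet {f : EuclideanSpace ℝ (Fin n) → ℂ} (h : MemSobolev m f) :
    ∃ D, IsJetOf m f D := by
  have h1 : ∀ γ : Fin n → ℕ, ∑ i, γ i ≤ m → ∃ g : L2Space n, IsWeakDeriv γ f g := by
    intro γ hγ
    obtain ⟨g, hg, hg2⟩ := h.2 _ hγ γ (mem_multiIndices.2 rfl)
    exact ⟨hg2.toLp g, hg.congr .rfl hg2.coeFn_toLp.symm⟩
  choose! D hD using h1
  have h0 : f =ᵐ[volume] D 0 := by
    have e1 : IsWeakDeriv 0 f f :=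
      (isWeakDeriv_zero (h.1.toLp f)).congr h.1.coeFn_toLp h.1.coeFn_toLp
    exact e1.ae_eq (hD 0 (by simp))
  refine ⟨D, ⟨fun γ i hγ => ?_, h0⟩⟩
  have e1 := (hD γ hγ.le).congr h0 .rfl
  have e2 := (hD (γ + Pi.single i 1) (by rw [sum_add_single]; omega)).congr h0 .rfl
  exact e1.add_single_iff.1 e2

lemma IsJet.test {φ : EuclideanSpace ℝ (Fin n) → ℝ} (hφ : ContDiff ℝ ∞ φ)
    (hφ' : HasCompactSupport φ) : IsJet m fun γ => testL2 (iteratedPartial γ φ) := by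
  intro γ i _
  have : iteratedPartial (γ + Pi.single i 1) φ = partialDeriv i (iteratedPartial γ φ) := by
    rw [iteratedPartial_add_single γ hφ]
    exact (partialDeriv_foldr γ _ hφ i).symm
  simp only [this]
  exact hasPartial_testL2 (hφ.iteratedPartial γ) (hφ'.iteratedPartial γ) i

variable {a : (Fin n → ℕ) → (Fin n → ℕ) → EuclideanSpace ℝ (Fin n) → ℂ}

/-- The elliptic form, on jets. -/
noncomputable def jetForm (m : ℕ) (a : (Fin n → ℕ) → (Fin n → ℕ) → EuclideanSpace ℝ (Fin n) → ℂ)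
    (D D' : (Fin n → ℕ) → L2Space n) : ℂ :=
  ∑ α ∈ multiIndices n m, ∑ β ∈ multiIndices n m, inner ℂ (D' α) (mulOp (a α β) (D β))

/-- The square of the `L²` norm of the derivatives of order `m`, on jets. -/
noncomputable def topSq (m : ℕ) (D : (Fin n → ℕ) → L2Space n) : ℝ :=
  ∑ α ∈ multiIndices n m, ‖D α‖ ^ 2

lemma topSq_nonneg (D : (Fin n → ℕ) → L2Space n) : 0 ≤ topSq m D :=
  Finset.sum_nonneg fun _ _ => sq_nonneg _

lemma ellipticForm_eq_jetForm
    (ha : ∀ α ∈ multiIndices n m, ∀ β ∈ multiIndices n m, MemLp (a α β) ∞ volume)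
    {f g : EuclideanSpace ℝ (Fin n) → ℂ} {D D' : (Fin n → ℕ) → L2Space n} (hD : IsJetOf m f D)
    (hD' : IsJetOf m g D') : ellipticForm m a f g = jetForm m a D D' := by
  refine Finset.sum_congr rfl fun α hα => Finset.sum_congr rfl fun β hβ => ?_
  rw [inner_mulOp (ha α hα β hβ)]
  refine integral_congr_ae ?_
  filter_upwards [hD.weakDeriv_ae_eq (mem_multiIndices.1 hβ).le,
    hD'.weakDeriv_ae_eq (mem_multiIndices.1 hα).le] with x h1 h2
  rw [h1, h2]

lemma integral_norm_sq (u : L2Space n) : ∫ x, ‖u x‖ ^ 2 = ‖u‖ ^ 2 := by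
  have h := L2.inner_def (𝕜 := ℂ) u u
  rw [inner_self_eq_norm_sq_to_K] at h
  have h1 : ∀ x, inner ℂ (u x) (u x) = ((‖u x‖ ^ 2 : ℝ) : ℂ) := fun x => by
    rw [inner_self_eq_norm_sq_to_K]; simp
  simp only [h1] at h
  rw [integral_complex_ofReal] at h
  have h2 : ((‖u‖ ^ 2 : ℝ) : ℂ) = ((∫ x, ‖u x‖ ^ 2 : ℝ) : ℂ) := by rw [← h]; simp
  exact (Complex.ofReal_injective h2).symm

lemma gradNorm_eq {f : EuclideanSpace ℝ (Fin n) → ℂ} {D : (Fin n → ℕ) → L2Space n}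
    (hD : IsJetOf m f D) : gradNorm m f = Real.sqrt (topSq m D) := by
  rw [gradNorm, topSq]
  congr 1
  refine Finset.sum_congr rfl fun α hα => ?_
  rw [← integral_norm_sq]
  refine integral_congr_ae ?_
  filter_upwards [hD.weakDeriv_ae_eq (mem_multiIndices.1 hα).le] with x h1
  rw [h1]

/-- Gårding's inequality on jets. -/
lemma EllipticityCondition.exists_coercive (hE : EllipticityCondition m a)
    (ha : ∀ α ∈ multiIndices n m, ∀ β ∈ multiIndices n m, MemLp (a α β) ∞ volume) :
    ∃ lam : ℝ, 0 < lam ∧ ∀ D, IsJet m D → lam * topSq m D ≤ (jetForm m a D D).re := by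
  obtain ⟨lam, Lam, hlam, -, -, h⟩ := hE
  refine ⟨lam, hlam, fun D hD => ?_⟩
  have := h (D 0) hD.isJetOf.memSobolev.memHomSobolev
  rwa [ellipticForm_eq_jetForm ha hD.isJetOf hD.isJetOf, gradNorm_eq hD.isJetOf,
    Real.sq_sqrt (topSq_nonneg D)] at this

lemma mem_ellipticOperatorGraph
    (ha : ∀ α ∈ multiIndices n m, ∀ β ∈ multiIndices n m, MemLp (a α β) ∞ volume)
    {u v : L2Space n} : (u, v) ∈ ellipticOperatorGraph m a ↔
      ∃ D, IsJet m D ∧ D 0 = u ∧ ∀ D', IsJet m D' → jetForm m a D D' = inner ℂ (D' 0) v := by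
  have hin : ∀ w : L2Space n, inner ℂ w v = ∫ x, v x * conj (w x) := fun w => by
    rw [L2.inner_def]; rfl
  constructor
  · rintro ⟨hu, h⟩
    obtain ⟨D, hD⟩ := MemSobolev.exists_jet hu
    refine ⟨D, hD.isJet, (Lp.ext hD.ae_eq).symm, fun D' hD' => ?_⟩
    rw [← ellipticForm_eq_jetForm ha hD hD'.isJetOf, h _ hD'.isJetOf.memSobolev, hin]
  · rintro ⟨D, hD, rfl, h⟩
    refine ⟨hD.isJetOf.memSobolev, fun φ hφ => ?_⟩
    obtain ⟨D', hD'⟩ := hφ.exists_jet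
    rw [ellipticForm_eq_jetForm ha hD.isJetOf hD', h D' hD'.isJet, hin]
    refine integral_congr_ae ?_
    filter_upwards [hD'.ae_eq] with x hx
    rw [hx]

lemma IsJet.add {D D' : (Fin n → ℕ) → L2Space n} (h : IsJet m D) (h' : IsJet m D') :
    IsJet m (D + D') := fun γ i hγ => (h γ i hγ).add (h' γ i hγ)

lemma IsJet.smul {D : (Fin n → ℕ) → L2Space n} (c : ℂ) (h : IsJet m D) :
    IsJet m (c • D) := fun γ i hγ => (h γ i hγ).smul c

lemma IsJet.zero : IsJet m (0 : (Fin n → ℕ) → L2Space n) := fun _ i _ => .zero i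

lemma jetForm_add_left (D₁ D₂ D' : (Fin n → ℕ) → L2Space n) :
    jetForm m a (D₁ + D₂) D' = jetForm m a D₁ D' + jetForm m a D₂ D' := by
  simp [jetForm, inner_add_right, Finset.sum_add_distrib]

lemma jetForm_smul_left (c : ℂ) (D D' : (Fin n → ℕ) → L2Space n) :
    jetForm m a (c • D) D' = c * jetForm m a D D' := by
  simp [jetForm, inner_smul_right, Finset.mul_sum]

/-- The graph of the elliptic operator, as a submodule. -/
noncomputable def ellipticGraph (m : ℕ)
    (a : (Fin n → ℕ) → (Fin n → ℕ) → EuclideanSpace ℝ (Fin n) → ℂ)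
    (ha : ∀ α ∈ multiIndices n m, ∀ β ∈ multiIndices n m, MemLp (a α β) ∞ volume) :
    Submodule ℂ (L2Space n × L2Space n) where
  carrier := ellipticOperatorGraph m a
  add_mem' := by
    rintro ⟨u, v⟩ ⟨u', v'⟩ h h'
    rw [Prod.mk_add_mk]
    rw [mem_ellipticOperatorGraph ha] at h h' ⊢
    obtain ⟨D, hD, rfl, hv⟩ := h
    obtain ⟨D', hD', rfl, hv'⟩ := h'
    exact ⟨D + D', hD.add hD', rfl, fun E hE => by
      rw [jetForm_add_left, hv E hE, hv' E hE, inner_add_right]⟩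
  zero_mem' := by
    rw [← Prod.mk_zero_zero, mem_ellipticOperatorGraph ha]
    exact ⟨0, .zero, rfl, fun E _ => by simp [jetForm]⟩
  smul_mem' := by
    rintro c ⟨u, v⟩ h
    rw [Prod.smul_mk]
    rw [mem_ellipticOperatorGraph ha] at h ⊢
    obtain ⟨D, hD, rfl, hv⟩ := h
    exact ⟨c • D, hD.smul c, rfl, fun E hE => by
      rw [jetForm_smul_left, hv E hE, inner_smul_right]⟩

/-! ### The Sobolev space `W^{m,2}` as a Hilbert space, and the resolvent equation -/

/-- The multi-indices of order at most `m`. -/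
def lowIndices (n m : ℕ) : Finset (Fin n → ℕ) :=
  (Finset.range (m + 1)).biUnion (multiIndices n)

lemma mem_lowIndices {γ : Fin n → ℕ} : γ ∈ lowIndices n m ↔ ∑ i, γ i ≤ m := by
  simp [lowIndices, mem_multiIndices]

open Classical in
/-- The extension by zero of a finite family of elements of `L²` to all multi-indices. -/
noncomputable def extendJet (w : PiLp 2 fun _ : lowIndices n m => L2Space n) (γ : Fin n → ℕ) :
    L2Space n := if h : γ ∈ lowIndices n m then w ⟨γ, h⟩ else 0

lemma extendJet_add (v w : PiLp 2 fun _ : lowIndices n m => L2Space n) :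
    extendJet (v + w) = extendJet v + extendJet w := by
  ext1 γ
  by_cases h : γ ∈ lowIndices n m <;> simp [extendJet, h]

lemma extendJet_smul (c : ℂ) (w : PiLp 2 fun _ : lowIndices n m => L2Space n) :
    extendJet (c • w) = c • extendJet w := by
  ext1 γ
  by_cases h : γ ∈ lowIndices n m <;> simp [extendJet, h]

lemma continuous_extendJet (γ : Fin n → ℕ) :
    Continuous fun w : PiLp 2 fun _ : lowIndices n m => L2Space n => extendJet w γ := by
  by_cases h : γ ∈ lowIndices n m
  · simp only [extendJet, h, dif_pos]; fun_prop
  · simp only [extendJet, h]; exact continuous_const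

/-- The Sobolev space `W^{m,2}(ℝⁿ)`, realized as the space of jets. -/
noncomputable def jetSpace (n m : ℕ) :
    Submodule ℂ (PiLp 2 fun _ : lowIndices n m => L2Space n) where
  carrier := {w | IsJet m (extendJet w)}
  add_mem' {v w} hv hw := by
    rw [Set.mem_ofPred_eq, extendJet_add]; exact hv.add hw
  zero_mem' := by
    rw [Set.mem_ofPred_eq, show extendJet (0 : PiLp 2 fun _ : lowIndices n m => L2Space n) = 0 by
      ext1 γ; by_cases h : γ ∈ lowIndices n m <;> simp [extendJet, h]]
    exact .zero
  smul_mem' c w hw := by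
    rw [Set.mem_ofPred_eq, extendJet_smul]; exact hw.smul c

lemma isClosed_jetSpace :
    IsClosed (jetSpace n m : Set (PiLp 2 fun _ : lowIndices n m => L2Space n)) := by
  have : (jetSpace n m : Set (PiLp 2 fun _ : lowIndices n m => L2Space n)) =
      ⋂ (γ : Fin n → ℕ) (i : Fin n) (_ : ∑ j, γ j < m) (φ : EuclideanSpace ℝ (Fin n) → ℝ)
        (_ : ContDiff ℝ ∞ φ) (_ : HasCompactSupport φ),
        {w | inner ℂ (testL2 (partialDeriv i φ)) (extendJet w γ) =
          - inner ℂ (testL2 φ) (extendJet w (γ + Pi.single i 1))} := by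
    ext w
    simp only [Set.mem_iInter]
    rfl
  rw [this]
  refine isClosed_iInter fun γ => isClosed_iInter fun i => isClosed_iInter fun _ =>
    isClosed_iInter fun φ => isClosed_iInter fun _ => isClosed_iInter fun _ => isClosed_eq ?_ ?_
  · exact continuous_const.inner (continuous_extendJet _)
  · exact (continuous_const.inner (continuous_extendJet _)).neg

noncomputable instance : CompleteSpace (jetSpace n m) := isClosed_jetSpace.completeSpace_coe

/-- The derivative `∂^γ` as a bounded operator from `W^{m,2}` to `L²`. -/
noncomputable def jetProj (n m : ℕ) (γ : Fin n → ℕ) : jetSpace n m →L[ℂ] L2Space n where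
  toFun w := extendJet w.1 γ
  map_add' v w := by rw [Submodule.coe_add, extendJet_add]; rfl
  map_smul' c w := by rw [Submodule.coe_smul, extendJet_smul]; rfl
  cont := (continuous_extendJet γ).comp continuous_subtype_val

lemma isJet_jetProj (w : jetSpace n m) : IsJet m fun γ => jetProj n m γ w := w.2

lemma IsJet.exists_jetProj_eq {D : (Fin n → ℕ) → L2Space n} (hD : IsJet m D) :
    ∃ w : jetSpace n m, ∀ γ, ∑ i, γ i ≤ m → jetProj n m γ w = D γ := by
  let w : PiLp 2 fun _ : lowIndices n m => L2Space n := WithLp.toLp 2 fun γ => D γ.1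
  have hw : ∀ γ, ∑ i, γ i ≤ m → extendJet w γ = D γ := fun γ hγ => by
    simp [extendJet, mem_lowIndices, hγ, w]
  refine ⟨⟨w, fun γ i hγ => ?_⟩, hw⟩
  rw [hw γ hγ.le, hw _ (by rw [sum_add_single]; omega)]
  exact hD γ i hγ

/-- The norm of `W^{m,2}` is controlled by the function and its derivatives of order `m`, by
interpolation. -/
lemma exists_norm_sq_le (n m : ℕ) : ∃ C : ℝ, 0 < C ∧ ∀ w : jetSpace n m,
    ‖w‖ ^ 2 ≤ C * (topSq m (fun γ => jetProj n m γ w) + ‖jetProj n m 0 w‖ ^ 2) := by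
  obtain ⟨B, hB, h⟩ := exists_sum_wsum_le n m le_rfl one_pos
  set c : ℝ := ((multiIndices n m).card : ℝ)
  refine ⟨8 * c + 2 * B ^ 2 + 1, by positivity, fun w => ?_⟩
  set D : (Fin n → ℕ) → L2Space n := fun γ => jetProj n m γ w
  have h1 := h (fun _ => 1) 1 D (.const 1) one_pos (by simp [partialDeriv]) (isJet_jetProj w)
  have hw : ∀ k, wsum (fun _ => 1) D k = ∑ γ ∈ multiIndices n k, ‖D γ‖ := fun k => by
    simp only [wsum, one_pow]
    simp only [mulReal_one]
  have h0 : wsum (fun _ => 1) D 0 = ‖D 0‖ := by rw [wsum_zero, mulReal_one]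
  simp only [one_pow, one_mul] at h1
  rw [h0] at h1
  have h2 : ‖w‖ ^ 2 = ∑ γ ∈ lowIndices n m, ‖D γ‖ ^ 2 := by
    rw [show ‖w‖ = ‖w.1‖ from rfl, PiLp.norm_sq_eq_of_L2, ← Finset.sum_coe_sort (lowIndices n m)]
    refine Finset.sum_congr rfl fun γ _ => ?_
    have : D γ.1 = w.1 γ := by
      change extendJet w.1 γ.1 = _
      rw [extendJet, dif_pos γ.2]
    rw [this]
  have h3 : ∑ γ ∈ lowIndices n m, ‖D γ‖ = ∑ k ∈ Finset.range (m + 1), wsum (fun _ => 1) D k := by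
    rw [lowIndices, Finset.sum_biUnion]
    · exact Finset.sum_congr rfl fun k _ => (hw k).symm
    · intro k _ l _ hkl
      refine Finset.disjoint_left.2 fun γ hk hl => hkl ?_
      rw [← mem_multiIndices.1 hk, ← mem_multiIndices.1 hl]
  have h4 : ‖w‖ ^ 2 ≤ (∑ γ ∈ lowIndices n m, ‖D γ‖) ^ 2 := by
    rw [h2]; exact Finset.sum_sq_le_sq_sum_of_nonneg fun _ _ => norm_nonneg _
  have h5 : wsum (fun _ => 1) D m ^ 2 ≤ c * topSq m D := by
    rw [hw]; exact sq_sum_le_card_mul_sum_sq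
  rw [h3, Finset.sum_range_succ] at h4
  have h6 := wsum_nonneg (fun _ => 1) D m
  have h7 : 0 ≤ ∑ k ∈ Finset.range m, wsum (fun _ => 1) D k :=
    Finset.sum_nonneg fun k _ => wsum_nonneg _ _ _
  have h8 := topSq_nonneg (m := m) D
  change ‖w‖ ^ 2 ≤ _ * (topSq m D + ‖D 0‖ ^ 2)
  refine h4.trans ((pow_le_pow_left₀ (add_nonneg h7 h6)
    (show _ ≤ 2 * wsum (fun _ => 1) D m + B * ‖D 0‖ by linarith) 2).trans ?_)
  have e1 : 0 ≤ c * ‖D 0‖ ^ 2 := mul_nonneg (Nat.cast_nonneg _) (sq_nonneg _)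
  have e2 : 0 ≤ B ^ 2 * topSq m D := mul_nonneg (sq_nonneg _) h8
  have e3 := sq_nonneg ‖D 0‖
  have e4 := sq_nonneg (2 * wsum (fun _ => 1) D m - B * ‖D 0‖)
  linarith

/-- The Lax–Milgram lemma: a bounded operator with coercive real part is onto. -/
lemma surjective_of_coercive {V : Type*} [NormedAddCommGroup V] [InnerProductSpace ℂ V]
    [CompleteSpace V] (A : V →L[ℂ] V) {c : ℝ} (hc : 0 < c)
    (h : ∀ v, c * ‖v‖ ^ 2 ≤ (inner ℂ v (A v)).re) : Function.Surjective A := by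
  have hbd : ∀ v, ‖v‖ ≤ c⁻¹ * ‖A v‖ := fun v => by
    rw [le_inv_mul_iff₀ hc]
    by_cases hv : v = 0
    · simp [hv]
    have h1 : c * ‖v‖ ^ 2 ≤ ‖v‖ * ‖A v‖ :=
      (h v).trans ((Complex.re_le_norm _).trans (norm_inner_le_norm _ _))
    have h2 : 0 < ‖v‖ := norm_pos_iff.2 hv
    exact le_of_mul_le_mul_left (by linarith [show ‖v‖ * (c * ‖v‖) = c * ‖v‖ ^ 2 by ring]) h2
  have hanti : AntilipschitzWith (Real.toNNReal c⁻¹) A :=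
    A.antilipschitz_of_bound fun v => by
      rw [Real.coe_toNNReal _ (by positivity)]; exact hbd v
  have hcl : IsClosed (A.range : Set V) := hanti.isClosed_range A.uniformContinuous
  have : CompleteSpace A.range := hcl.completeSpace_coe
  have htop : A.range = ⊤ := by
    rw [← A.range.orthogonal_orthogonal, Submodule.eq_top_iff']
    intro v w hw
    have h1 : inner ℂ (A w) w = 0 := hw _ ⟨w, rfl⟩
    have h2 := h w
    rw [← inner_conj_symm, h1, map_zero, Complex.zero_re] at h2
    have h3 : ‖w‖ ^ 2 = 0 := le_antisymm (by nlinarith [sq_nonneg ‖w‖]) (sq_nonneg _)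
    rw [show w = 0 by simpa using h3, inner_zero_left]
  exact LinearMap.range_eq_top.1 htop

/-- The operator on `W^{m,2}` representing the form `𝔞₀(u, v) + k (u, v)`. -/
noncomputable def formOp (m : ℕ) (a : (Fin n → ℕ) → (Fin n → ℕ) → EuclideanSpace ℝ (Fin n) → ℂ)
    (k : ℝ) : jetSpace n m →L[ℂ] jetSpace n m :=
  (∑ α ∈ multiIndices n m, ∑ β ∈ multiIndices n m,
    (ContinuousLinearMap.adjoint (jetProj n m α)).comp ((mulOp (a α β)).comp (jetProj n m β))) +
    (ContinuousLinearMap.adjoint (jetProj n m 0)).comp ((k : ℂ) • jetProj n m 0)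

lemma inner_formOp (k : ℝ) (z w : jetSpace n m) :
    inner ℂ z (formOp m a k w) =
      jetForm m a (fun γ => jetProj n m γ w) (fun γ => jetProj n m γ z) +
        k * inner ℂ (jetProj n m 0 z) (jetProj n m 0 w) := by
  simp only [formOp, jetForm, add_apply, sum_apply, smul_apply, ContinuousLinearMap.comp_apply,
    inner_add_right, inner_sum, inner_smul_right, ContinuousLinearMap.adjoint_inner_right]

lemma jetForm_congr {D D' E E' : (Fin n → ℕ) → L2Space n}
    (h : ∀ γ, ∑ i, γ i ≤ m → D γ = E γ) (h' : ∀ γ, ∑ i, γ i ≤ m → D' γ = E' γ) :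
    jetForm m a D D' = jetForm m a E E' :=
  Finset.sum_congr rfl fun α hα => Finset.sum_congr rfl fun β hβ => by
    rw [h β (mem_multiIndices.1 hβ).le, h' α (mem_multiIndices.1 hα).le]

/-- The elliptic operator is m-accretive. -/
theorem isMAccretive_ellipticGraph
    (ha : ∀ α ∈ multiIndices n m, ∀ β ∈ multiIndices n m, MemLp (a α β) ∞ volume)
    (hE : EllipticityCondition m a) : IsMAccretive (ellipticGraph m a ha) := by
  obtain ⟨lam, hlam, hco⟩ := hE.exists_coercive ha
  refine ⟨fun v hv => ?_, fun u v huv => ?_, fun k hk f => ?_⟩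
  · obtain ⟨D, hD, hD0, h⟩ := (mem_ellipticOperatorGraph ha).1 hv
    have hz : ∀ γ, ∑ i, γ i ≤ m → D γ = 0 := fun γ hγ => by
      have h1 := hD.isWeakDeriv _ γ rfl hγ
      have h2 := (IsJet.zero (n := n) (m := m)).isWeakDeriv _ γ rfl hγ
      rw [hD0] at h1
      exact Lp.ext (h1.ae_eq h2)
    refine eq_of_inner_testL2 fun φ hφ hφ' => ?_
    have h1 := h _ (.test hφ hφ')
    rw [jetForm_congr (E := 0) (fun γ hγ => hz γ hγ) (fun γ _ => rfl)] at h1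
    simp only [iteratedPartial_zero] at h1
    rw [← h1, inner_zero_right]
    simp [jetForm]
  · obtain ⟨D, hD, rfl, h⟩ := (mem_ellipticOperatorGraph ha).1 huv
    rw [← h D hD]
    exact (mul_nonneg hlam.le (topSq_nonneg D)).trans (hco D hD)
  · obtain ⟨C, hC, hnorm⟩ := exists_norm_sq_le n m
    have hsurj : Function.Surjective (formOp (n := n) m a k) := by
      refine surjective_of_coercive _ (c := min lam k / C) (by positivity) fun w => ?_
      have h1 := hco _ (isJet_jetProj w)
      have h2 := hnorm w
      rw [inner_formOp, Complex.add_re, Complex.re_ofReal_mul, inner_self_eq_norm_sq_to_K]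
      simp only [Complex.coe_algebraMap, ← Complex.ofReal_pow, Complex.ofReal_re]
      set t := topSq m fun γ => jetProj n m γ w
      have ht : 0 ≤ t := topSq_nonneg _
      calc min lam k / C * ‖w‖ ^ 2 ≤ min lam k / C * (C * (t + ‖jetProj n m 0 w‖ ^ 2)) := by gcongr
        _ = min lam k * t + min lam k * ‖jetProj n m 0 w‖ ^ 2 := by field_simp
        _ ≤ lam * t + k * ‖jetProj n m 0 w‖ ^ 2 := by
            gcongr
            · exact min_le_left _ _
            · exact min_le_right _ _
        _ ≤ _ := by gcongr
    obtain ⟨w, hw⟩ := hsurj (ContinuousLinearMap.adjoint (jetProj n m 0) f)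
    refine ⟨jetProj n m 0 w, f - (k : ℂ) • jetProj n m 0 w, ?_, by
      rw [← Complex.coe_smul]; abel⟩
    refine (mem_ellipticOperatorGraph ha).2 ⟨_, isJet_jetProj w, rfl, fun D' hD' => ?_⟩
    obtain ⟨z, hz⟩ := hD'.exists_jetProj_eq
    have h1 := inner_formOp (a := a) k z w
    rw [hw, ContinuousLinearMap.adjoint_inner_right, hz 0 (by simp),
      jetForm_congr (fun γ _ => rfl) hz] at h1
    rw [inner_sub_right, inner_smul_right, h1]
    ring

end Form

/-! ### The spatial Caccioppoli estimate -/

section Caccioppoli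

variable {n m : ℕ}

lemma isJet_of_isWeakDeriv {u : L2Space n} {D : (Fin n → ℕ) → L2Space n}
    (h : ∀ γ, ∑ i, γ i ≤ m → IsWeakDeriv γ u (D γ)) : IsJet m D ∧ D 0 = u := by
  have h0 : D 0 = u := Lp.ext ((h 0 (by simp)).ae_eq (isWeakDeriv_zero u))
  exact ⟨fun γ i hγ => (h γ hγ.le).add_single_iff.1 (h _ (by rw [sum_add_single]; omega)), h0⟩

/-- The jet of the cut-off function `η^{q+m+1} u`: its derivatives of order `m` are
`η^{q+m+1} ∂^α u + η^q R_α` with a remainder `R_α` controlled by derivatives of lower order. -/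
lemma exists_cutoff_jet {η₀ : EuclideanSpace ℝ (Fin n) → ℝ} (hη : ContDiff ℝ ∞ η₀)
    (hη' : HasCompactSupport η₀) (q m : ℕ) :
    ∃ C : ℝ, 0 ≤ C ∧ ∀ (r : ℝ) (x₀ : EuclideanSpace ℝ (Fin n)) (D : (Fin n → ℕ) → L2Space n),
      0 < r → IsJet m D → ∃ V R : (Fin n → ℕ) → L2Space n, IsJet m V ∧
        V 0 = mulReal (rescale r x₀ fun y => η₀ y ^ (q + m + 1)) (D 0) ∧
        ∀ α ∈ multiIndices n m,
          V α = mulReal (rescale r x₀ fun y => η₀ y ^ (q + m + 1)) (D α) +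
            mulReal (rescale r x₀ fun y => η₀ y ^ q) (R α) ∧
          ‖R α‖ ≤ C * (r⁻¹ ^ m * ∑ j ∈ Finset.range m, r ^ j * wsum (rescale r x₀ η₀) D j) := by
  choose! F hF hFD using fun (α : Fin n → ℕ) (hα : ∑ i, α i ≤ m) =>
    exists_leibniz hη hη' q m _ α rfl hα
  choose! C F' hC hCF using fun (α : Fin n → ℕ) (hα : ∑ i, α i = m) =>
    (hF α hα.le).exists_bound hη hη' hα
  have hC' : ∀ α ∈ multiIndices n m, 0 ≤ C α := fun α hα => hC α (mem_multiIndices.1 hα)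
  refine ⟨∑ α ∈ multiIndices n m, C α, Finset.sum_nonneg hC', fun r x₀ D hr hD => ?_⟩
  obtain ⟨hV, hV0⟩ := isJet_of_isWeakDeriv (m := m) fun γ hγ => hFD γ hγ r x₀ D hD
  refine ⟨_, fun α => F' α r x₀ D, hV, hV0, fun α hα => ?_⟩
  have h1 := hCF α (mem_multiIndices.1 hα) r x₀ D hr
  refine ⟨by rw [← h1.1], h1.2.trans (mul_le_mul_of_nonneg_right
    (Finset.single_le_sum hC' hα) ?_)⟩
  exact mul_nonneg (by positivity)
    (Finset.sum_nonneg fun j _ => mul_nonneg (by positivity) (wsum_nonneg _ _ _))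

variable {a : (Fin n → ℕ) → (Fin n → ℕ) → EuclideanSpace ℝ (Fin n) → ℂ}

lemma exists_coeff_bound (m : ℕ)
    (a : (Fin n → ℕ) → (Fin n → ℕ) → EuclideanSpace ℝ (Fin n) → ℂ) :
    ∃ A : ℝ, 0 ≤ A ∧ ∀ α ∈ multiIndices n m, ∀ β ∈ multiIndices n m, ∀ u : L2Space n,
      ‖mulOp (a α β) u‖ ≤ A * ‖u‖ := by
  refine ⟨∑ α ∈ multiIndices n m, ∑ β ∈ multiIndices n m, ‖mulOp (a α β)‖,
    Finset.sum_nonneg fun _ _ => Finset.sum_nonneg fun _ _ => norm_nonneg _,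
    fun α hα β hβ u => (ContinuousLinearMap.le_opNorm _ _).trans
      (mul_le_mul_of_nonneg_right ?_ (norm_nonneg _))⟩
  exact (Finset.single_le_sum (f := fun β => ‖mulOp (a α β)‖) (fun _ _ => norm_nonneg _) hβ).trans
    (Finset.single_le_sum (f := fun α => ∑ β ∈ multiIndices n m, ‖mulOp (a α β)‖)
      (fun _ _ => Finset.sum_nonneg fun _ _ => norm_nonneg _) hα)

lemma mulOp_mulReal_comm {b : EuclideanSpace ℝ (Fin n) → ℂ} (hb : MemLp b ∞ volume)
    {ψ : EuclideanSpace ℝ (Fin n) → ℝ} (hψ : IsMultiplier ψ) (u : L2Space n) :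
    mulReal ψ (mulOp b u) = mulOp b (mulReal ψ u) := by
  apply Lp.ext
  filter_upwards [coeFn_mulOp hψ.memLp (mulOp b u), coeFn_mulOp hb u,
    coeFn_mulOp hb (mulReal ψ u), coeFn_mulOp hψ.memLp u] with x h1 h2 h3 h4
  rw [mulReal, h1, h2, h3, h4]; ring

/-- The comparison of `𝔞₀(η^N u, η^N u)` with `𝔞₀(u, η^{2N} u)`: the terms of highest order agree,
and the difference involves at least one remainder. -/
lemma norm_jetForm_sub_le
    (ha : ∀ α ∈ multiIndices n m, ∀ β ∈ multiIndices n m, MemLp (a α β) ∞ volume)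
    {A : ℝ} (hA0 : 0 ≤ A) (hA : ∀ α ∈ multiIndices n m, ∀ β ∈ multiIndices n m, ∀ u : L2Space n,
      ‖mulOp (a α β) u‖ ≤ A * ‖u‖) {ψ : EuclideanSpace ℝ (Fin n) → ℝ} (hψ : IsMultiplier ψ)
    {D V Φ R R' : (Fin n → ℕ) → L2Space n} {s ρ : ℝ} (hs : 0 ≤ s) (hρ : 0 ≤ ρ)
    (hV : ∀ α ∈ multiIndices n m, V α = mulReal ψ (D α) + R α)
    (hΦ : ∀ α ∈ multiIndices n m, Φ α = mulReal ψ (mulReal ψ (D α)) + mulReal ψ (R' α))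
    (hD : ∀ α ∈ multiIndices n m, ‖mulReal ψ (D α)‖ ≤ s)
    (hR : ∀ α ∈ multiIndices n m, ‖R α‖ ≤ ρ) (hR' : ∀ α ∈ multiIndices n m, ‖R' α‖ ≤ ρ) :
    ‖jetForm m a V V - jetForm m a D Φ‖ ≤
      ((multiIndices n m).card : ℝ) ^ 2 * (A * (3 * ρ * s + ρ ^ 2)) := by
  have hterm : ∀ α ∈ multiIndices n m, ∀ β ∈ multiIndices n m,
      ‖inner ℂ (V α) (mulOp (a α β) (V β)) - inner ℂ (Φ α) (mulOp (a α β) (D β))‖ ≤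
        A * (3 * ρ * s + ρ ^ 2) := by
    intro α hα β hβ
    have e : inner ℂ (V α) (mulOp (a α β) (V β)) - inner ℂ (Φ α) (mulOp (a α β) (D β)) =
        inner ℂ (R α - R' α) (mulOp (a α β) (mulReal ψ (D β))) +
          inner ℂ (mulReal ψ (D α) + R α) (mulOp (a α β) (R β)) := by
      rw [hV α hα, hV β hβ, hΦ α hα, ← map_add, inner_mulReal_left hψ.memLp,
        mulOp_mulReal_comm (ha α hα β hβ) hψ, map_add]
      simp only [inner_add_left, inner_add_right, inner_sub_left]
      ring
    rw [e]
    have n1 : ‖R α - R' α‖ ≤ 2 * ρ := (norm_sub_le _ _).trans (by linarith [hR α hα, hR' α hα])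
    have n2 : ‖mulOp (a α β) (mulReal ψ (D β))‖ ≤ A * s :=
      (hA α hα β hβ _).trans (mul_le_mul_of_nonneg_left (hD β hβ) hA0)
    have n3 : ‖mulReal ψ (D α) + R α‖ ≤ s + ρ :=
      (norm_add_le _ _).trans (add_le_add (hD α hα) (hR α hα))
    have n4 : ‖mulOp (a α β) (R β)‖ ≤ A * ρ :=
      (hA α hα β hβ _).trans (mul_le_mul_of_nonneg_left (hR β hβ) hA0)
    calc _ ≤ ‖R α - R' α‖ * ‖mulOp (a α β) (mulReal ψ (D β))‖ +
          ‖mulReal ψ (D α) + R α‖ * ‖mulOp (a α β) (R β)‖ :=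
          (norm_add_le _ _).trans (add_le_add (norm_inner_le_norm _ _) (norm_inner_le_norm _ _))
      _ ≤ 2 * ρ * (A * s) + (s + ρ) * (A * ρ) := by gcongr
      _ = _ := by ring
  simp only [jetForm]
  rw [← Finset.sum_sub_distrib]
  simp only [← Finset.sum_sub_distrib]
  refine (norm_sum_le_of_le _ (fun α hα => norm_sum_le_of_le _ (hterm α hα))).trans ?_
  simp only [Finset.sum_const, nsmul_eq_mul]
  exact le_of_eq (by ring)

/-- Young's inequality, by which the mixed term `ρ S` is absorbed on the left. Here `S` is the
localized gradient, `t` the energy of the cut-off function, and `ρ` bounds the remainders. -/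
lemma absorb_estimate {S E ρ t c lam A : ℝ} (hlam : 0 < lam) (hc : 0 ≤ c)
    (h1 : lam * t ≤ E + c ^ 2 * (A * (3 * ρ * S + ρ ^ 2)))
    (h2 : S ^ 2 ≤ 2 * c * t + 2 * c ^ 2 * ρ ^ 2) :
    S ^ 2 ≤ 4 * c / lam * E +
      (36 * (c ^ 3 * A / lam) ^ 2 + 4 * (c ^ 3 * A / lam) + 4 * c ^ 2) * ρ ^ 2 := by
  have h3 : t ≤ E / lam + c ^ 2 * A / lam * (3 * ρ * S + ρ ^ 2) := by
    have : t ≤ (E + c ^ 2 * (A * (3 * ρ * S + ρ ^ 2))) / lam := by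
      rw [le_div_iff₀ hlam]; linarith
    refine this.trans (le_of_eq ?_)
    field_simp
  set k := c ^ 3 * A / lam with hk
  have h4 : 2 * c * t ≤ 2 * c / lam * E + 2 * k * (3 * ρ * S + ρ ^ 2) := by
    refine (mul_le_mul_of_nonneg_left h3 (by positivity : 0 ≤ 2 * c)).trans (le_of_eq ?_)
    rw [hk]; field_simp
  have h5 : 12 * k * ρ * S ≤ S ^ 2 + 36 * k ^ 2 * ρ ^ 2 := by nlinarith [sq_nonneg (S - 6 * k * ρ)]
  have e : 4 * c / lam * E = 2 * (2 * c / lam * E) := by ring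
  rw [e]
  nlinarith

/-- The spatial Caccioppoli estimate with derivatives of intermediate order on the right. -/
lemma exists_caccioppoli_lower {η₀ : EuclideanSpace ℝ (Fin n) → ℝ} (hη : ContDiff ℝ ∞ η₀)
    (hη' : HasCompactSupport η₀)
    (ha : ∀ α ∈ multiIndices n m, ∀ β ∈ multiIndices n m, MemLp (a α β) ∞ volume)
    (hE : EllipticityCondition m a) :
    ∃ A₁ K : ℝ, 0 ≤ A₁ ∧ 0 ≤ K ∧ ∀ (r : ℝ) (x₀ : EuclideanSpace ℝ (Fin n))
      (D : (Fin n → ℕ) → L2Space n) (v : L2Space n), 0 < r → IsJet m D →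
      (∀ D', IsJet m D' → jetForm m a D D' = inner ℂ (D' 0) v) →
      wsum (rescale r x₀ η₀) D m ^ 2 ≤
        A₁ * (inner ℂ (mulReal (fun x => rescale r x₀ η₀ x ^ (m + 1)) (D 0))
          (mulReal (fun x => rescale r x₀ η₀ x ^ (m + 1)) v)).re +
        K * (r⁻¹ ^ m * ∑ j ∈ Finset.range m, r ^ j * wsum (rescale r x₀ η₀) D j) ^ 2 := by
  obtain ⟨lam, hlam, hco⟩ := hE.exists_coercive ha
  obtain ⟨A, hA0, hA⟩ := exists_coeff_bound m a
  -- `η^{m+1} u` enters Gårding's inequality, and `η^{2(m+1)} u` is the test function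
  obtain ⟨C₁, hC₁, hjet₁⟩ := exists_cutoff_jet hη hη' 0 m
  obtain ⟨C₂, hC₂, hjet₂⟩ := exists_cutoff_jet hη hη' (m + 1) m
  set C := max C₁ C₂
  have hC : 0 ≤ C := hC₁.trans (le_max_left _ _)
  set c : ℝ := ((multiIndices n m).card : ℝ)
  have hc : 0 ≤ c := Nat.cast_nonneg _
  set K := 36 * (c ^ 3 * A / lam) ^ 2 + 4 * (c ^ 3 * A / lam) + 4 * c ^ 2
  have hK : 0 ≤ K := by positivity
  refine ⟨4 * c / lam, K * C ^ 2, by positivity, by positivity, fun r x₀ D v hr hD hv => ?_⟩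
  set η := rescale r x₀ η₀
  obtain ⟨V, R, hV, hV0, hVR⟩ := hjet₁ r x₀ D hr hD
  obtain ⟨Φ, R', hΦ, hΦ0, hΦR⟩ := hjet₂ r x₀ D hr hD
  set ψ : EuclideanSpace ℝ (Fin n) → ℝ := fun x => η x ^ (m + 1) with hψdef
  have hψ : IsMultiplier ψ := (IsMultiplier.of_hasCompactSupport hη hη').rescale.pow _
  have e0 : (rescale r x₀ fun y => η₀ y ^ (0 + m + 1)) = ψ := by
    ext x; simp [ψ, η, rescale]
  have e1 : (rescale r x₀ fun y => η₀ y ^ 0) = fun _ => 1 := by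
    ext x; simp [rescale]
  have e2 : (rescale r x₀ fun y => η₀ y ^ (m + 1 + m + 1)) = fun x => ψ x * ψ x := by
    ext x; simp only [ψ, η, rescale]; ring
  have e3 : (rescale r x₀ fun y => η₀ y ^ (m + 1)) = ψ := rfl
  simp only [e0, e1, mulReal_one] at hV0 hVR
  simp only [e2, e3, ← hψ.mulReal_mulReal hψ] at hΦ0 hΦR
  set S := wsum η D m with hS
  have hS0 : 0 ≤ S := wsum_nonneg _ _ _
  set Y := r⁻¹ ^ m * ∑ j ∈ Finset.range m, r ^ j * wsum η D j
  have hY0 : 0 ≤ Y := mul_nonneg (by positivity)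
    (Finset.sum_nonneg fun j _ => mul_nonneg (by positivity) (wsum_nonneg _ _ _))
  have hρ0 : 0 ≤ C * Y := mul_nonneg hC hY0
  have hRρ : ∀ α ∈ multiIndices n m, ‖R α‖ ≤ C * Y := fun α hα =>
    (hVR α hα).2.trans (mul_le_mul_of_nonneg_right (le_max_left _ _) hY0)
  have hRρ' : ∀ α ∈ multiIndices n m, ‖R' α‖ ≤ C * Y := fun α hα =>
    (hΦR α hα).2.trans (mul_le_mul_of_nonneg_right (le_max_right _ _) hY0)
  have hdiff := norm_jetForm_sub_le ha hA0 hA hψ hS0 hρ0 (fun α hα => (hVR α hα).1)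
    (fun α hα => (hΦR α hα).1) (fun α hα => norm_le_wsum η D (mem_multiIndices.1 hα)) hRρ hRρ'
  set E := (inner ℂ (mulReal ψ (D 0)) (mulReal ψ v)).re
  have hE' : (jetForm m a D Φ).re = E := by
    rw [hv Φ hΦ, hΦ0, inner_mulReal_left hψ.memLp]
  have k1 : lam * topSq m V ≤ E + c ^ 2 * (A * (3 * (C * Y) * S + (C * Y) ^ 2)) := by
    have := (Complex.re_le_norm _).trans hdiff
    rw [Complex.sub_re, hE'] at this
    linarith [hco V hV]
  have k2 : S ^ 2 ≤ 2 * c * topSq m V + 2 * c ^ 2 * (C * Y) ^ 2 := by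
    have f1 : S ≤ ∑ α ∈ multiIndices n m, ‖V α‖ + c * (C * Y) := by
      calc S = ∑ α ∈ multiIndices n m, ‖mulReal ψ (D α)‖ := rfl
        _ ≤ ∑ α ∈ multiIndices n m, (‖V α‖ + C * Y) := by
            refine Finset.sum_le_sum fun α hα => ?_
            have : mulReal ψ (D α) = V α - R α := by rw [(hVR α hα).1]; abel
            rw [this]
            exact (norm_sub_le _ _).trans (add_le_add_right (hRρ α hα) _)
        _ = _ := by rw [Finset.sum_add_distrib, Finset.sum_const, nsmul_eq_mul]
    have f2 : (∑ α ∈ multiIndices n m, ‖V α‖) ^ 2 ≤ c * topSq m V := sq_sum_le_card_mul_sum_sq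
    have f3 := pow_le_pow_left₀ hS0 f1 2
    have f4 := sq_nonneg (∑ α ∈ multiIndices n m, ‖V α‖ - c * (C * Y))
    linarith
  exact (absorb_estimate hlam hc k1 k2).trans (le_of_eq (by rw [mul_pow, mul_assoc]))

/-- The spatial Caccioppoli estimate for `u` in the domain of `L` with `L u = v`. -/
theorem exists_spatial_caccioppoli {η₀ : EuclideanSpace ℝ (Fin n) → ℝ} (hη : ContDiff ℝ ∞ η₀)
    (hη' : HasCompactSupport η₀)
    (ha : ∀ α ∈ multiIndices n m, ∀ β ∈ multiIndices n m, MemLp (a α β) ∞ volume)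
    (hE : EllipticityCondition m a) :
    ∃ A₁ A₂ : ℝ, 0 ≤ A₁ ∧ 0 ≤ A₂ ∧ ∀ (r : ℝ) (x₀ : EuclideanSpace ℝ (Fin n))
      (D : (Fin n → ℕ) → L2Space n) (v : L2Space n), 0 < r → IsJet m D →
      (∀ D', IsJet m D' → jetForm m a D D' = inner ℂ (D' 0) v) →
      wsum (rescale r x₀ η₀) D m ^ 2 ≤
        A₁ * (inner ℂ (mulReal (fun x => rescale r x₀ η₀ x ^ (m + 1)) (D 0))
          (mulReal (fun x => rescale r x₀ η₀ x ^ (m + 1)) v)).re +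
        A₂ * (r⁻¹ ^ (2 * m) * ‖mulReal (rescale r x₀ η₀) (D 0)‖ ^ 2) := by
  obtain ⟨A₁, K, hA₁, hK, hlow⟩ := exists_caccioppoli_lower hη hη' ha hE
  have hη₀ := IsMultiplier.of_hasCompactSupport hη hη'
  obtain ⟨M, hM0, hM⟩ : ∃ M : ℝ, 0 ≤ M ∧ ∀ i x, |partialDeriv i η₀ x| ≤ M := by
    choose M hM using hη₀.bdd_deriv
    refine ⟨∑ i, |M i|, Finset.sum_nonneg fun _ _ => abs_nonneg _, fun i x => (hM i x).trans ?_⟩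
    exact (le_abs_self _).trans (Finset.single_le_sum (f := fun i => |M i|)
      (fun _ _ => abs_nonneg _) (Finset.mem_univ i))
  -- `ε` is so small that the top order part of the interpolated remainder can be absorbed
  set ε := 1 / (2 * (K + 1))
  have hε : 0 < ε := by positivity
  have hεK : K * (2 * ε ^ 2) ≤ 1 / 2 := by
    calc K * (2 * ε ^ 2) = K / (K + 1) * (1 / (2 * (K + 1))) := by simp only [ε]; field_simp
      _ ≤ 1 * (1 / 2) := by
          gcongr
          · rw [div_le_one (by positivity)]; linarith
          · linarith
      _ = 1 / 2 := by ring
  obtain ⟨B, hB, hint⟩ := exists_sum_wsum_le n m hM0 hε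
  refine ⟨2 * A₁, 2 * (K * (2 * B ^ 2)), by positivity, by positivity,
    fun r x₀ D v hr hD hv => ?_⟩
  have k3 := hlow r x₀ D v hr hD hv
  have k4 := hint (rescale r x₀ η₀) r D hη₀.rescale hr (fun i x => by
      rw [partialDeriv_rescale hη, abs_mul, abs_of_nonneg (by positivity : 0 ≤ r⁻¹), mul_comm,
        ← div_eq_mul_inv]
      gcongr
      exact hM _ _) hD
  rw [wsum_zero] at k4
  set S := wsum (rescale r x₀ η₀) D m
  set Y := ∑ j ∈ Finset.range m, r ^ j * wsum (rescale r x₀ η₀) D j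
  have hY0 : 0 ≤ Y :=
    Finset.sum_nonneg fun j _ => mul_nonneg (by positivity) (wsum_nonneg _ _ _)
  set N := ‖mulReal (rescale r x₀ η₀) (D 0)‖
  set E := (inner ℂ (mulReal (fun x => rescale r x₀ η₀ x ^ (m + 1)) (D 0))
          (mulReal (fun x => rescale r x₀ η₀ x ^ (m + 1)) v)).re
  have hr1 : r⁻¹ ^ m * r ^ m = 1 := by rw [← mul_pow, inv_mul_cancel₀ hr.ne', one_pow]
  have k5 : r⁻¹ ^ m * Y ≤ ε * S + B * (r⁻¹ ^ m * N) := by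
    calc r⁻¹ ^ m * Y ≤ r⁻¹ ^ m * (ε * (r ^ m * S) + B * N) := by gcongr
      _ = ε * S + B * (r⁻¹ ^ m * N) := by linear_combination (ε * S) * hr1
  rw [show r⁻¹ ^ (2 * m) * N ^ 2 = (r⁻¹ ^ m * N) ^ 2 by ring]
  have k6 : (r⁻¹ ^ m * Y) ^ 2 ≤ 2 * ε ^ 2 * S ^ 2 + 2 * B ^ 2 * (r⁻¹ ^ m * N) ^ 2 := by
    have := pow_le_pow_left₀ (by positivity) k5 2
    nlinarith [sq_nonneg (ε * S - B * (r⁻¹ ^ m * N))]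
  have k7 : K * (r⁻¹ ^ m * Y) ^ 2 ≤ 1 / 2 * S ^ 2 + K * (2 * B ^ 2) * (r⁻¹ ^ m * N) ^ 2 := by
    calc _ ≤ K * (2 * ε ^ 2 * S ^ 2 + 2 * B ^ 2 * (r⁻¹ ^ m * N) ^ 2) := by gcongr
      _ = K * (2 * ε ^ 2) * S ^ 2 + K * (2 * B ^ 2) * (r⁻¹ ^ m * N) ^ 2 := by ring
      _ ≤ _ := by gcongr
  linarith

end Caccioppoli

/-! ### The energy inequality in time -/

section Energy

variable {H : Type*} [NormedAddCommGroup H] [InnerProductSpace ℂ H] {y v : ℝ → H}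

lemma hasDerivWithinAt_norm_sq_comp_pow (P : H →L[ℂ] H)
    (hd : ∀ s, 0 < s → HasDerivWithinAt y (-v s) (Set.Ici s) s) (q : ℕ) {t : ℝ} (ht : 0 < t) :
    HasDerivWithinAt (fun t => ‖P (y (t ^ (q + 1)))‖ ^ 2)
      (-(2 * (q + 1) * t ^ q * (inner ℂ (P (y (t ^ (q + 1)))) (P (v (t ^ (q + 1))))).re))
      (Set.Ici t) t := by
  have h1 : HasDerivWithinAt (fun t : ℝ => t ^ (q + 1)) ((q + 1) * t ^ q) (Set.Ici t) t := by
    simpa using (hasDerivAt_pow (q + 1) t).hasDerivWithinAt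
  have hmaps : Set.MapsTo (fun t : ℝ => t ^ (q + 1)) (Set.Ici t) (Set.Ici (t ^ (q + 1))) :=
    fun s hs => pow_le_pow_left₀ ht.le hs _
  have h2 := HasDerivWithinAt.scomp (h := fun t : ℝ => t ^ (q + 1)) t
    (hd _ (pow_pos ht (q + 1))) h1 hmaps
  have h3 := (P.restrictScalars ℝ).hasFDerivAt.comp_hasDerivWithinAt t h2
  have h4 := hasDerivWithinAt_norm_sq h3
  refine h4.congr_deriv ?_
  simp only [Function.comp_apply, ContinuousLinearMap.coe_restrictScalars', smul_neg, map_neg,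
    inner_neg_right, ← Complex.coe_smul, map_smul, inner_smul_right, Complex.neg_re,
    Complex.re_ofReal_mul]
  ring

/-- The weight `(4r² - (t - t₀)²) t^{-q}` in the energy inequality and its derivative. The factor
`t^{-q}` compensates the derivative of the time change `t ↦ t^{q+1}`. -/
lemma exists_hasDerivAt_weight {r t₀ t : ℝ} (hr : 0 < r) (ht₀ : 3 * r < t₀)
    (ht : t ∈ Set.Icc (t₀ - 2 * r) (t₀ + 2 * r)) (q : ℕ) :
    HasDerivAt (fun t : ℝ => (4 * r ^ 2 - (t - t₀) ^ 2) * t⁻¹ ^ q)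
      (-(2 * (t - t₀)) * t⁻¹ ^ q - (4 * r ^ 2 - (t - t₀) ^ 2) * (q * t⁻¹ ^ (q + 1))) t ∧
    -(2 * (t - t₀)) * t⁻¹ ^ q - (4 * r ^ 2 - (t - t₀) ^ 2) * (q * t⁻¹ ^ (q + 1)) ≤
      4 * (r ^ 2 * r⁻¹ ^ (q + 1)) := by
  obtain ⟨ha, hb⟩ := ht
  have hrt : r ≤ t := by linarith
  have ht0 : 0 < t := hr.trans_le hrt
  constructor
  · have h1 : HasDerivAt (fun t : ℝ => 4 * r ^ 2 - (t - t₀) ^ 2) (-(2 * (t - t₀))) t := by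
      simpa using (((hasDerivAt_id t).sub_const t₀).pow 2).const_sub (4 * r ^ 2)
    have h2 : HasDerivAt (fun t : ℝ => t⁻¹ ^ q) (-(q * t⁻¹ ^ (q + 1))) t := by
      refine ((hasDerivAt_inv ht0.ne').pow q).congr_deriv ?_
      rcases q with _ | q
      · simp
      · simp only [Nat.add_sub_cancel, ← inv_pow]; ring
    exact (h1.mul h2).congr_deriv (by ring)
  · have hz : 0 ≤ 4 * r ^ 2 - (t - t₀) ^ 2 := by nlinarith
    have h1 : 0 ≤ (4 * r ^ 2 - (t - t₀) ^ 2) * (q * t⁻¹ ^ (q + 1)) := by positivity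
    have h2 : -(2 * (t - t₀)) * t⁻¹ ^ q ≤ 4 * r * r⁻¹ ^ q := by
      gcongr
      linarith
    have h3 : 4 * (r ^ 2 * r⁻¹ ^ (q + 1)) = 4 * r * r⁻¹ ^ q := by
      rw [pow_succ r⁻¹, pow_two]
      field_simp
    linarith

lemma integral_weight_mul_inner_le (hy : ContinuousOn y (Set.Ioi 0))
    (hv : ContinuousOn v (Set.Ioi 0))
    (hd : ∀ s, 0 < s → HasDerivWithinAt y (-v s) (Set.Ici s) s) {P R : H →L[ℂ] H}
    (hPR : ∀ x, ‖P x‖ ≤ ‖R x‖) (q : ℕ) {r t₀ : ℝ} (hr : 0 < r) (ht₀ : 3 * r < t₀) :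
    ∫ t in (t₀ - 2 * r)..(t₀ + 2 * r), (4 * r ^ 2 - (t - t₀) ^ 2) *
        (inner ℂ (P (y (t ^ (q + 1)))) (P (v (t ^ (q + 1))))).re ≤
      2 / (q + 1) * (r ^ 2 * r⁻¹ ^ (q + 1)) *
        ∫ t in (t₀ - 2 * r)..(t₀ + 2 * r), ‖R (y (t ^ (q + 1)))‖ ^ 2 := by
  have hab : t₀ - 2 * r ≤ t₀ + 2 * r := by linarith
  have hpos : ∀ t ∈ Set.Icc (t₀ - 2 * r) (t₀ + 2 * r), 0 < t := fun t ht => by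
    linarith [ht.1]
  have hmaps : Set.MapsTo (fun t : ℝ => t ^ (q + 1)) (Set.Icc (t₀ - 2 * r) (t₀ + 2 * r))
      (Set.Ioi 0) := fun t ht => pow_pos (hpos t ht) _
  have hy' : ContinuousOn (fun t => y (t ^ (q + 1))) (Set.Icc (t₀ - 2 * r) (t₀ + 2 * r)) :=
    hy.comp (by fun_prop) hmaps
  have hv' : ContinuousOn (fun t => v (t ^ (q + 1))) (Set.Icc (t₀ - 2 * r) (t₀ + 2 * r)) :=
    hv.comp (by fun_prop) hmaps
  have hinv : ContinuousOn (fun t : ℝ => t⁻¹) (Set.Icc (t₀ - 2 * r) (t₀ + 2 * r)) :=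
    continuousOn_id.inv₀ fun t ht => (hpos t ht).ne'
  have hQ : ContinuousOn (fun t => ‖P (y (t ^ (q + 1)))‖ ^ 2)
      (Set.Icc (t₀ - 2 * r) (t₀ + 2 * r)) := by fun_prop
  have hN : ContinuousOn (fun t => ‖R (y (t ^ (q + 1)))‖ ^ 2)
      (Set.Icc (t₀ - 2 * r) (t₀ + 2 * r)) := by fun_prop
  have hEc : ContinuousOn (fun t => (4 * r ^ 2 - (t - t₀) ^ 2) *
      (inner ℂ (P (y (t ^ (q + 1)))) (P (v (t ^ (q + 1))))).re)
      (Set.Icc (t₀ - 2 * r) (t₀ + 2 * r)) :=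
    ContinuousOn.mul (by fun_prop) (Complex.continuous_re.comp_continuousOn
      ((P.continuous.comp_continuousOn hy').inner (𝕜 := ℂ) (P.continuous.comp_continuousOn hv')))
  set W' : ℝ → ℝ := fun t =>
    -(2 * (t - t₀)) * t⁻¹ ^ q - (4 * r ^ 2 - (t - t₀) ^ 2) * (q * t⁻¹ ^ (q + 1))
  have hW' : ContinuousOn W' (Set.Icc (t₀ - 2 * r) (t₀ + 2 * r)) := by
    simp only [W']; fun_prop
  have hint : ∀ {g : ℝ → ℝ}, ContinuousOn g (Set.Icc (t₀ - 2 * r) (t₀ + 2 * r)) →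
      IntervalIntegrable g volume (t₀ - 2 * r) (t₀ + 2 * r) := fun hg =>
    hg.intervalIntegrable_of_Icc hab
  have hW := fun t ht => exists_hasDerivAt_weight (t := t) hr ht₀ ht q
  have hWQ : IntervalIntegrable (fun t => W' t * ‖P (y (t ^ (q + 1)))‖ ^ 2) volume
      (t₀ - 2 * r) (t₀ + 2 * r) := hint (hW'.mul hQ)
  have hftc := intervalIntegral.integral_eq_sub_of_hasDeriv_right_of_le hab
    (f := fun t => ((4 * r ^ 2 - (t - t₀) ^ 2) * t⁻¹ ^ q) * ‖P (y (t ^ (q + 1)))‖ ^ 2)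
    (f' := fun t => W' t * ‖P (y (t ^ (q + 1)))‖ ^ 2 - 2 * (q + 1) *
      ((4 * r ^ 2 - (t - t₀) ^ 2) * (inner ℂ (P (y (t ^ (q + 1)))) (P (v (t ^ (q + 1))))).re))
    (by fun_prop)
    (fun t ht => by
      have ht' := Set.Ioo_subset_Icc_self ht
      have h0 := hpos t ht'
      have h1 := ((hW t ht').1.hasDerivWithinAt (s := Set.Ioi t)).mul
        ((hasDerivWithinAt_norm_sq_comp_pow P hd q h0).mono Set.Ioi_subset_Ici_self)
      refine h1.congr_deriv ?_
      have h2 : t⁻¹ ^ q * t ^ q = 1 := by rw [← mul_pow, inv_mul_cancel₀ h0.ne', one_pow]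
      simp only [W']
      linear_combination (-(4 * r ^ 2 - (t - t₀) ^ 2) * 2 * (q + 1) *
        (inner ℂ (P (y (t ^ (q + 1)))) (P (v (t ^ (q + 1))))).re) * h2)
    (hWQ.sub ((hint hEc).const_mul _))
  rw [intervalIntegral.integral_sub hWQ ((hint hEc).const_mul _),
    intervalIntegral.integral_const_mul] at hftc
  have hle : ∫ t in (t₀ - 2 * r)..(t₀ + 2 * r), W' t * ‖P (y (t ^ (q + 1)))‖ ^ 2 ≤
      ∫ t in (t₀ - 2 * r)..(t₀ + 2 * r),
        4 * (r ^ 2 * r⁻¹ ^ (q + 1)) * ‖R (y (t ^ (q + 1)))‖ ^ 2 := by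
    refine intervalIntegral.integral_mono_on hab hWQ ((hint hN).const_mul _)
      fun t ht => ?_
    have := (hW t ht).2
    have h2 := hPR (y (t ^ (q + 1)))
    change W' t * _ ≤ _
    gcongr
  rw [intervalIntegral.integral_const_mul] at hle
  set I := ∫ t in (t₀ - 2 * r)..(t₀ + 2 * r), (4 * r ^ 2 - (t - t₀) ^ 2) *
        (inner ℂ (P (y (t ^ (q + 1)))) (P (v (t ^ (q + 1))))).re
  set J := ∫ t in (t₀ - 2 * r)..(t₀ + 2 * r), ‖R (y (t ^ (q + 1)))‖ ^ 2
  have h0 : 2 * ((q : ℝ) + 1) * I ≤ 4 * (r ^ 2 * r⁻¹ ^ (q + 1)) * J := by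
    refine le_trans (le_of_eq ?_) hle
    have e1 : 4 * r ^ 2 - (t₀ + 2 * r - t₀) ^ 2 = 0 := by ring
    have e2 : 4 * r ^ 2 - (t₀ - 2 * r - t₀) ^ 2 = 0 := by ring
    rw [e1, e2] at hftc
    linarith
  calc I = (2 * ((q : ℝ) + 1))⁻¹ * (2 * ((q : ℝ) + 1) * I) := by field_simp
    _ ≤ (2 * ((q : ℝ) + 1))⁻¹ * (4 * (r ^ 2 * r⁻¹ ^ (q + 1)) * J) := by gcongr
    _ = _ := by ring_nf; field_simp; ring

/-- The energy inequality on parabolic cylinders: if a nonnegative quantity `F` is controlled on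
each time slice by the rate of energy loss and by the size of the solution, its integral in time is
controlled by the size of the solution on a longer time interval. -/
lemma lintegral_le_of_slicewise (hy : ContinuousOn y (Set.Ioi 0))
    (hv : ContinuousOn v (Set.Ioi 0))
    (hd : ∀ s, 0 < s → HasDerivWithinAt y (-v s) (Set.Ici s) s) {P R : H →L[ℂ] H}
    (hPR : ∀ x, ‖P x‖ ≤ ‖R x‖) (q : ℕ) {r t₀ A₁ A₂ : ℝ} (hr : 0 < r) (ht₀ : 3 * r < t₀)
    (hA₁ : 0 ≤ A₁) (hA₂ : 0 ≤ A₂) {F K : ℝ → ℝ≥0∞}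
    (h0 : ∀ s, 0 < s →
      0 ≤ A₁ * (inner ℂ (P (y s)) (P (v s))).re + A₂ * (r⁻¹ ^ (q + 1) * ‖R (y s)‖ ^ 2))
    (hF : ∀ t, 0 < t → F t ≤ ENNReal.ofReal
      (A₁ * (inner ℂ (P (y (t ^ (q + 1)))) (P (v (t ^ (q + 1))))).re +
        A₂ * (r⁻¹ ^ (q + 1) * ‖R (y (t ^ (q + 1)))‖ ^ 2)))
    (hK : ∀ t, 0 < t → ENNReal.ofReal (‖R (y (t ^ (q + 1)))‖ ^ 2) ≤ K t) :
    ∫⁻ t in Set.Ioo (t₀ - r) (t₀ + r), F t ≤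
      ENNReal.ofReal (((2 * A₁ / (q + 1) + 4 * A₂) / 3 + 1) / r ^ (q + 1)) *
        ∫⁻ t in Set.Ioo (t₀ - 2 * r) (t₀ + 2 * r), K t := by
  have hab : t₀ - 2 * r ≤ t₀ + 2 * r := by linarith
  set E : ℝ → ℝ := fun t => (inner ℂ (P (y (t ^ (q + 1)))) (P (v (t ^ (q + 1))))).re
  set N : ℝ → ℝ := fun t => ‖R (y (t ^ (q + 1)))‖ ^ 2
  have hpos : ∀ t ∈ Set.Icc (t₀ - 2 * r) (t₀ + 2 * r), 0 < t := fun t ht => by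
    linarith [ht.1]
  have hmaps : Set.MapsTo (fun t : ℝ => t ^ (q + 1)) (Set.Icc (t₀ - 2 * r) (t₀ + 2 * r))
      (Set.Ioi 0) := fun t ht => pow_pos (hpos t ht) _
  have hy' : ContinuousOn (fun t => y (t ^ (q + 1))) (Set.Icc (t₀ - 2 * r) (t₀ + 2 * r)) :=
    hy.comp (by fun_prop) hmaps
  have hv' : ContinuousOn (fun t => v (t ^ (q + 1))) (Set.Icc (t₀ - 2 * r) (t₀ + 2 * r)) :=
    hv.comp (by fun_prop) hmaps
  have hE : ContinuousOn E (Set.Icc (t₀ - 2 * r) (t₀ + 2 * r)) :=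
    Complex.continuous_re.comp_continuousOn
      ((P.continuous.comp_continuousOn hy').inner (𝕜 := ℂ) (P.continuous.comp_continuousOn hv'))
  have hN : ContinuousOn N (Set.Icc (t₀ - 2 * r) (t₀ + 2 * r)) := by
    simp only [N]; fun_prop
  set z : ℝ → ℝ := fun t => 4 * r ^ 2 - (t - t₀) ^ 2
  have hz : Continuous z := by simp only [z]; fun_prop
  have hz0 : ∀ t ∈ Set.Ioo (t₀ - 2 * r) (t₀ + 2 * r), 0 ≤ z t ∧ z t ≤ 4 * r ^ 2 := fun t ht =>
    ⟨by simp only [z]; nlinarith [ht.1, ht.2], by simp only [z]; nlinarith⟩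
  set c := r⁻¹ ^ (q + 1) with hc
  have hc0 : 0 < c := by positivity
  set h : ℝ → ℝ := fun t => A₁ * E t + A₂ * (c * N t)
  have hh0 : ∀ t, 0 < t → 0 ≤ h t := fun t ht => h0 _ (pow_pos ht _)
  have hN0 : ∀ t, 0 ≤ N t := fun t => sq_nonneg _
  have hint : ∀ {g : ℝ → ℝ}, ContinuousOn g (Set.Icc (t₀ - 2 * r) (t₀ + 2 * r)) →
      IntegrableOn g (Set.Ioo (t₀ - 2 * r) (t₀ + 2 * r)) := fun hg =>
    hg.integrableOn_Icc.mono_set Set.Ioo_subset_Icc_self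
  have hzh : ContinuousOn (fun t => (3 * r ^ 2)⁻¹ * (z t * h t))
      (Set.Icc (t₀ - 2 * r) (t₀ + 2 * r)) := by
    simp only [h]; fun_prop
  -- the comparison of integrals of continuous functions
  have key : ∫ t in Set.Ioo (t₀ - 2 * r) (t₀ + 2 * r), (3 * r ^ 2)⁻¹ * (z t * h t) ≤
      ((2 * A₁ / (q + 1) + 4 * A₂) / 3) * c * ∫ t in Set.Ioo (t₀ - 2 * r) (t₀ + 2 * r), N t := by
    have h1 := integral_weight_mul_inner_le hy hv hd hPR q hr ht₀
    rw [intervalIntegral.integral_of_le hab, intervalIntegral.integral_of_le hab,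
      integral_Ioc_eq_integral_Ioo, integral_Ioc_eq_integral_Ioo] at h1
    change ∫ t in Set.Ioo (t₀ - 2 * r) (t₀ + 2 * r), z t * E t ≤
      2 / ((q : ℝ) + 1) * (r ^ 2 * c) * ∫ t in Set.Ioo (t₀ - 2 * r) (t₀ + 2 * r), N t at h1
    have h2 : ∫ t in Set.Ioo (t₀ - 2 * r) (t₀ + 2 * r), z t * h t ≤
        ∫ t in Set.Ioo (t₀ - 2 * r) (t₀ + 2 * r),
          (A₁ * (z t * E t) + 4 * A₂ * (r ^ 2 * c) * N t) := by
      refine setIntegral_mono_on (hint (by simp only [h]; fun_prop)) (hint (by fun_prop))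
        measurableSet_Ioo fun t ht => ?_
      have e1 : z t * (A₂ * (c * N t)) ≤ 4 * r ^ 2 * (A₂ * (c * N t)) :=
        mul_le_mul_of_nonneg_right (hz0 t ht).2 (mul_nonneg hA₂ (mul_nonneg hc0.le (hN0 t)))
      calc z t * h t = A₁ * (z t * E t) + z t * (A₂ * (c * N t)) := by simp only [h]; ring
        _ ≤ A₁ * (z t * E t) + 4 * r ^ 2 * (A₂ * (c * N t)) := by gcongr
        _ = _ := by ring
    rw [integral_add (hint (by fun_prop)) (hint (by fun_prop)), integral_const_mul,
      integral_const_mul] at h2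
    set J := ∫ t in Set.Ioo (t₀ - 2 * r) (t₀ + 2 * r), N t
    rw [integral_const_mul]
    calc _ ≤ (3 * r ^ 2)⁻¹ * (A₁ * (2 / ((q : ℝ) + 1) * (r ^ 2 * c) * J) +
          4 * A₂ * (r ^ 2 * c) * J) := by
          gcongr
          exact h2.trans (by gcongr)
      _ = _ := by field_simp
  calc ∫⁻ t in Set.Ioo (t₀ - r) (t₀ + r), F t
      ≤ ∫⁻ t in Set.Ioo (t₀ - r) (t₀ + r), ENNReal.ofReal ((3 * r ^ 2)⁻¹ * (z t * h t)) := by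
        refine setLIntegral_mono' measurableSet_Ioo fun t ht => ?_
        have ht0 : 0 < t := by linarith [ht.1]
        refine (hF t ht0).trans (ENNReal.ofReal_le_ofReal ?_)
        rw [le_inv_mul_iff₀ (by positivity)]
        -- the weight is at least `3 r²` on the short interval
        have : 3 * r ^ 2 ≤ z t := by simp only [z]; nlinarith [ht.1, ht.2]
        exact mul_le_mul_of_nonneg_right this (hh0 t ht0)
    _ ≤ ∫⁻ t in Set.Ioo (t₀ - 2 * r) (t₀ + 2 * r), ENNReal.ofReal ((3 * r ^ 2)⁻¹ * (z t * h t)) :=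
        lintegral_mono_set (Set.Ioo_subset_Ioo (by linarith) (by linarith))
    _ = ENNReal.ofReal (∫ t in Set.Ioo (t₀ - 2 * r) (t₀ + 2 * r), (3 * r ^ 2)⁻¹ * (z t * h t)) := by
        rw [ofReal_integral_eq_lintegral_ofReal (hint hzh)]
        refine (ae_restrict_iff' measurableSet_Ioo).2 (.of_forall fun t ht => ?_)
        exact mul_nonneg (by positivity) (mul_nonneg (hz0 t ht).1
          (hh0 t (hpos t (Set.Ioo_subset_Icc_self ht))))
    _ ≤ ENNReal.ofReal (((2 * A₁ / (q + 1) + 4 * A₂) / 3 + 1) / r ^ (q + 1) *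
          ∫ t in Set.Ioo (t₀ - 2 * r) (t₀ + 2 * r), N t) := by
        refine ENNReal.ofReal_le_ofReal (key.trans ?_)
        have hJ : 0 ≤ ∫ t in Set.Ioo (t₀ - 2 * r) (t₀ + 2 * r), N t := integral_nonneg hN0
        rw [div_eq_mul_inv _ (r ^ (q + 1)), ← inv_pow, ← hc]
        gcongr
        linarith
    _ = ENNReal.ofReal (((2 * A₁ / (q + 1) + 4 * A₂) / 3 + 1) / r ^ (q + 1)) *
          ∫⁻ t in Set.Ioo (t₀ - 2 * r) (t₀ + 2 * r), ENNReal.ofReal (N t) := by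
        rw [ENNReal.ofReal_mul (by positivity),
          ofReal_integral_eq_lintegral_ofReal (hint hN) (.of_forall hN0)]
    _ ≤ _ := by
        gcongr 1
        exact setLIntegral_mono' measurableSet_Ioo fun t ht =>
          hK t (hpos t (Set.Ioo_subset_Icc_self ht))

end Energy

/-! ### The parabolic Caccioppoli inequality -/

section Parabolic

variable {n m : ℕ} {a : (Fin n → ℕ) → (Fin n → ℕ) → EuclideanSpace ℝ (Fin n) → ℂ}

lemma lintegral_enorm_sq (w : L2Space n) : ∫⁻ x, ‖w x‖ₑ ^ 2 = ENNReal.ofReal (‖w‖ ^ 2) := by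
  rw [← integral_norm_sq, ofReal_integral_eq_lintegral_ofReal
    ((memLp_two_iff_integrable_sq_norm (Lp.aestronglyMeasurable w)).1 (Lp.memLp w))
    (.of_forall fun _ => sq_nonneg _)]
  simp_rw [ENNReal.ofReal_pow (norm_nonneg _), ofReal_norm]

lemma setLIntegral_enorm_sq_le {b : EuclideanSpace ℝ (Fin n) → ℝ} (hb : IsMultiplier b)
    {s : Set (EuclideanSpace ℝ (Fin n))} (hs : MeasurableSet s) (h1 : ∀ x ∈ s, b x = 1)
    (w : L2Space n) : ∫⁻ x in s, ‖w x‖ₑ ^ 2 ≤ ENNReal.ofReal (‖mulReal b w‖ ^ 2) := by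
  rw [← lintegral_enorm_sq]
  refine le_trans (le_of_eq ?_) (setLIntegral_le_lintegral s _)
  refine lintegral_congr_ae ((ae_restrict_iff' hs).2 ?_)
  filter_upwards [coeFn_mulOp hb.memLp w] with x hx hxs
  rw [hx, h1 x hxs]
  simp

lemma ofReal_norm_mulReal_sq_le {b : EuclideanSpace ℝ (Fin n) → ℝ} (hb : IsMultiplier b)
    {s : Set (EuclideanSpace ℝ (Fin n))} (hs : MeasurableSet s) (h0 : ∀ x ∉ s, b x = 0)
    (h1 : ∀ x, |b x| ≤ 1) (w : L2Space n) :
    ENNReal.ofReal (‖mulReal b w‖ ^ 2) ≤ ∫⁻ x in s, ‖w x‖ₑ ^ 2 := by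
  rw [← lintegral_enorm_sq, ← lintegral_indicator hs]
  refine lintegral_mono_ae ?_
  filter_upwards [coeFn_mulOp hb.memLp w] with x hx
  rw [hx]
  by_cases hxs : x ∈ s
  · rw [Set.indicator_of_mem hxs]
    gcongr
    rw [enorm_mul]
    refine mul_le_of_le_one_left' ?_
    rw [← ofReal_norm, Complex.norm_real, Real.norm_eq_abs]
    exact ENNReal.ofReal_le_one.2 (h1 x)
  · rw [h0 x hxs]
    simp

/-- On a time slice, the gradient on a ball is controlled by the localized jet. -/
lemma lintegral_ball_le_wsum {η : EuclideanSpace ℝ (Fin n) → ℝ} (hη : IsMultiplier η)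
    {s : Set (EuclideanSpace ℝ (Fin n))} (hs : MeasurableSet s) (h1 : ∀ x ∈ s, η x = 1)
    {D : (Fin n → ℕ) → L2Space n} (hD : IsJet m D) :
    ∫⁻ x in s, ∑ α ∈ multiIndices n m, ‖weakDeriv α (D 0) x‖ₑ ^ 2 ≤
      ENNReal.ofReal (wsum η D m ^ 2) := by
  have e1 : ∫⁻ x in s, ∑ α ∈ multiIndices n m, ‖weakDeriv α (D 0) x‖ₑ ^ 2 =
      ∫⁻ x in s, ∑ α ∈ multiIndices n m, ‖D α x‖ₑ ^ 2 := by
    refine lintegral_congr_ae (ae_restrict_of_ae ?_)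
    have : ∀ᵐ x, ∀ α ∈ multiIndices n m, weakDeriv α (D 0) x = D α x :=
      (ae_ball_iff (Finset.countable_toSet _)).2 fun α hα =>
        hD.isJetOf.weakDeriv_ae_eq (mem_multiIndices.1 hα).le
    filter_upwards [this] with x hx
    exact Finset.sum_congr rfl fun α hα => by rw [hx α hα]
  rw [e1, lintegral_finsetSum' _ fun α _ =>
    ((Lp.aestronglyMeasurable (D α)).enorm.pow_const 2).restrict]
  calc _ ≤ ∑ α ∈ multiIndices n m,
        ENNReal.ofReal (‖mulReal (fun x => η x ^ (m + 1)) (D α)‖ ^ 2) :=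
        Finset.sum_le_sum fun α _ =>
          setLIntegral_enorm_sq_le (hη.pow (m + 1)) hs (fun x hx => by rw [h1 x hx, one_pow]) _
    _ = ENNReal.ofReal (∑ α ∈ multiIndices n m,
          ‖mulReal (fun x => η x ^ (m + 1)) (D α)‖ ^ 2) :=
        (ENNReal.ofReal_sum_of_nonneg fun _ _ => sq_nonneg _).symm
    _ ≤ _ := ENNReal.ofReal_le_ofReal (Finset.sum_sq_le_sq_sum_of_nonneg fun _ _ => norm_nonneg _)

/-- A cutoff function between the unit ball and the ball of radius two. -/
lemma exists_cutoff (n : ℕ) : ∃ η : EuclideanSpace ℝ (Fin n) → ℝ, ContDiff ℝ ∞ η ∧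
    HasCompactSupport η ∧ (∀ x, 0 ≤ η x ∧ η x ≤ 1) ∧ (∀ x ∈ Metric.ball 0 1, η x = 1) ∧
    ∀ x ∉ Metric.ball 0 2, η x = 0 := by
  let η : ContDiffBump (0 : EuclideanSpace ℝ (Fin n)) := ⟨1, 2, one_pos, one_lt_two⟩
  refine ⟨η, η.contDiff, η.hasCompactSupport, fun x => ⟨η.nonneg, η.le_one⟩,
    fun x hx => η.one_of_mem_closedBall (Metric.ball_subset_closedBall hx), fun x hx => ?_⟩
  rw [← Function.notMem_support, η.support_eq]
  exact hx

lemma inv_smul_sub_mem_ball_iff {ρ r : ℝ} {x₀ x : EuclideanSpace ℝ (Fin n)} (hr : 0 < r) :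
    r⁻¹ • (x - x₀) ∈ Metric.ball 0 ρ ↔ x ∈ Metric.ball x₀ (ρ * r) := by
  rw [mem_ball_zero_iff, norm_smul, Real.norm_of_nonneg (by positivity), inv_mul_lt_iff₀ hr,
    mul_comm, mem_ball_iff_norm]

lemma isSemigroupOfNeg_expNeg
    (ha : ∀ α ∈ multiIndices n m, ∀ β ∈ multiIndices n m, MemLp (a α β) ∞ volume)
    (hE : EllipticityCondition m a) :
    IsSemigroupOfNeg (ellipticOperatorGraph m a) (expNeg (ellipticOperatorGraph m a)) := by
  have h : ∃ S : ℝ → L2Space n →L[ℂ] L2Space n, IsSemigroupOfNeg (ellipticOperatorGraph m a) S :=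
    (isMAccretive_ellipticGraph ha hE).exists_semigroup
  rw [expNeg, dif_pos h]
  exact h.choose_spec

/-- The orbits of the semigroup are regular for positive times, since the form is sectorial. -/
lemma exists_continuousOn_operator
    (ha : ∀ α ∈ multiIndices n m, ∀ β ∈ multiIndices n m, MemLp (a α β) ∞ volume)
    (hE : EllipticityCondition m a) (f : L2Space n) :
    ContinuousOn (fun s => expNeg (ellipticOperatorGraph m a) s f) (Set.Ioi 0) ∧
    ∃ v : ℝ → L2Space n, ContinuousOn v (Set.Ioi 0) ∧ ∀ t, 0 < t →
      (expNeg (ellipticOperatorGraph m a) t f, v t) ∈ ellipticOperatorGraph m a ∧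
      HasDerivWithinAt (fun s => expNeg (ellipticOperatorGraph m a) s f) (-v t) (Set.Ici t) t := by
  have hG := isMAccretive_ellipticGraph ha hE
  have hS : IsSemigroupOfNeg (ellipticGraph m a ha : Set (L2Space n × L2Space n))
    (expNeg (ellipticOperatorGraph m a)) := isSemigroupOfNeg_expNeg ha hE
  have hform : ∀ u v : L2Space n, (u, v) ∈ ellipticOperatorGraph m a → ∀ w : L2Space n,
      MemSobolev m w → ellipticForm m a u w = inner ℂ w v := fun u v huv w hw => by
    rw [huv.2 w hw, L2.inner_def]; rfl
  refine ⟨fun t ht => ?_, ?_⟩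
  · exact ((IsSemigroupOfNeg.continuousOn_Icc hS hG f (t + 1)).continuousAt
      (Icc_mem_nhds ht (by linarith))).continuousWithinAt
  · obtain ⟨lam, Lam, hlam, -, hupper, hlower⟩ := hE
    refine IsSemigroupOfNeg.exists_continuousOn_generator hS hG
      (p := fun u => gradNorm m u) (Lam := Lam) hlam
      (fun u v huv => ?_) (fun u v u' v' huv huv' => ?_) f
    · rw [← hform u v huv u huv.1]
      exact hlower _ (MemSobolev.memHomSobolev huv.1)
    · rw [← hform u v huv u' huv'.1]
      exact hupper _ _ (MemSobolev.memHomSobolev huv.1) (MemSobolev.memHomSobolev huv'.1)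

/-- The parabolic Caccioppoli inequality: `exists_spatial_caccioppoli` on each time slice, with
`v = L u`, inserted in the energy inequality in time. -/
theorem exists_parabolic_caccioppoli (hm : 0 < m)
    (ha : ∀ α ∈ multiIndices n m, ∀ β ∈ multiIndices n m, MemLp (a α β) ∞ volume)
    (hE : EllipticityCondition m a) :
    ∃ C : ℝ, 0 < C ∧
      ∀ (f : L2Space n) (x₀ : EuclideanSpace ℝ (Fin n)) (r t₀ : ℝ), 0 < r → 3 * r < t₀ →
        ∫⁻ t in Set.Ioo (t₀ - r) (t₀ + r), ∫⁻ x in Metric.ball x₀ r,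
            ∑ α ∈ multiIndices n m, ‖weakDeriv α (heatExtension m a f t) x‖ₑ ^ 2
          ≤ ENNReal.ofReal (C / r ^ (2 * m)) *
            ∫⁻ t in Set.Ioo (t₀ - 2 * r) (t₀ + 2 * r), ∫⁻ x in Metric.ball x₀ (2 * r),
              ‖heatExtension m a f t x‖ₑ ^ 2 := by
  obtain ⟨η₀, hη, hη', h01, hone, hzero⟩ := exists_cutoff n
  obtain ⟨A₁, A₂, hA₁, hA₂, hspat⟩ := exists_spatial_caccioppoli hη hη' ha hE
  obtain ⟨q, hq⟩ : ∃ q, 2 * m = q + 1 := ⟨2 * m - 1, by omega⟩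
  refine ⟨(2 * A₁ / (q + 1) + 4 * A₂) / 3 + 1, by positivity, fun f x₀ r t₀ hr ht₀ => ?_⟩
  obtain ⟨hy, v, hv, hvG⟩ := exists_continuousOn_operator ha hE f
  have hη₀ : IsMultiplier (rescale r x₀ η₀) := (IsMultiplier.of_hasCompactSupport hη hη').rescale
  have hbd : ∀ x, 0 ≤ rescale r x₀ η₀ x ∧ rescale r x₀ η₀ x ≤ 1 := fun x => h01 _
  have hPR : ∀ u : L2Space n, ‖mulReal (fun x => rescale r x₀ η₀ x ^ (m + 1)) u‖ ≤
      ‖mulReal (rescale r x₀ η₀) u‖ := fun u => by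
    rw [← one_mul ‖mulReal (rescale r x₀ η₀) u‖]
    refine norm_mulOp_le (hη₀.pow (m + 1)).memLp hη₀.memLp (.of_forall fun x => ?_) u
    rw [Complex.norm_real, Complex.norm_real, Real.norm_of_nonneg (pow_nonneg (hbd x).1 _),
      Real.norm_of_nonneg (hbd x).1, one_mul]
    exact pow_le_of_le_one (hbd x).1 (hbd x).2 (by omega)
  -- the inequality on the slice at time `s`, with the original time variable of the semigroup
  have hslice : ∀ s, 0 < s → ∃ D, IsJet m D ∧ D 0 = expNeg (ellipticOperatorGraph m a) s f ∧
      wsum (rescale r x₀ η₀) D m ^ 2 ≤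
        A₁ * (inner ℂ (mulReal (fun x => rescale r x₀ η₀ x ^ (m + 1))
            (expNeg (ellipticOperatorGraph m a) s f))
          (mulReal (fun x => rescale r x₀ η₀ x ^ (m + 1)) (v s))).re +
        A₂ * (r⁻¹ ^ (q + 1) * ‖mulReal (rescale r x₀ η₀)
          (expNeg (ellipticOperatorGraph m a) s f)‖ ^ 2) := fun s hs => by
    obtain ⟨D, hD, hD0, hDv⟩ := (mem_ellipticOperatorGraph ha).1 (hvG s hs).1
    refine ⟨D, hD, hD0, ?_⟩
    rw [← hD0, ← hq]
    exact hspat r x₀ D (v s) hr hD hDv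
  rw [hq]
  refine lintegral_le_of_slicewise hy hv (fun s hs => (hvG s hs).2) hPR q hr ht₀ hA₁ hA₂
    (fun s hs => ?_) (fun t ht => ?_) fun t _ => ?_
  · obtain ⟨D, -, -, hle⟩ := hslice s hs
    exact (sq_nonneg _).trans hle
  · obtain ⟨D, hD, hD0, hle⟩ := hslice (t ^ (q + 1)) (pow_pos ht _)
    refine le_trans ?_ (ENNReal.ofReal_le_ofReal hle)
    rw [heatExtension, hq, ← hD0]
    exact lintegral_ball_le_wsum hη₀ measurableSet_ball
      (fun x hx => hone _ ((inv_smul_sub_mem_ball_iff hr).2 (by rwa [one_mul]))) hD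
  · rw [heatExtension, hq]
    exact ofReal_norm_mulReal_sq_le hη₀ measurableSet_ball
      (fun x hx => hzero _ fun h => hx ((inv_smul_sub_mem_ball_iff hr).1 h))
      (fun x => abs_le.2 ⟨by linarith [(hbd x).1], (hbd x).2⟩) _

end Parabolic

theorem mainTheorem5 (n m : ℕ) (hm : 0 < m)
    (a : (Fin n → ℕ) → (Fin n → ℕ) → EuclideanSpace ℝ (Fin n) → ℂ)
    (ha : ∀ α ∈ multiIndices n m, ∀ β ∈ multiIndices n m, MemLp (a α β) ∞ volume)
    (hE : EllipticityCondition m a) :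
    IsSemigroupOfNeg (ellipticOperatorGraph m a) (expNeg (ellipticOperatorGraph m a)) ∧
    (∀ (f : L2Space n) (t : ℝ), 0 < t → MemSobolev m (heatExtension m a f t)) ∧
    ∃ C : ℝ, 0 < C ∧
      ∀ (f : L2Space n) (x₀ : EuclideanSpace ℝ (Fin n)) (r t₀ : ℝ), 0 < r → 3 * r < t₀ →
        ∫⁻ t in Set.Ioo (t₀ - r) (t₀ + r), ∫⁻ x in Metric.ball x₀ r,
            ∑ α ∈ multiIndices n m, ‖weakDeriv α (heatExtension m a f t) x‖ₑ ^ 2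
          ≤ ENNReal.ofReal (C / r ^ (2 * m)) *
            ∫⁻ t in Set.Ioo (t₀ - 2 * r) (t₀ + 2 * r), ∫⁻ x in Metric.ball x₀ (2 * r),
              ‖heatExtension m a f t x‖ₑ ^ 2 := by
  refine ⟨isSemigroupOfNeg_expNeg ha hE, fun f t ht => ?_, exists_parabolic_caccioppoli hm ha hE⟩
  obtain ⟨-, v, -, hv⟩ := exists_continuousOn_operator ha hE f
  exact (hv (t ^ (2 * m)) (pow_pos ht _)).1.1
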